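/- **Generalised triangulations.** An $n$-tetrahedron triangulation $\mathfrak T$ of a closed $3$-manifold consists of $n$ abstract tetrahedra and $2n$ affine gluing maps that identify their $4n$ triangular faces in pairs, such that the quotient space is a closed topological $3$-manifold (not necessarily orientable). $V,E,F,T$ denote the sets of vertices, edges and triangles of the tetrahedra modulo the gluings, and the set of tetrahedra; $\mathfrak T$ is *$1$-vertex* if $|V|=1$. $\beta_1(\mathfrak T,\mathbb Z_2)=\dim_{\mathbb Z_2}H_1(\mathfrak T,\mathbb Z_2)$ is computed from the cellular chain complex of $\mathfrak T$. **Turaev–Viro invariants.** Let $r\ge 3$, $0<q<2r$, $\gcd(r,q)=1$, $\zeta=e^{i\pi q/r}$, $[0]=1$, $[k]=(\zeta^k-\zeta^{-k})/(\zeta-\zeta^{-1})$ for $k\ge1$, and $[k]!=[k][k-1]\cdots[0]$. A colouring $\theta:E\to\{0,\frac12,1,\dots,\frac{r-2}2\}$ is admissible if the colours $i,j,k$ of the edges of every triangle satisfy $i+j+k\in\mathbb Z$, the three triangle inequalities, and $i+j+k\le r-2$. The weights are $|w|_\theta=|\zeta-\zeta^{-1}|^2/(2r)$ for a vertex, $|e|_\theta=(-1)^{2i}[2i+1]$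 for an edge of colour $i$, $$|f|_\theta=(-1)^{i+j+k}\frac{[i+j-k]!\,[i+k-j]!\,[j+k-i]!}{[i+j+k+1]!}$$ for a triangle with colours $i,j,k$, and, for a tetrahedron with colours $i_0,\dots,i_5$, triangles $(i_0,i_1,i_3),(i_0,i_2,i_4),(i_1,i_2,i_5),(i_3,i_4,i_5)$ and opposite pairs $(i_0,i_5),(i_1,i_4),(i_2,i_3)$, $$|t|_\theta=\sum_{z}\frac{(-1)^z[z+1]!}{\prod_{a}[z-a]!\;\prod_{b}[b-z]!},$$ where $a$ runs over the four sums of the colours of a triangle, $b$ over the three sums of the colours of two opposite pairs, and $z$ over the integers with $\max a\le z\le\min b$. Then $$\mathrm{TV}_{r,q}(\mathfrak T)=\sum_{\theta\text{ admissible}}\ \prod_{w\in V}|w|_\theta\prod_{e\in E}|e|_\theta\prod_{f\in F}|f|_\theta\prod_{t\in T}|t|_\theta .$$ **Machine model.** Algorithms are programs for a word RAM: on an input with $n$ tetrahedra a word has $O(\log n)$ bits (more precisely, it holds a natural number of size at most $(n+1)^{O(1)}$), each arithmetic operation, comparison or memory access on words costs one time step, and space is the number of memory words used. The input is the table of the gluing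 maps of $\mathfrak T$, together with $n$ and $q$. The output is an exact representation $(\pm A\pm B\sqrt 2)/2^k$ of a number, with the natural numbers $A,B$ given by their binary digits, one per word. **Theorem.** There is an algorithm that, given $q\in\{1,3\}$ and a $1$-vertex $n$-tetrahedron triangulation $\mathfrak T$ of a closed $3$-manifold, computes $\mathrm{TV}_{4,q}(\mathfrak T)$ in time $O\big(2^{\beta_1(\mathfrak T,\mathbb Z_2)}\,n^3\big)$ and space $O(n^2)$. The constants in the $O$'s are absolute: they depend neither on $\mathfrak T$, nor on $n$, nor on $q$. -/

import Mathlib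

/-! ## Generalised triangulations

A generalised triangulation glues the `4 n` triangular faces of `n` abstract tetrahedra in pairs.
The vertices of every tetrahedron are labelled by `Fin 4`, and "face `i`" of a tetrahedron is the
triangle opposite its vertex `i`. -/

/-- Face `i` of tetrahedron `t` is glued to face `glue t i i` of tetrahedron `adj t i`; every vertex
`v ≠ i` of `t` is sent to the vertex `glue t i v` of `adj t i`.  The face pairing is an involution
without fixed points, so the `4 n` faces are identified in `2 n` pairs. -/
structure Triangulation (n : ℕ) where
  adj : Fin n → Fin 4 → Fin n
  glue : Fin n → Fin 4 → Equiv.Perm (Fin 4)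
  adj_adj : ∀ t i, adj (adj t i) (glue t i i) = t
  glue_glue : ∀ t i, glue (adj t i) (glue t i i) = (glue t i)⁻¹
  no_fixed_face : ∀ t i, (adj t i, glue t i i) ≠ (t, i)

namespace Triangulation

variable {n : ℕ}

/-! ### The underlying topological space -/

/-- A point `x` on face `i` of tetrahedron `t` (barycentric coordinates, so `x i = 0`) is identified
with the point of the tetrahedron `adj t i` to which the affine gluing map sends it. -/
def PointRel (T : Triangulation n) (p p' : Fin n × stdSimplex ℝ (Fin 4)) : Prop :=
  ∃ i : Fin 4, p.2.1 i = 0 ∧ p'.1 = T.adj p.1 i ∧ ∀ v, p'.2.1 (T.glue p.1 i v) = p.2.1 v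

/-- The underlying space: `n` disjoint tetrahedra modulo the gluing maps, with the quotient
topology. -/
abbrev Space (T : Triangulation n) : Type := Quot T.PointRel

/-- The underlying space is a closed topological `3`-manifold. -/
structure IsClosedManifold (T : Triangulation n) : Prop where
  compact : CompactSpace T.Space
  hausdorff : T2Space T.Space
  secondCountable : SecondCountableTopology T.Space
  locallyEuclidean : Nonempty (ChartedSpace (EuclideanSpace ℝ (Fin 3)) T.Space)

/-! ### Vertices, edges, triangles -/

/-- The `k`-dimensional faces of the single tetrahedra, before gluing. -/
abbrev LocalFace (n k : ℕ) : Type := Fin n × {s : Finset (Fin 4) // s.card = k + 1}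

/-- The gluing along face `i` identifies those faces of the two tetrahedra that avoid vertex `i`. -/
def FaceRel (T : Triangulation n) (k : ℕ) (f f' : LocalFace n k) : Prop :=
  ∃ i : Fin 4, i ∉ f.2.1 ∧ f'.1 = T.adj f.1 i ∧ f'.2.1 = f.2.1.map (T.glue f.1 i).toEmbedding

/-- The `k`-dimensional faces of the triangulation (vertices for `k = 0`, edges for `k = 1`,
triangles for `k = 2`): classes of faces of tetrahedra under the gluing maps. -/
abbrev Face (T : Triangulation n) (k : ℕ) : Type := Quot (T.FaceRel k)

instance (T : Triangulation n) (k : ℕ) : Finite (T.Face k) :=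
  Quot.finite (T.FaceRel k)

noncomputable instance (T : Triangulation n) (k : ℕ) : Fintype (T.Face k) := Fintype.ofFinite _

/-- All vertices of all tetrahedra are identified to one point. -/
def IsOneVertex (T : Triangulation n) : Prop := Nat.card (T.Face 0) = 1

/-- The class of the edge of tetrahedron `t` with end points `a ≠ b`. -/
def edge (T : Triangulation n) (t : Fin n) (a b : Fin 4) (h : a ≠ b) : T.Face 1 :=
  Quot.mk _ (t, ⟨{a, b}, Finset.card_pair h⟩)

/-- The facets of a local face: leave out one vertex. -/
def localFacets (T : Triangulation n) {k : ℕ} (f : LocalFace n (k + 1)) : Multiset (T.Face k) :=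
  (Finset.univ : Finset {v // v ∈ f.2.1}).val.map fun v =>
    Quot.mk _ (f.1, ⟨f.2.1.erase v.1, by rw [Finset.card_erase_of_mem v.2, f.2.2]; rfl⟩)

theorem localFacets_eq (T : Triangulation n) {k : ℕ} (f f' : LocalFace n (k + 1))
    (h : T.FaceRel (k + 1) f f') : T.localFacets f = T.localFacets f' := by
  obtain ⟨t, s, hs⟩ := f
  obtain ⟨t', s', hs'⟩ := f'
  obtain ⟨i, hi, h1, h2⟩ := h
  dsimp only at hi h1 h2
  subst h1
  subst h2
  let e : {v // v ∈ s} ≃ {v // v ∈ s.map (T.glue t i).toEmbedding} :=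
    (T.glue t i).subtypeEquiv (by intro a; simp)
  unfold localFacets
  dsimp only
  rw [← Multiset.map_univ_val_equiv e]
  refine Eq.trans ?_ (Multiset.map_map _ _ _).symm
  refine Multiset.map_congr rfl fun v _ => ?_
  refine Quot.sound ⟨i, fun hh => hi (Finset.mem_of_mem_erase hh), rfl, ?_⟩
  dsimp only [Function.comp]
  rw [Finset.map_erase]
  rfl

/-- The `k + 2` facets of a `(k + 1)`-face, with multiplicity (several facets of the same face may
be identified). -/
def facets (T : Triangulation n) {k : ℕ} (f : T.Face (k + 1)) : Multiset (T.Face k) :=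
  Quot.lift T.localFacets T.localFacets_eq f

/-! ### Homology with coefficients in `ℤ/2` -/

/-- The boundary operator from `(k + 1)`-chains to `k`-chains with coefficients in `ℤ/2`. -/
noncomputable def boundary (T : Triangulation n) (k : ℕ) :
    (T.Face (k + 1) →₀ ZMod 2) →ₗ[ZMod 2] (T.Face k →₀ ZMod 2) :=
  Finsupp.linearCombination (ZMod 2) fun f =>
    ((T.facets f).map fun g => Finsupp.single g (1 : ZMod 2)).sum

/-- The first homology group with coefficients in `ℤ/2`: `1`-cycles modulo boundaries of
`2`-chains. -/
abbrev H1 (T : Triangulation n) : Type :=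
  (LinearMap.ker (T.boundary 0) : Submodule (ZMod 2) (T.Face 1 →₀ ZMod 2)) ⧸
    ((LinearMap.range (T.boundary 1)).comap (LinearMap.ker (T.boundary 0)).subtype :
      Submodule (ZMod 2) (LinearMap.ker (T.boundary 0)))

/-- The first Betti number `β₁(T, ℤ/2)`. -/
noncomputable def betti1 (T : Triangulation n) : ℕ := Module.finrank (ZMod 2) T.H1

end Triangulation

/-! ## Turaev–Viro invariants -/

namespace TuraevViro

/-- `ζ = exp (i π q / r)`. -/
noncomputable def zeta (r q : ℕ) : ℂ := Complex.exp (Complex.I * Real.pi * q / r)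

/-- The quantum integer `[k]`, with the convention `[0] = 1`. -/
noncomputable def bracket (r q k : ℕ) : ℂ :=
  if k = 0 then 1
  else (zeta r q ^ k - (zeta r q)⁻¹ ^ k) / (zeta r q - (zeta r q)⁻¹)

/-- The bracket factorial `[k]! = [k] [k - 1] ⋯ [0]`. -/
noncomputable def bracketFact (r q k : ℕ) : ℂ := ∏ j ∈ Finset.range (k + 1), bracket r q j

end TuraevViro

namespace Triangulation

open TuraevViro

variable {n : ℕ}

/-- A colouring of the edges by `I = {0, 1/2, 1, …, (r - 2)/2}`.  A colour `i ∈ I` is stored as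
the natural number `2 i ∈ {0, …, r - 2}`, here and in all formulas below. -/
abbrev Colouring (T : Triangulation n) (r : ℕ) : Type := T.Face 1 → Fin (r - 1)

/-- Admissibility: for the three edges of any triangle, in any order, the parity condition, the
triangle inequality and the upper bound constraint. -/
def Admissible (T : Triangulation n) (r : ℕ) (θ : T.Colouring r) : Prop :=
  ∀ (f : T.Face 2) (e₁ e₂ e₃ : T.Face 1), T.facets f = {e₁, e₂, e₃} →
    Even ((θ e₁ : ℕ) + θ e₂ + θ e₃) ∧
    (θ e₁ : ℕ) ≤ θ e₂ + θ e₃ ∧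
    (θ e₁ : ℕ) + θ e₂ + θ e₃ ≤ 2 * (r - 2)

/-- Weight of a vertex: `|ζ - ζ⁻¹|² / (2 r)`. -/
noncomputable def vertexWeight (r q : ℕ) : ℂ :=
  ((‖zeta r q - (zeta r q)⁻¹‖ ^ 2 / (2 * r) : ℝ) : ℂ)

/-- Weight of an edge of colour `i = c / 2`: `(-1)^(2 i) [2 i + 1]`. -/
noncomputable def edgeWeight (r q c : ℕ) : ℂ := (-1) ^ c * bracket r q (c + 1)

/-- Weight of a triangle with colours `i, j, k`, given as the multiset `m = {2 i, 2 j, 2 k}`: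
`(-1)^(i+j+k) [i+j-k]! [i+k-j]! [j+k-i]! / [i+j+k+1]!`.
Here `m.sum / 2 = i + j + k` and `m.sum / 2 - 2 k = i + j - k`. -/
noncomputable def triangleWeight (r q : ℕ) (m : Multiset ℕ) : ℂ :=
  (-1) ^ (m.sum / 2) * (m.map fun c => bracketFact r q (m.sum / 2 - c)).prod /
    bracketFact r q (m.sum / 2 + 1)

/-- Weight of a tetrahedron whose edges have colours `i₀ = c₀ / 2, …, i₅ = c₅ / 2`, with triangles
`(i₀, i₁, i₃)`, `(i₀, i₂, i₄)`, `(i₁, i₂, i₅)`, `(i₃, i₄, i₅)` and opposite pairs `(i₀, i₅)`,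
`(i₁, i₄)`, `(i₂, i₃)`. -/
noncomputable def tetWeight (r q c₀ c₁ c₂ c₃ c₄ c₅ : ℕ) : ℂ :=
  let a₁ := (c₀ + c₁ + c₃) / 2
  let a₂ := (c₀ + c₂ + c₄) / 2
  let a₃ := (c₁ + c₂ + c₅) / 2
  let a₄ := (c₃ + c₄ + c₅) / 2
  let b₁ := (c₀ + c₁ + c₄ + c₅) / 2
  let b₂ := (c₀ + c₂ + c₃ + c₅) / 2
  let b₃ := (c₁ + c₂ + c₃ + c₄) / 2
  ∑ z ∈ Finset.Icc (max (max a₁ a₂) (max a₃ a₄)) (min (min b₁ b₂) b₃),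
    (-1) ^ z * bracketFact r q (z + 1) /
      ((bracketFact r q (z - a₁) * bracketFact r q (z - a₂) *
          bracketFact r q (z - a₃) * bracketFact r q (z - a₄)) *
        (bracketFact r q (b₁ - z) * bracketFact r q (b₂ - z) * bracketFact r q (b₃ - z)))

/-- The weight of a colouring: the product of the weights of all vertices, edges, triangles and
tetrahedra. -/
noncomputable def weight (T : Triangulation n) (r q : ℕ) (θ : T.Colouring r) : ℂ :=
  (∏ _w : T.Face 0, vertexWeight r q) *
  (∏ e : T.Face 1, edgeWeight r q (θ e)) *
  (∏ f : T.Face 2, triangleWeight r q ((T.facets f).map fun e => (θ e : ℕ))) *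
  ∏ t : Fin n, tetWeight r q
    (θ (T.edge t 0 1 (by decide))) (θ (T.edge t 0 2 (by decide))) (θ (T.edge t 0 3 (by decide)))
    (θ (T.edge t 1 2 (by decide))) (θ (T.edge t 1 3 (by decide))) (θ (T.edge t 2 3 (by decide)))

open Classical in
/-- The Turaev–Viro invariant `TV_{r,q}(T)`, for `r ≥ 3`, `0 < q < 2 r` and `gcd(r, q) = 1`: the sum
of the weights of all admissible colourings. -/
noncomputable def TV (T : Triangulation n) (r q : ℕ) : ℂ :=
  ∑ θ ∈ Finset.univ.filter (T.Admissible r), T.weight r q θ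

end Triangulation

/-! ## The machine model: a word RAM

Programs are while-programs over registers and random access memory.  The memory consists of
segments, each an array of words.  A program is a finite object, so it uses only a constant number
of registers and of segments. -/

namespace WordRAM

/-- Unit-cost operations on words; `sub` is truncated at `0`, `lt` and `eq` return `0` or `1`. -/
inductive BinOp
  | add | sub | mul | div | mod | lt | eq

def BinOp.eval : BinOp → ℕ → ℕ → ℕ
  | .add, x, y => x + y
  | .sub, x, y => x - y
  | .mul, x, y => x * y
  | .div, x, y => x / y
  | .mod, x, y => x % y
  | .lt, x, y => if x < y then 1 else 0
  | .eq, x, y => if x = y then 1 else 0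

/-- `load a e` is the content of the cell of segment `a` whose index is the value of `e`. -/
inductive Expr
  | lit (k : ℕ)
  | reg (x : ℕ)
  | load (a : ℕ) (e : Expr)
  | op (o : BinOp) (e₁ e₂ : Expr)

/-- The time to evaluate an expression: one step for every constant, register access, memory access
and operation in it. -/
def Expr.cost : Expr → ℕ
  | .lit _ => 1
  | .reg _ => 1
  | .load _ e => e.cost + 1
  | .op _ e₁ e₂ => e₁.cost + e₂.cost + 1

structure State where
  reg : ℕ → ℕ
  mem : ℕ → ℕ → ℕ

/-- Evaluation of expressions on a machine with `S` cells per segment, each holding a word of size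
at most `W`.  It fails (`none`) if a constant or the result of an operation exceeds `W`, or if a
cell of index `≥ S` is accessed. -/
def Expr.eval (W S : ℕ) (s : State) : Expr → Option ℕ
  | .lit k => if k ≤ W then some k else none
  | .reg x => some (s.reg x)
  | .load a e => (e.eval W S s).bind fun i => if i < S then some (s.mem a i) else none
  | .op o e₁ e₂ => (e₁.eval W S s).bind fun x => (e₂.eval W S s).bind fun y =>
      if o.eval x y ≤ W then some (o.eval x y) else none

def State.setReg (s : State) (x v : ℕ) : State :=
  { s with reg := Function.update s.reg x v }

def State.setMem (s : State) (a i v : ℕ) : State :=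
  { s with mem := Function.update s.mem a (Function.update (s.mem a) i v) }

/-- `assign x e` writes the value of `e` to register `x`; `store a e₁ e₂` writes the value of `e₂`
to the cell of segment `a` whose index is the value of `e₁`; conditions are true if nonzero. -/
inductive Prog
  | skip
  | assign (x : ℕ) (e : Expr)
  | store (a : ℕ) (e₁ e₂ : Expr)
  | seq (p₁ p₂ : Prog)
  | ite (e : Expr) (p₁ p₂ : Prog)
  | while (e : Expr) (p : Prog)

/-- `Exec W S p s s' t`: on a machine with `S` cells per segment and words of size at most `W`, the
program `p`, started in state `s`, halts in state `s'` after exactly `t` steps.  The machine is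
deterministic, and a run that overflows `W`, leaves the `S` available cells, or does not halt has no
derivation. -/
inductive Exec (W S : ℕ) : Prog → State → State → ℕ → Prop
  | skip (s : State) : Exec W S .skip s s 1
  | assign {x : ℕ} {e : Expr} {s : State} {v : ℕ} (h : e.eval W S s = some v) :
      Exec W S (.assign x e) s (s.setReg x v) (e.cost + 1)
  | store {a : ℕ} {e₁ e₂ : Expr} {s : State} {i v : ℕ} (h₁ : e₁.eval W S s = some i)
      (h₂ : e₂.eval W S s = some v) (hi : i < S) :
      Exec W S (.store a e₁ e₂) s (s.setMem a i v) (e₁.cost + e₂.cost + 1)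
  | seq {p₁ p₂ : Prog} {s s' s'' : State} {t₁ t₂ : ℕ} (h₁ : Exec W S p₁ s s' t₁)
      (h₂ : Exec W S p₂ s' s'' t₂) : Exec W S (.seq p₁ p₂) s s'' (t₁ + t₂)
  | ite_true {e : Expr} {p₁ p₂ : Prog} {s s' : State} {v t : ℕ} (h : e.eval W S s = some v)
      (hv : v ≠ 0) (h₁ : Exec W S p₁ s s' t) : Exec W S (.ite e p₁ p₂) s s' (e.cost + 1 + t)
  | ite_false {e : Expr} {p₁ p₂ : Prog} {s s' : State} {t : ℕ} (h : e.eval W S s = some 0)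
      (h₂ : Exec W S p₂ s s' t) : Exec W S (.ite e p₁ p₂) s s' (e.cost + 1 + t)
  | while_true {e : Expr} {p : Prog} {s s' s'' : State} {v t t' : ℕ} (h : e.eval W S s = some v)
      (hv : v ≠ 0) (h₁ : Exec W S p s s' t) (h₂ : Exec W S (.while e p) s' s'' t') :
      Exec W S (.while e p) s s'' (e.cost + 1 + t + t')
  | while_false {e : Expr} {p : Prog} {s : State} (h : e.eval W S s = some 0) :
      Exec W S (.while e p) s s (e.cost + 1)

/-- The input: register `0` holds the number `n` of tetrahedra, register `1` holds `q`, cell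
`4 t + i` of segment `0` holds the neighbour of tetrahedron `t` along face `i`, and cell
`16 t + 4 i + v` of segment `1` holds the image of vertex `v` under the gluing map of face `i` of
tetrahedron `t`.  Everything else is `0`. -/
def input {n : ℕ} (T : Triangulation n) (q : ℕ) : State where
  reg x := if x = 0 then n else if x = 1 then q else 0
  mem a j :=
    if a = 0 then
      if h : j / 4 < n then (T.adj ⟨j / 4, h⟩ (Fin.ofNat 4 j) : ℕ) else 0
    else if a = 1 then
      if h : j / 16 < n then
        (T.glue ⟨j / 16, h⟩ (Fin.ofNat 4 (j / 4)) (Fin.ofNat 4 j) : ℕ) else 0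
    else 0

/-- The natural number whose binary digits are the first `L` cells of segment `a` (least significant
digit first). -/
def State.binary (s : State) (a L : ℕ) : ℕ := ∑ i ∈ Finset.range L, s.mem a i * 2 ^ i

/-- The output: `z = (± A ± B √2) / 2 ^ k`, where the first `L` cells of segments `0` and `1` hold
the binary digits of `A` and `B`, register `0` holds `L`, registers `1` and `2` hold the signs of
the two terms (even for `+`, odd for `-`) and register `3` holds `k`. -/
def State.Outputs (s : State) (z : ℂ) : Prop :=
  (∀ i < s.reg 0, s.mem 0 i ≤ 1 ∧ s.mem 1 i ≤ 1) ∧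
  z = ((-1) ^ s.reg 1 * (s.binary 0 (s.reg 0) : ℂ) +
      (-1) ^ s.reg 2 * (s.binary 1 (s.reg 0) : ℂ) * (Real.sqrt 2 : ℂ)) / 2 ^ s.reg 3

end WordRAM

/-!
For `r = 4` the colours are `0, 1/2, 1`, stored as `0, 1, 2`, and `[1] = [3] = 1`, `[2] = ±√2`,
`[4] = 0`. In an admissible colouring the edges of colour `1` form a cocycle `α` over `ℤ/2`. Given
`α`, the edges of colour `2` form a function `x` that vanishes where `α` does not, and that has
sum zero over each triangle on which `α` is zero; these `x` form a vector space
(`Triangulation.admissible_iff_cocycle`).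

The weights of the edges, triangles and tetrahedra at which `α` is zero are all `1`. At the others
a weight is `-[2]`, up to a factor `1 / 2` for a triangle, times a sign: for a triangle the sign
is `(-1)` to the number of its edges of colour `2`, and for a tetrahedron it tells whether there
is an edge of colour `2`. Since there are `m ∈ {0, 1, 2}` of them, this is the parity of
`m (m + 1) / 2`, the sum of the first two elementary symmetric polynomials in the values of `x`.
So the sign of the whole colouring is `(-1) ^ Q x` for a quadratic function `Q` over `ℤ/2` that
depends on `α` (`Triangulation.weight_eq`, based on `TuraevViro.triangleWeight_four` and
`TuraevViro.tetWeight_four`), and `TV` is the sum over the cocycles `α` of a power of `√2`, up to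
sign, times the Gauss sum `∑ x, (-1) ^ Q x` over a vector space (`Triangulation.TV_eq`).

A Gauss sum over an affine space is evaluated by removing one direction `u` at a time: the terms
of `y` and `y + u` cancel unless `Q (y + u) + Q y = 0`, which is an affine equation for `y`
(`WordRAM.run_gaussSum`). Both this and the solution of the linear systems are Gaussian
elimination (`WordRAM.run_solve`), hence take cubic time and quadratic space. In a one-vertex
triangulation every edge is a loop, so there are exactly `2 ^ β₁` cocycles
(`Triangulation.card_isCocycle`); the program enumerates them with a binary counter
(`WordRAM.run_main`).

Local edges instead of edges serve as coordinates: the vector `x` has one entry for each triple of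
a tetrahedron `t` and two of its vertices `a`, `b`, and the identifications of edges under the
gluing maps are imposed as further linear equations (`Triangulation.solution_iff`). Thus no table
of the classes of edges is needed, and the number of edges at which `α` is nonzero is found as the
dimension of the space of functions supported there. Triangles are counted by their local
representative that precedes its partner (`Triangulation.prod_face`).

The contributions are integers, or integers times `√2`, over the common denominator
`2 ^ (4 n + 2)`. They are powers of two up to sign, and are added to two accumulators in two's
complement by propagating a carry.
-/

/-! ### Running programs within a time bound -/

namespace WordRAM

open WordRAM.Expr

instance : Add Expr := ⟨.op .add⟩
instance : Sub Expr := ⟨.op .sub⟩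
instance : Mul Expr := ⟨.op .mul⟩
instance : Div Expr := ⟨.op .div⟩
instance : Mod Expr := ⟨.op .mod⟩

/-- The expression testing `e₁ < e₂`. -/
def Expr.less (e₁ e₂ : Expr) : Expr := .op .lt e₁ e₂

/-- The expression testing `e₁ = e₂`. -/
def Expr.equal (e₁ e₂ : Expr) : Expr := .op .eq e₁ e₂

/-- The value of an expression on an idealised machine without overflow. -/
def Expr.val (s : State) : Expr → ℕ
  | .lit k => k
  | .reg x => s.reg x
  | .load a e => s.mem a (e.val s)
  | .op o e₁ e₂ => o.eval (e₁.val s) (e₂.val s)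

/-- An expression is safe in a state if its evaluation does not overflow. -/
def Expr.Safe (W S : ℕ) (s : State) : Expr → Prop
  | .lit k => k ≤ W
  | .reg _ => True
  | .load _ e => e.Safe W S s ∧ e.val s < S
  | .op o e₁ e₂ => e₁.Safe W S s ∧ e₂.Safe W S s ∧ o.eval (e₁.val s) (e₂.val s) ≤ W

section
variable (W S : ℕ) (s : State) (e₁ e₂ : Expr)

@[simp] theorem val_lit (k : ℕ) : (lit k).val s = k := rfl
@[simp] theorem val_reg (x : ℕ) : (Expr.reg x).val s = s.reg x := rfl
@[simp] theorem val_load (a : ℕ) : (load a e₁).val s = s.mem a (e₁.val s) := rfl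
@[simp] theorem val_add : (e₁ + e₂).val s = e₁.val s + e₂.val s := rfl
@[simp] theorem val_sub : (e₁ - e₂).val s = e₁.val s - e₂.val s := rfl
@[simp] theorem val_mul : (e₁ * e₂).val s = e₁.val s * e₂.val s := rfl
@[simp] theorem val_div : (e₁ / e₂).val s = e₁.val s / e₂.val s := rfl
@[simp] theorem val_mod : (e₁ % e₂).val s = e₁.val s % e₂.val s := rfl
@[simp] theorem val_less : (less e₁ e₂).val s = if e₁.val s < e₂.val s then 1 else 0 := rfl
@[simp] theorem val_equal : (equal e₁ e₂).val s = if e₁.val s = e₂.val s then 1 else 0 := rfl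

@[simp] theorem safe_lit (k : ℕ) : (lit k).Safe W S s ↔ k ≤ W := Iff.rfl
@[simp] theorem safe_reg (x : ℕ) : (Expr.reg x).Safe W S s ↔ True := Iff.rfl
@[simp] theorem safe_load (a : ℕ) :
    (load a e₁).Safe W S s ↔ e₁.Safe W S s ∧ e₁.val s < S := Iff.rfl
@[simp] theorem safe_add :
    (e₁ + e₂).Safe W S s ↔ e₁.Safe W S s ∧ e₂.Safe W S s ∧ e₁.val s + e₂.val s ≤ W := Iff.rfl
@[simp] theorem safe_sub :
    (e₁ - e₂).Safe W S s ↔ e₁.Safe W S s ∧ e₂.Safe W S s ∧ e₁.val s - e₂.val s ≤ W := Iff.rfl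
@[simp] theorem safe_mul :
    (e₁ * e₂).Safe W S s ↔ e₁.Safe W S s ∧ e₂.Safe W S s ∧ e₁.val s * e₂.val s ≤ W := Iff.rfl
@[simp] theorem safe_div :
    (e₁ / e₂).Safe W S s ↔ e₁.Safe W S s ∧ e₂.Safe W S s ∧ e₁.val s / e₂.val s ≤ W := Iff.rfl
@[simp] theorem safe_mod :
    (e₁ % e₂).Safe W S s ↔ e₁.Safe W S s ∧ e₂.Safe W S s ∧ e₁.val s % e₂.val s ≤ W := Iff.rfl

variable {W S s e₁ e₂} in
theorem Expr.Safe.less (hW : 1 ≤ W) (h₁ : e₁.Safe W S s) (h₂ : e₂.Safe W S s) :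
    (less e₁ e₂).Safe W S s := by
  refine ⟨h₁, h₂, ?_⟩
  simp only [BinOp.eval]; split_ifs <;> omega

variable {W S s e₁ e₂} in
theorem Expr.Safe.equal (hW : 1 ≤ W) (h₁ : e₁.Safe W S s) (h₂ : e₂.Safe W S s) :
    (equal e₁ e₂).Safe W S s := by
  refine ⟨h₁, h₂, ?_⟩
  simp only [BinOp.eval]; split_ifs <;> omega

variable {W S s} in
theorem Expr.Safe.eval_eq : ∀ {e : Expr}, e.Safe W S s → e.eval W S s = some (e.val s)
  | .lit k, h => if_pos h
  | .reg _, _ => rfl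
  | .load a e, h => by
    rw [Expr.eval, Expr.Safe.eval_eq h.1]
    exact if_pos h.2
  | .op o e₁ e₂, h => by
    rw [Expr.eval, Expr.Safe.eval_eq h.1, Expr.Safe.eval_eq h.2.1]
    exact if_pos h.2.2

@[simp] theorem setReg_reg (x v y : ℕ) :
    (s.setReg x v).reg y = if y = x then v else s.reg y := by
  simp [State.setReg, Function.update_apply]
@[simp] theorem setReg_mem (x v : ℕ) : (s.setReg x v).mem = s.mem := rfl
@[simp] theorem setMem_reg (a i v : ℕ) : (s.setMem a i v).reg = s.reg := rfl
@[simp] theorem setMem_mem (a i v a' : ℕ) :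
    (s.setMem a i v).mem a' = if a' = a then Function.update (s.mem a) i v else s.mem a' := by
  simp [State.setMem, Function.update_apply]
end

/-- `Run W S p T s Q`: from the state `s`, the program `p` halts within `300 T` steps, in a state
satisfying `Q`.  The factor `300` is such that each assignment, store and test that occurs in the
programs below accounts for one unit of `T`. -/
def Run (W S : ℕ) (p : Prog) (T : ℕ) (s : State) (Q : State → Prop) : Prop :=
  ∃ s' t, Exec W S p s s' t ∧ t ≤ 300 * T ∧ Q s'

variable {W S : ℕ} {s : State} {Q : State → Prop}

theorem Run.mono {p : Prog} {T T' : ℕ} {Q' : State → Prop} (h : Run W S p T s Q)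
    (hT : T ≤ T') (hQ : ∀ s', Q s' → Q' s') : Run W S p T' s Q' := by
  obtain ⟨s', t, h1, h2, h3⟩ := h
  exact ⟨s', t, h1, by omega, hQ _ h3⟩

theorem Run.skip {T : ℕ} (hQ : Q s) (hT : 1 ≤ T) : Run W S .skip T s Q :=
  ⟨s, 1, .skip s, by omega, hQ⟩

theorem Run.assign {x : ℕ} {e : Expr} {T : ℕ} (he : e.Safe W S s)
    (hQ : Q (s.setReg x (e.val s))) (hT : 1 ≤ T)
    (hc : e.cost ≤ 299 := by exact Nat.le_of_ble_eq_true rfl) : Run W S (.assign x e) T s Q :=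
  ⟨_, _, .assign he.eval_eq, by omega, hQ⟩

theorem Run.store {a : ℕ} {e₁ e₂ : Expr} {T : ℕ} (h₁ : e₁.Safe W S s) (h₂ : e₂.Safe W S s)
    (hi : e₁.val s < S) (hQ : Q (s.setMem a (e₁.val s) (e₂.val s))) (hT : 1 ≤ T)
    (hc : e₁.cost + e₂.cost ≤ 299 := by exact Nat.le_of_ble_eq_true rfl) :
    Run W S (.store a e₁ e₂) T s Q :=
  ⟨_, _, .store h₁.eval_eq h₂.eval_eq hi, by omega, hQ⟩

theorem Run.seq {p₁ p₂ : Prog} {T₁ T₂ T : ℕ} {R : State → Prop} (h₁ : Run W S p₁ T₁ s R)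
    (h₂ : ∀ s', R s' → Run W S p₂ T₂ s' Q) (hT : T₁ + T₂ ≤ T) : Run W S (.seq p₁ p₂) T s Q := by
  obtain ⟨s', t, h1, h2, h3⟩ := h₁
  obtain ⟨s'', t', h4, h5, h6⟩ := h₂ s' h3
  exact ⟨s'', t + t', .seq h1 h4, by omega, h6⟩

theorem Run.assign_seq {x : ℕ} {e : Expr} {p : Prog} {T : ℕ} (he : e.Safe W S s)
    (h : Run W S p (T - 1) (s.setReg x (e.val s)) Q) (hT : 1 ≤ T)
    (hc : e.cost ≤ 299 := by exact Nat.le_of_ble_eq_true rfl) :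
    Run W S (.seq (.assign x e) p) T s Q :=
  Run.seq (T₁ := 1) (R := fun s' => s' = s.setReg x (e.val s)) (.assign he rfl le_rfl hc)
    (by rintro _ rfl; exact h) (by omega)

theorem Run.store_seq {a : ℕ} {e₁ e₂ : Expr} {p : Prog} {T : ℕ} (h₁ : e₁.Safe W S s)
    (h₂ : e₂.Safe W S s) (hi : e₁.val s < S)
    (h : Run W S p (T - 1) (s.setMem a (e₁.val s) (e₂.val s)) Q) (hT : 1 ≤ T)
    (hc : e₁.cost + e₂.cost ≤ 299 := by exact Nat.le_of_ble_eq_true rfl) :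
    Run W S (.seq (.store a e₁ e₂) p) T s Q :=
  Run.seq (T₁ := 1) (R := fun s' => s' = s.setMem a (e₁.val s) (e₂.val s))
    (.store h₁ h₂ hi rfl le_rfl hc) (by rintro _ rfl; exact h) (by omega)

theorem Run.ite {e : Expr} {p₁ p₂ : Prog} {T : ℕ} (he : e.Safe W S s)
    (h₁ : e.val s ≠ 0 → Run W S p₁ (T - 1) s Q) (h₂ : e.val s = 0 → Run W S p₂ (T - 1) s Q)
    (hT : 1 ≤ T) (hc : e.cost ≤ 299 := by exact Nat.le_of_ble_eq_true rfl) :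
    Run W S (.ite e p₁ p₂) T s Q := by
  by_cases hv : e.val s = 0
  · obtain ⟨s', t, h1, h2, h3⟩ := h₂ hv
    exact ⟨s', _, .ite_false (hv ▸ he.eval_eq) h1, by omega, h3⟩
  · obtain ⟨s', t, h1, h2, h3⟩ := h₁ hv
    exact ⟨s', _, .ite_true he.eval_eq hv h1, by omega, h3⟩

/-- A loop that is run exactly `K` times; `I i` holds before the `i`-th test. -/
theorem Run.while {e : Expr} {p : Prog} {K T T' : ℕ} {I : ℕ → State → Prop} (h0 : I 0 s)
    (hstep : ∀ i s, i < K → I i s → e.Safe W S s ∧ e.val s ≠ 0 ∧ Run W S p T s (I (i + 1)))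
    (hend : ∀ s, I K s → e.Safe W S s ∧ e.val s = 0 ∧ Q s)
    (hT : K * (T + 1) + 1 ≤ T') (hc : e.cost ≤ 299 := by exact Nat.le_of_ble_eq_true rfl) :
    Run W S (.while e p) T' s Q := by
  have key : ∀ d i s, i + d = K → I i s → Run W S (.while e p) (d * (T + 1) + 1) s Q := by
    intro d
    induction d with
    | zero =>
      intro i s hi hI
      obtain ⟨h1, h2, h3⟩ := hend s (by simpa [← hi] using hI)
      exact ⟨s, _, .while_false (h2 ▸ h1.eval_eq), by omega, h3⟩
    | succ d ih =>
      intro i s hi hI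
      obtain ⟨h1, h2, s', t, h3, h4, h5⟩ := hstep i s (by omega) hI
      obtain ⟨s'', t', h6, h7, h8⟩ := ih (i + 1) s' (by omega) h5
      refine ⟨s'', _, .while_true h1.eval_eq h2 h3 h6, ?_, h8⟩
      have := Nat.add_one_mul d (T + 1)
      omega
  exact (key K 0 s (by omega) h0).mono hT fun _ h => h

/-- `for x = 0, …, b - 1 do p`. -/
def forLoop (x : ℕ) (b : Expr) (p : Prog) : Prog :=
  .seq (.assign x (lit 0))
    (.while (less (.reg x) b) (.seq p (.assign x (.reg x + lit 1))))

theorem Run.for {x : ℕ} {b : Expr} {p : Prog} {T T' : ℕ} (K : ℕ) (J : ℕ → State → Prop)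
    (hK : K ≤ W) (hW : 1 ≤ W) (h0 : J 0 s) (hJ : ∀ i s v, J i s → J i (s.setReg x v))
    (hb : ∀ i s, i ≤ K → J i s → s.reg x = i → b.Safe W S s ∧ b.val s = K)
    (hstep : ∀ i s, i < K → J i s → s.reg x = i →
      Run W S p T s fun s' => s'.reg x = i ∧ J (i + 1) s')
    (hQ : ∀ s, J K s → Q s) (hT : K * (T + 2) + 2 ≤ T')
    (hc : b.cost ≤ 200 := by exact Nat.le_of_ble_eq_true rfl) :
    Run W S (forLoop x b p) T' s Q := by
  refine Run.assign_seq (by simp) ?_ (by omega)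
  refine Run.while (K := K) (T := T + 1) (I := fun i s => i ≤ K ∧ s.reg x = i ∧ J i s)
    ⟨by omega, by simp, hJ _ _ _ h0⟩ ?_ ?_ (by rw [show T + 1 + 1 = T + 2 by omega]; omega)
    (by simp only [less, Expr.cost]; omega)
  · rintro i s hi ⟨-, h1, h2⟩
    obtain ⟨h3, h4⟩ := hb i s hi.le h2 h1
    refine ⟨.less hW (by simp) h3, by simp [h1, h4, hi], ?_⟩
    refine Run.seq (hstep i s hi h2 h1) (T₂ := 1) ?_ le_rfl
    rintro s' ⟨h5, h6⟩
    refine Run.assign (by simp; omega) ⟨by omega, by simp [h5], hJ _ _ _ h6⟩ le_rfl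
  · rintro s ⟨-, h1, h2⟩
    obtain ⟨h3, h4⟩ := hb K s le_rfl h2 h1
    exact ⟨.less hW (by simp) h3, by simp [h1, h4], hQ _ h2⟩

/-- The states agree except possibly in the registers in `X` and the segments in `A`. -/
def Same (X A : List ℕ) (s s' : State) : Prop :=
  (∀ x, x ∉ X → s'.reg x = s.reg x) ∧ ∀ a, a ∉ A → s'.mem a = s.mem a

section
variable {X A X' A' : List ℕ} {s' s'' : State}

theorem Same.refl : Same X A s s := ⟨fun _ _ => rfl, fun _ _ => rfl⟩

theorem Same.r (h : Same X A s s') (x : ℕ) (hx : x ∉ X := by decide) : s'.reg x = s.reg x :=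
  h.1 x hx

theorem Same.m (h : Same X A s s') (a : ℕ) (ha : a ∉ A := by decide) : s'.mem a = s.mem a :=
  h.2 a ha

theorem Same.setReg (h : Same X A s s') {x v : ℕ} (hx : x ∈ X := by decide) :
    Same X A s (s'.setReg x v) :=
  ⟨fun y hy => by
    have : y ≠ x := fun h => hy (h ▸ hx)
    simp [this, h.1 y hy], h.2⟩

theorem Same.refl_setReg {x v : ℕ} (hx : x ∈ X := by decide) : Same X A s (s.setReg x v) :=
  Same.refl.setReg hx

theorem Same.setMem (h : Same X A s s') {a i v : ℕ} (ha : a ∈ A := by decide) :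
    Same X A s (s'.setMem a i v) :=
  ⟨h.1, fun y hy => by
    have : y ≠ a := fun h => hy (h ▸ ha)
    simp [this, h.2 y hy]⟩

theorem Same.trans (h : Same X A s s') (h' : Same X' A' s' s'') (hX : X' ⊆ X := by decide)
    (hA : A' ⊆ A := by decide) : Same X A s s'' :=
  ⟨fun x hx => (h'.1 x fun h => hx (hX h)).trans (h.1 x hx),
    fun a ha => (h'.2 a fun h => ha (hA h)).trans (h.2 a ha)⟩

theorem Same.mono (h : Same X' A' s s') (hX : X' ⊆ X := by decide)
    (hA : A' ⊆ A := by decide) : Same X A s s' :=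
  Same.refl.trans h hX hA
end

end WordRAM

/-! ### Affine families over `ℤ/2` -/

section Family

open Finset

variable {V : Type*} [AddCommGroup V]

/-- The sum of `F` over the affine family with offset `R 0` and directions `R 1, …, R d`, every
combination of the directions being counted once. -/
noncomputable def famSum (d : ℕ) (R : ℕ → V) (F : V → ℂ) : ℂ :=
  ∑ A ∈ (range d).powerset, F (R 0 + ∑ i ∈ A, R (i + 1))

theorem famSum_congr {d : ℕ} {R R' : ℕ → V} (h : ∀ i ≤ d, R' i = R i) (F : V → ℂ) :
    famSum d R' F = famSum d R F := by
  refine sum_congr rfl fun A hA => ?_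
  rw [h 0 (by omega), sum_congr rfl fun i hi => h (i + 1) ?_]
  have := mem_range.1 (mem_powerset.1 hA hi)
  omega

theorem famSum_succ (d : ℕ) (R : ℕ → V) (F : V → ℂ) :
    famSum (d + 1) R F = famSum d R fun y => F y + F (y + R (d + 1)) := by
  rw [famSum, range_add_one, sum_powerset_insert (by simp), famSum, sum_add_distrib]
  congr 1
  refine sum_congr rfl fun A hA => ?_
  rw [sum_insert fun h => by simpa using mem_powerset.1 hA h, add_assoc, add_comm (R (d + 1))]

theorem zmod_two_eq_one {a : ZMod 2} (h : a ≠ 0) : a = 1 := by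
  revert a; decide

theorem ite_add_one_eq_zero (μ : ZMod 2) (a b : ℂ) :
    ((if μ = 0 then a else 0) + if μ + 1 = 0 then b else 0) = if μ = 0 then a else b := by
  by_cases h : μ = 0
  · simp [h]
  · have : (1 : ZMod 2) + 1 = 0 := by decide
    simp [zmod_two_eq_one h, this]

/-- Gaussian elimination: the members of a family that satisfy an affine equation, whose value at
the offset is `l 0` and whose linear part takes the values `l 1, …, l (d + 1)` at the directions,
form a family again.  The direction `R (j + 1)` with `l (j + 1) = 1` is used to correct the other
vectors, and is then overwritten by the last direction. -/
theorem famSum_eliminate [Module (ZMod 2) V] {d j : ℕ} (hj : j ≤ d) (R R' : ℕ → V) (l : ℕ → ZMod 2)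
    (hl : l (j + 1) = 1)
    (hR' : ∀ i ≤ d, R' i = if i = j + 1 then R (d + 1) + l (d + 1) • R (j + 1)
      else R i + l i • R (j + 1)) (F : V → ℂ) :
    famSum d R' F = ∑ A ∈ (range (d + 1)).powerset,
      if l 0 + ∑ i ∈ A, l (i + 1) = 0 then F (R 0 + ∑ i ∈ A, R (i + 1)) else 0 := by
  set X : ℕ → V := fun i => R i + l i • R (j + 1) with hX
  -- for `A` not containing `j`, exactly one of `A` and `A ∪ {j}` satisfies the equation
  have key : ∀ I : Finset ℕ, j ∉ I → ∑ A ∈ (insert j I).powerset,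
      (if l 0 + ∑ i ∈ A, l (i + 1) = 0 then F (R 0 + ∑ i ∈ A, R (i + 1)) else 0) =
      ∑ A ∈ I.powerset, F (X 0 + ∑ i ∈ A, X (i + 1)) := by
    intro I hI
    rw [sum_powerset_insert hI, ← sum_add_distrib]
    refine sum_congr rfl fun A hA => ?_
    have hjA : j ∉ A := fun h => hI (mem_powerset.1 hA h)
    rw [sum_insert hjA, sum_insert hjA, hl, add_left_comm, add_comm (1 : ZMod 2),
      ite_add_one_eq_zero]
    have : X 0 + ∑ i ∈ A, X (i + 1) = R 0 + ∑ i ∈ A, R (i + 1) +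
        (l 0 + ∑ i ∈ A, l (i + 1)) • R (j + 1) := by
      simp only [hX, sum_add_distrib, add_smul, sum_smul]
      abel
    rw [this]
    split_ifs with h
    · rw [h, zero_smul, add_zero]
    · rw [zmod_two_eq_one h, one_smul, add_left_comm, add_comm (R (j + 1))]
  have hR0 : R' 0 = X 0 := by rw [hR' 0 (by omega), if_neg (by omega)]
  rcases hj.eq_or_lt with rfl | hj'
  · rw [range_add_one, key _ (by simp)]
    refine sum_congr rfl fun A hA => ?_
    rw [hR0]
    congr 1
    congr 1
    refine sum_congr rfl fun i hi => ?_
    have := mem_range.1 (mem_powerset.1 hA hi)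
    rw [hR' _ (by omega), if_neg (by omega)]
  · set I := (range d).erase j with hI
    have hjI : j ∉ I := by simp [hI]
    have hdI : d ∉ I := by simp [hI]
    have h1 : range (d + 1) = insert j (insert d I) := by
      ext x; simp only [hI, mem_range, mem_insert, mem_erase]; omega
    have h2 : range d = insert j I := by
      ext x; simp only [hI, mem_range, mem_insert, mem_erase]; omega
    rw [h1, key _ (by simp only [mem_insert, hjI, or_false]; exact hj'.ne), famSum, h2,
      sum_powerset_insert hjI, sum_powerset_insert hdI]
    have hsum : ∀ A ∈ I.powerset, ∑ i ∈ A, R' (i + 1) = ∑ i ∈ A, X (i + 1) := by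
      intro A hA
      refine sum_congr rfl fun i hi => ?_
      have := mem_powerset.1 hA hi
      simp only [hI, mem_erase, mem_range] at this
      rw [hR' _ (by omega), if_neg (by omega)]
    congr 1
    · refine sum_congr rfl fun A hA => ?_
      rw [hR0, hsum A hA]
    · refine sum_congr rfl fun A hA => ?_
      rw [sum_insert fun h => hjI (mem_powerset.1 hA h),
        sum_insert fun h => hdI (mem_powerset.1 hA h), hR0, hsum A hA, hR' _ (by omega),
        if_pos rfl]

/-- The subsets of the standard basis enumerate all vectors. -/
theorem famSum_single {N : ℕ} (R : ℕ → Fin N → ZMod 2) (h0 : R 0 = 0)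
    (hR : ∀ i < N, R (i + 1) = fun c : Fin N => if (c : ℕ) = i then 1 else 0)
    (F : (Fin N → ZMod 2) → ℂ) :
    famSum N R F = ∑ x, F x := by
  classical
  have hval : ∀ A ∈ (range N).powerset,
      R 0 + ∑ i ∈ A, R (i + 1) = fun c : Fin N => if (c : ℕ) ∈ A then 1 else 0 := by
    intro A hA
    rw [h0, zero_add]
    ext c
    rw [Finset.sum_apply, sum_congr rfl fun i hi => by
      rw [hR i (mem_range.1 (mem_powerset.1 hA hi))]]
    simp
  refine sum_bij' (fun A _ => fun c : Fin N => if (c : ℕ) ∈ A then 1 else 0)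
    (fun x _ => (univ.filter fun c => x c = 1).map Fin.valEmbedding) (by simp) ?_ ?_ ?_ ?_
  · intro x _
    rw [mem_powerset]
    intro i hi
    simp only [mem_map, Fin.valEmbedding_apply] at hi
    obtain ⟨c, -, rfl⟩ := hi
    simp
  · intro A hA
    ext i
    simp only [mem_map, mem_filter, mem_univ, true_and, Fin.valEmbedding_apply, ite_eq_left_iff,
      zero_ne_one, imp_false, not_not]
    constructor
    · rintro ⟨c, h, rfl⟩
      exact h
    · intro h
      exact ⟨⟨i, mem_range.1 (mem_powerset.1 hA h)⟩, h, rfl⟩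
  · intro x _
    ext c
    have : ∀ b : ZMod 2, (if b = 1 then (1 : ZMod 2) else 0) = b := by decide
    rw [← this (x c)]
    congr 1
    simp [Fin.val_inj]
  · intro A hA
    rw [hval A hA]

end Family

/-! ### Rows of bits -/

/- Use of the machine in all programs below. Registers: `0` the number `n` of tetrahedra, `1` the
number `q`, `2` the length `N = 16 n` of a row, `3` the number of directions of the current affine
family, `4` a flag that marks the empty family, `5` the colour `κ`, `9` the dimension of the space
of cocycles, `10` and `38` the exponents of `2` and `-1` in a Gauss sum, `11`, `12`, `13` the
numbers of triangles, tetrahedra and edges at which the cocycle is nonzero (in the end, `13` is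
the sum of the three), `14` the length `4 N` of the accumulators, `15` whether the enumeration
goes on, `50`, `51` the signs of the result; the others are local. Segments: `0` and `1` the
gluing maps, `2` the current affine family, `3` the family of all cocycles, `4` the current
cocycle, `5` an affine function on the rows of segment `2`, `6` the counter, `7` and `8` the
accumulators, `9` and `10` the tables of tetrahedra and faces at which the cocycle is nonzero. At
the end of the computation the registers `0` to `3` and the segments `0` and `1` receive the
output. -/

namespace WordRAM

open WordRAM.Expr

/-- The machine is large enough for `N + 1` rows of `N` bits. -/
structure Big (W S N : ℕ) : Prop where
  hN : 16 ≤ N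
  hW : 4 * (N * N) ≤ W
  hS : 4 * (N * N) ≤ S

variable {W S N : ℕ}

theorem Big.lin (hB : Big W S N) : 64 * N ≤ 4 * (N * N) := by
  have := Nat.mul_le_mul_right N hB.hN
  omega

theorem Big.addr (hB : Big W S N) {i c : ℕ} (hi : i ≤ N) (hc : c < N) :
    i * N + c < 2 * (N * N) := by
  have := Nat.mul_le_mul_right N hi
  have := hB.lin
  omega

theorem addr_eq {i j c c' : ℕ} (hc : c < N) (hc' : c' < N) :
    i * N + c = j * N + c' ↔ i = j ∧ c = c' := by
  refine ⟨fun h => ?_, by rintro ⟨rfl, rfl⟩; rfl⟩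
  rcases lt_trichotomy i j with hij | rfl | hij
  · have := Nat.mul_le_mul_right N (Nat.succ_le_of_lt hij)
    rw [Nat.succ_mul] at this
    omega
  · exact ⟨rfl, by omega⟩
  · have := Nat.mul_le_mul_right N (Nat.succ_le_of_lt hij)
    rw [Nat.succ_mul] at this
    omega

/-- Segment `a` consists of bits. -/
def Bits (s : State) (a : ℕ) : Prop := ∀ k, s.mem a k ≤ 1

/-- Row `i` of segment `2`, as a vector over `ℤ/2`. -/
def rows (N : ℕ) (s : State) (i : ℕ) : Fin N → ZMod 2 := fun c => (s.mem 2 (i * N + c) : ZMod 2)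

theorem rows_congr {s s' : State} (h : s'.mem 2 = s.mem 2) : rows N s' = rows N s := by
  unfold rows; rw [h]

@[simp] theorem rows_setReg (s : State) (x v : ℕ) : rows N (s.setReg x v) = rows N s := rfl

/-- Replace row `i` by `e` times row `i` plus row `j`, where `i`, `j`, `e` are the contents of the
registers `20`, `21`, `23`. -/
def rowOp : Prog :=
  forLoop 22 (.reg 2) (.store 2 (.reg 20 * .reg 2 + .reg 22)
    ((.reg 23 * load 2 (.reg 20 * .reg 2 + .reg 22) + load 2 (.reg 21 * .reg 2 + .reg 22)) % lit 2))

theorem mul_bit_le {a b : ℕ} (ha : a ≤ 1) (hb : b ≤ 1) : a * b ≤ 1 :=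
  Nat.mul_le_mul ha hb

theorem run_rowOp (hB : Big W S N) {s : State} (h2 : s.reg 2 = N) (hi : s.reg 20 ≤ N)
    (hj : s.reg 21 ≤ N) (he : s.reg 23 ≤ 1) (hb : Bits s 2) :
    Run W S rowOp (3 * N + 2) s fun s' => Same [22] [2] s s' ∧ Bits s' 2 ∧
      rows N s' = Function.update (rows N s) (s.reg 20)
        ((s.reg 23 : ZMod 2) • rows N s (s.reg 20) + rows N s (s.reg 21)) := by
  have hlin := hB.lin
  have hN := hB.hN
  have hWB := hB.hW
  have hSB := hB.hS
  refine Run.for N (fun c s' => Same [22] [2] s s' ∧ Bits s' 2 ∧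
      ∀ i c', c' < N → s'.mem 2 (i * N + c') = if i = s.reg 20 ∧ c' < c then
        (s.reg 23 * s.mem 2 (s.reg 20 * N + c') + s.mem 2 (s.reg 21 * N + c')) % 2
        else s.mem 2 (i * N + c')) (T := 1) (by omega) (by omega)
    ?_ ?_ ?_ ?_ ?_ (by omega)
  · exact ⟨.refl, hb, by simp⟩
  · rintro i s' v ⟨h, hb', hm⟩
    exact ⟨h.setReg, hb', hm⟩
  · rintro i s' - ⟨h, -⟩ -
    simp [h.r 2, h2]
  · rintro c s' hc ⟨h, hb', hm⟩ hx
    have a1 := hB.addr hi hc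
    have a2 := hB.addr hj hc
    have e20 := h.r 20
    have e21 := h.r 21
    have e23 := h.r 23
    have e2 := h.r 2
    have b1 := hb' (s.reg 20 * N + c)
    have b2 := hb' (s.reg 21 * N + c)
    have b3 := mul_bit_le he b1
    refine Run.store ?_ ?_ ?_ ⟨by simp [hx], h.setMem, ?_, ?_⟩ le_rfl
    · simp only [safe_add, safe_mul, safe_reg, val_reg, val_mul, true_and, e20, e2, h2, hx]
      omega
    · simp only [safe_add, safe_mul, safe_reg, safe_load, safe_mod, val_reg, val_mul, val_add,
        val_load, val_lit, safe_lit, true_and, e20, e2, e21, e23, h2, hx]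
      omega
    · simp only [val_reg, val_mul, val_add, e20, e2, h2, hx]
      omega
    · intro k
      simp only [setMem_mem, if_true, Function.update_apply, val_mod, val_lit]
      split_ifs
      · omega
      · exact hb' k
    · intro i c' hc'
      simp only [setMem_mem, if_true, Function.update_apply, val_reg, val_mul, val_add, val_load,
        val_mod, val_lit, e20, e2, e21, e23, h2, hx]
      simp only [addr_eq hc' hc, hm _ _ hc', hm _ _ hc]
      by_cases h1 : i = s.reg 20 ∧ c' = c
      · rw [if_pos h1, if_neg (by omega), if_neg (by omega), if_pos (by omega), h1.2]
      · rw [if_neg h1]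
        by_cases h2 : i = s.reg 20 ∧ c' < c
        · rw [if_pos h2, if_pos (by omega)]
        · rw [if_neg h2, if_neg (by omega)]
  · rintro s' ⟨h, hb', hm⟩
    refine ⟨h, hb', ?_⟩
    ext i c
    simp only [rows, hm _ _ c.2, Function.update_apply]
    by_cases h1 : i = s.reg 20
    · subst h1
      simp [rows, ZMod.natCast_mod]
    · simp [h1, rows]

end WordRAM

/-! ### Elimination on the machine -/

namespace WordRAM

open WordRAM.Expr

variable {W S N : ℕ}

/-- The sum of `F` over the family whose `reg 3` directions are stored in the rows `1, 2, …` and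
whose offset is row `0`.  A nonzero flag in register `4` marks the empty family. -/
noncomputable def famVal (N : ℕ) (s : State) (F : (Fin N → ZMod 2) → ℂ) : ℂ :=
  if s.reg 4 = 0 then famSum (s.reg 3) (rows N s) F else 0

/-- Impose on the family the affine equation whose values at the rows are stored in segment `5`:
find the last direction at which the linear part does not vanish, correct the other rows with it
and remove it. -/
def eliminate : Prog :=
  .seq (.assign 24 (lit 0)) <|
  .seq (forLoop 25 (.reg 3 + lit 1) (.ite (load 5 (.reg 25)) (.assign 24 (.reg 25)) .skip)) <|
  .ite (.reg 24)
    (.seq (forLoop 25 (.reg 3 + lit 1)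
        (.ite (load 5 (.reg 25) * (lit 1 - equal (.reg 25) (.reg 24)))
          (.seq (.assign 20 (.reg 25)) <| .seq (.assign 21 (.reg 24)) <|
            .seq (.assign 23 (lit 1)) rowOp)
          .skip)) <|
      .seq (.assign 20 (.reg 24)) <| .seq (.assign 21 (.reg 3)) <| .seq (.assign 23 (lit 0)) <|
      .seq rowOp (.assign 3 (.reg 3 - lit 1)))
    (.ite (load 5 (lit 0)) (.assign 4 (lit 1)) .skip)

theorem run_eliminate (hB : Big W S N) {s : State} (h2 : s.reg 2 = N) (h3 : s.reg 3 ≤ N)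
    (hb : Bits s 2) (hb5 : Bits s 5) (l : (Fin N → ZMod 2) → ZMod 2)
    (hl : ∀ A ⊆ Finset.range (s.reg 3), l (rows N s 0 + ∑ i ∈ A, rows N s (i + 1)) =
      (s.mem 5 0 : ZMod 2) + ∑ i ∈ A, (s.mem 5 (i + 1) : ZMod 2)) :
    Run W S eliminate (6 * (N * N)) s fun s' =>
      Same [3, 4, 20, 21, 22, 23, 24, 25] [2] s s' ∧ Bits s' 2 ∧ s'.reg 3 ≤ s.reg 3 ∧
      ∀ F, famVal N s' F = famVal N s fun x => if l x = 0 then F x else 0 := by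
  have hlin := hB.lin
  have hN := hB.hN
  have hWB := hB.hW
  have hSB := hB.hS
  have hsafe : ∀ i ≤ N, i < S := by intros; omega
  have hmul1 : (s.reg 3 + 1) * (3 * N + 8) ≤ (N + 1) * (3 * N + 8) :=
    Nat.mul_le_mul_right _ (by omega)
  have hmul2 : (N + 1) * (3 * N + 8) = 3 * (N * N) + 11 * N + 8 := by ring
  refine Run.assign_seq (by simp) ?_ (by omega)
  refine Run.seq (T₁ := (s.reg 3 + 1) * 4 + 2) (T₂ := (s.reg 3 + 1) * (3 * N + 8) + 3 * N + 9)
    (R := fun s' => Same [24, 25] [] s s' ∧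
      ((s'.reg 24 = 0 ∧ ∀ i < s.reg 3 + 1, 1 ≤ i → s.mem 5 i = 0) ∨
        (1 ≤ s'.reg 24 ∧ s'.reg 24 ≤ s.reg 3 ∧ s.mem 5 (s'.reg 24) = 1))) ?_ ?_ (by omega)
  · refine Run.for (s.reg 3 + 1) (fun k s' => Same [24, 25] [] s s' ∧
      ((s'.reg 24 = 0 ∧ ∀ i < k, 1 ≤ i → s.mem 5 i = 0) ∨
        (1 ≤ s'.reg 24 ∧ s'.reg 24 < k ∧ s.mem 5 (s'.reg 24) = 1))) (T := 2) (by omega)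
      (by omega) ⟨.refl_setReg, .inl (by simp)⟩ ?_ ?_ ?_ ?_ le_rfl
    · rintro i s' v ⟨h, h'⟩
      exact ⟨h.setReg, by simpa using h'⟩
    · rintro i s' - ⟨h, -⟩ -
      simp [h.r 3]
      omega
    · rintro i s' hi ⟨h, h'⟩ hx
      refine Run.ite ?_ ?_ ?_ (by omega)
      · simpa [hx] using hsafe i (by omega)
      · intro hv
        simp only [val_load, val_reg, hx, h.m 5] at hv
        refine Run.assign (by simp) ⟨by simp [hx], h.setReg, ?_⟩ le_rfl
        rcases Nat.eq_zero_or_pos i with rfl | hpos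
        · exact .inl (by simp [hx])
        · refine .inr ?_
          have := hb5 i
          simp [hx]
          omega
      · intro hv
        simp only [val_load, val_reg, hx, h.m 5] at hv
        refine Run.skip ⟨hx, h, ?_⟩ le_rfl
        rcases h' with ⟨h1, h4⟩ | h1
        · refine .inl ⟨h1, fun i' hi' hi'' => ?_⟩
          rcases Nat.lt_succ_iff_lt_or_eq.1 hi' with h5 | rfl
          · exact h4 i' h5 hi''
          · exact hv
        · exact .inr ⟨h1.1, by omega, h1.2.2⟩
    · rintro s' ⟨h, h'⟩
      refine ⟨h, h'.imp id fun h' => ⟨h'.1, by omega, h'.2.2⟩⟩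
  rintro s₁ ⟨hs₁, hpiv⟩
  refine Run.ite (by simp) ?_ ?_ (by omega)
  · intro hj
    simp only [val_reg] at hj
    obtain ⟨hj1, hjd, hlj⟩ : 1 ≤ s₁.reg 24 ∧ s₁.reg 24 ≤ s.reg 3 ∧ s.mem 5 (s₁.reg 24) = 1 :=
      hpiv.resolve_left fun h => hj h.1
    have e3 := hs₁.r 3
    have e2 := hs₁.r 2
    generalize hjdef : s₁.reg 24 = j at *
    have hrows₁ : rows N s₁ = rows N s := rows_congr (hs₁.m 2)
    refine Run.seq (T₁ := (s.reg 3 + 1) * (3 * N + 8) + 2) (T₂ := 3 * N + 2 + 4)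
      (R := fun s' => Same [20, 21, 22, 23, 24, 25] [2] s s' ∧ s'.reg 24 = j ∧ Bits s' 2 ∧
        ∀ i, i ≤ s.reg 3 → rows N s' i = if i ≠ j then
          rows N s i + (s.mem 5 i : ZMod 2) • rows N s j else rows N s i) ?_ ?_ ?_
    · refine Run.for (s.reg 3 + 1) (fun k s' => Same [20, 21, 22, 23, 24, 25] [2] s s' ∧
        s'.reg 24 = j ∧ Bits s' 2 ∧ ∀ i, rows N s' i = if i < k ∧ i ≠ j then
          rows N s i + (s.mem 5 i : ZMod 2) • rows N s j else rows N s i)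
        (T := 3 * N + 6) (by omega) (by omega) ⟨hs₁.mono, hjdef, ?_, by simp [hrows₁]⟩
        ?_ ?_ ?_ ?_ le_rfl
      · intro k; rw [hs₁.m 2]; exact hb k
      · rintro i s' v ⟨h, h', h'', h'''⟩
        exact ⟨h.setReg, by simpa using h', h'', h'''⟩
      · rintro i s' - ⟨h, -⟩ -
        simp [h.r 3]
        omega
      · rintro k s' hk ⟨h, h24, hb', hr⟩ hx
        have hb5k := hb5 k
        refine Run.ite ?_ ?_ ?_ (by omega)
        · simp only [safe_mul, safe_load, safe_reg, safe_sub, safe_lit, val_reg, val_lit, val_load,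
            val_sub, val_equal, hx, h.m 5]
          refine ⟨⟨trivial, hsafe _ (by omega)⟩,
            ⟨by omega, .equal (by omega) (by simp) (by simp), by omega⟩, ?_⟩
          exact (mul_bit_le hb5k (by omega)).trans (by omega)
        · intro hv
          simp only [val_mul, val_load, val_reg, val_sub, val_lit, val_equal, hx, h24, h.m 5] at hv
          have hkj : k ≠ j := fun h => by simp [h] at hv
          have hlk : s.mem 5 k = 1 := by
            rcases Nat.eq_zero_or_pos (s.mem 5 k) with h | h
            · simp [h] at hv
            · omega
          refine Run.assign_seq (by simp) ?_ (by omega)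
          refine Run.assign_seq (by simp) ?_ (by omega)
          refine Run.assign_seq (by simp; omega) ?_ (by omega)
          simp only [val_reg, val_lit, hx, setReg_reg, Nat.reduceEqDiff, reduceIte]
          refine (run_rowOp hB ?_ ?_ ?_ ?_ ?_).mono ?_ ?_
          · simp [h.r 2, h2]
          · simp; omega
          · simp [h24]; omega
          · simp
          · exact hb'
          · omega
          · rintro s₂ ⟨g, gb, gr⟩
            refine ⟨by simp [g.r 25, hx],
              (((h.setReg).setReg).setReg).trans g, ?_, gb, ?_⟩
            · simp [g.r 24, h24]
            · intro i
              rw [gr]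
              simp only [Function.update_apply, rows_setReg, setReg_reg, h24]
              simp only [hr]
              by_cases hik : i = k
              · subst hik
                simp [hkj, hlk]
              · have : i < k + 1 ↔ i < k := by omega
                simp [hik, this]
        · intro hv
          simp only [val_mul, val_load, val_reg, val_sub, val_lit, val_equal, hx, h24, h.m 5] at hv
          refine Run.skip ⟨hx, h, h24, hb', fun i => ?_⟩ (by omega)
          rw [hr]
          by_cases hik : i = k
          · subst hik
            by_cases hij : i = j
            · simp [hij]
            · have : s.mem 5 i = 0 := by simpa [hij] using hv
              simp [this]
          · have : i < k + 1 ↔ i < k := by omega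
            simp [this]
      · rintro s' ⟨h, h', h'', hr⟩
        refine ⟨h, h', h'', fun i hi => ?_⟩
        rw [hr]
        have : i < s.reg 3 + 1 := by omega
        simp [this]
    · rintro s₂ ⟨g, g24, gb, gr⟩
      refine Run.assign_seq (by simp) ?_ (by omega)
      refine Run.assign_seq (by simp) ?_ (by omega)
      refine Run.assign_seq (by simp) ?_ (by omega)
      simp only [val_reg, val_lit, setReg_reg, Nat.reduceEqDiff, reduceIte]
      refine Run.seq (T₂ := 1) (run_rowOp hB ?_ ?_ ?_ ?_ ?_) ?_ (by omega)
      · simp [g.r 2, h2]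
      · simp; omega
      · simp [g.r 3, h3]
      · simp
      · exact gb
      · rintro s₃ ⟨f, fb, fr⟩
        have f3 : s₃.reg 3 = s.reg 3 := by simp [f.r 3, g.r 3]
        have f4 : s₃.reg 4 = s.reg 4 := by simp [f.r 4, g.r 4]
        refine Run.assign (by simp [f3]; omega) ⟨?_, fb, by simp [f3], ?_⟩ le_rfl
        · have g' : Same [3, 4, 20, 21, 22, 23, 24, 25] [2] s s₂ := g.mono
          exact ((((g'.setReg).setReg).setReg).trans f).setReg
        · intro F
          obtain ⟨d, hd⟩ : ∃ d, s.reg 3 = d + 1 := ⟨s.reg 3 - 1, by omega⟩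
          obtain ⟨j', rfl⟩ : ∃ j', j = j' + 1 := ⟨j - 1, by omega⟩
          simp only [famVal, setReg_reg, val_sub, val_reg, val_lit, f3, hd]
          simp only [f4, if_true, show ¬ (4 = 3) by omega, if_false, Nat.add_sub_cancel]
          split_ifs with h4
          swap
          · rfl
          rw [show rows N (s₃.setReg 3 d) = rows N s₃ from rfl]
          rw [famSum_eliminate (j := j') (d := d) (by omega) (rows N s) (rows N s₃)
            (fun i => (s.mem 5 i : ZMod 2)) (by simp [hlj])]
          · refine Finset.sum_congr rfl fun A hA => ?_
            beta_reduce
            rw [hl A (by rw [hd]; exact Finset.mem_powerset.1 hA)]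
          · intro i hi
            rw [fr]
            simp only [Function.update_apply, rows_setReg, setReg_reg, g24, g.r 3, hd]
            by_cases hij : i = j' + 1
            · simp [hij, gr (d + 1) (by omega)]
              intro h
              omega
            · simp [hij, gr i (by omega)]
    · omega
  · intro hj
    simp only [val_reg] at hj
    have hz : ∀ i < s.reg 3 + 1, 1 ≤ i → s.mem 5 i = 0 :=
      (hpiv.resolve_right fun h => by omega).2
    have hl0 : ∀ A ∈ (Finset.range (s.reg 3)).powerset,
        l (rows N s 0 + ∑ i ∈ A, rows N s (i + 1)) = (s.mem 5 0 : ZMod 2) := by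
      intro A hA
      rw [hl A (Finset.mem_powerset.1 hA), Finset.sum_eq_zero, add_zero]
      intro i hi
      have := Finset.mem_range.1 (Finset.mem_powerset.1 hA hi)
      rw [hz (i + 1) (by omega) (by omega), Nat.cast_zero]
    have e3 := hs₁.r 3
    have e4 := hs₁.r 4
    have hb' : Bits s₁ 2 := by intro k; rw [hs₁.m 2]; exact hb k
    refine Run.ite (by simp; omega) ?_ ?_ (by omega)
    · intro hv
      simp only [val_load, val_lit, hs₁.m 5] at hv
      have h1 : s.mem 5 0 = 1 := by have := hb5 0; omega
      refine Run.assign (by simp; omega) ⟨hs₁.mono.setReg, hb', by simp [e3], ?_⟩ (by omega)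
      intro F
      simp only [famVal, setReg_reg, if_true, val_lit, one_ne_zero, if_false]
      split_ifs
      · refine (Finset.sum_eq_zero fun A hA => ?_).symm
        beta_reduce
        rw [hl0 A hA, h1]
        simp
      · rfl
    · intro hv
      simp only [val_load, val_lit, hs₁.m 5] at hv
      refine Run.skip ⟨hs₁.mono, hb', e3.le, fun F => ?_⟩ (by omega)
      simp only [famVal, e3, e4, rows_congr (hs₁.m 2)]
      split_ifs
      · refine Finset.sum_congr rfl fun A hA => ?_
        beta_reduce
        rw [hl0 A hA, hv]
        simp
      · rfl

end WordRAM

/-! ### Solving the linear system of a colouring -/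

namespace WordRAM

open WordRAM.Expr

variable {W S N : ℕ}

/-- The family of `s'` consists of the members of the family of `s` that satisfy `P`. -/
def Cuts (N : ℕ) (s s' : State) (P : (Fin N → ZMod 2) → Prop) : Prop :=
  ∀ F, famVal N s' F = famVal N s fun x => open Classical in if P x then F x else 0

theorem famVal_congr {s s' : State} (h3 : s'.reg 3 = s.reg 3) (h4 : s'.reg 4 = s.reg 4)
    (h2 : s'.mem 2 = s.mem 2) : famVal N s' = famVal N s := by
  ext F
  rw [famVal, famVal, h3, h4, rows_congr h2]

theorem famVal_setReg (s : State) {x : ℕ} (v : ℕ) (h3 : x ≠ 3 := by decide)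
    (h4 : x ≠ 4 := by decide) : famVal N (s.setReg x v) = famVal N s :=
  famVal_congr (by simp [h3.symm]) (by simp [h4.symm]) rfl

theorem Cuts.of_eq {s s' : State} (h : famVal N s' = famVal N s) : Cuts N s s' fun _ => True :=
  fun F => by simp [h]

theorem Cuts.trans {s s' s'' : State} {P P' : (Fin N → ZMod 2) → Prop} (h : Cuts N s s' P)
    (h' : Cuts N s' s'' P') : Cuts N s s'' fun x => P x ∧ P' x := by
  classical
  intro F
  rw [h', h]
  congr 1
  ext x
  by_cases h1 : P x <;> by_cases h2 : P' x <;> simp [h1, h2]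

theorem Cuts.congr {s s' : State} {P P' : (Fin N → ZMod 2) → Prop} (h : Cuts N s s' P)
    (h' : ∀ x, P x ↔ P' x) : Cuts N s s' P' := by
  obtain rfl : P = P' := funext fun x => propext (h' x)
  exact h

/-- Segments `2` and `5` hold bits, and register `3` counts at most `N` directions. -/
structure Good (N : ℕ) (s : State) : Prop where
  r2 : s.reg 2 = N
  r3 : s.reg 3 ≤ N
  b2 : Bits s 2
  b5 : Bits s 5

theorem Good.congr {s s' : State} (h : Good N s) (h2 : s'.reg 2 = s.reg 2)
    (h3 : s'.reg 3 = s.reg 3) (m2 : s'.mem 2 = s.mem 2) (m5 : s'.mem 5 = s.mem 5) :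
    Good N s' :=
  ⟨h2.trans h.r2, h3.le.trans h.r3, fun k => by rw [m2]; exact h.b2 k,
    fun k => by rw [m5]; exact h.b5 k⟩

/-- Coordinate `c` of a vector, and `0` if there is no such coordinate. -/
def coord (x : Fin N → ZMod 2) (c : ℕ) : ZMod 2 := if h : c < N then x ⟨c, h⟩ else 0

theorem coord_add (x y : Fin N → ZMod 2) (c : ℕ) : coord (x + y) c = coord x c + coord y c := by
  unfold coord; split_ifs <;> simp

theorem coord_sum (A : Finset ℕ) (f : ℕ → Fin N → ZMod 2) (c : ℕ) :
    coord (∑ i ∈ A, f i) c = ∑ i ∈ A, coord (f i) c := by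
  unfold coord; split_ifs <;> simp

theorem coord_rows (s : State) (i : ℕ) {c : ℕ} (hc : c < N) :
    coord (rows N s i) c = (s.mem 2 (i * N + c) : ZMod 2) := by
  simp [coord, rows, hc]

/-- Impose the equation `x c₁ + x c₂ + x c₃ = 0`, where `c₁`, `c₂`, `c₃` are the contents of the
registers `6`, `7`, `8`. -/
def constrain : Prog :=
  .seq (forLoop 26 (.reg 3 + lit 1) (.store 5 (.reg 26)
    ((load 2 (.reg 26 * .reg 2 + .reg 6) + load 2 (.reg 26 * .reg 2 + .reg 7) +
      load 2 (.reg 26 * .reg 2 + .reg 8)) % lit 2))) eliminate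

theorem run_constrain (hB : Big W S N) {s : State} (hg : Good N s) (h6 : s.reg 6 < N)
    (h7 : s.reg 7 < N) (h8 : s.reg 8 < N) :
    Run W S constrain (7 * (N * N)) s fun s' =>
      Same [3, 4, 20, 21, 22, 23, 24, 25, 26] [2, 5] s s' ∧ Good N s' ∧ s'.reg 3 ≤ s.reg 3 ∧
      Cuts N s s' fun x => coord x (s.reg 6) + coord x (s.reg 7) + coord x (s.reg 8) = 0 := by
  have hlin := hB.lin
  have hN := hB.hN
  have hWB := hB.hW
  have hSB := hB.hS
  have h2 := hg.r2
  have h3 := hg.r3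
  refine Run.seq (T₁ := 3 * N + 5) (T₂ := 6 * (N * N)) (R := fun s' => Same [26] [5] s s' ∧
    Bits s' 5 ∧ ∀ i, i ≤ s.reg 3 → (s'.mem 5 i : ZMod 2) = coord (rows N s i) (s.reg 6) +
      coord (rows N s i) (s.reg 7) + coord (rows N s i) (s.reg 8)) ?_ ?_ (by omega)
  · refine Run.for (s.reg 3 + 1) (fun k s' => Same [26] [5] s s' ∧
      Bits s' 5 ∧ ∀ i, i < k → (s'.mem 5 i : ZMod 2) = coord (rows N s i) (s.reg 6) +
      coord (rows N s i) (s.reg 7) + coord (rows N s i) (s.reg 8)) (T := 1) (by omega)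
      (by omega) ⟨.refl, hg.b5, by simp⟩ ?_ ?_ ?_ ?_ (by omega)
    · rintro i s' v ⟨h, h'⟩
      exact ⟨h.setReg, h'⟩
    · rintro i s' - ⟨h, -⟩ -
      simp [h.r 3]
      omega
    · rintro k s' hk ⟨h, hb', hm⟩ hx
      have hk' : k ≤ N := by omega
      have a1 := hB.addr hk' h6
      have a2 := hB.addr hk' h7
      have a3 := hB.addr hk' h8
      have b1 := hg.b2 (k * N + s.reg 6)
      have b2 := hg.b2 (k * N + s.reg 7)
      have b3 := hg.b2 (k * N + s.reg 8)
      refine Run.store (by simp) ?_ ?_ ⟨by simp [hx], h.setMem, ?_, ?_⟩ le_rfl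
      · simp only [safe_add, safe_mul, safe_reg, safe_load, safe_mod, val_reg, val_mul, val_add,
          val_load, val_lit, safe_lit, true_and, h.r 6, h.r 7, h.r 8, h.r 2, h2, hx, h.m 2]
        omega
      · simp only [val_reg, hx]
        omega
      · intro i
        simp only [setMem_mem, if_true, Function.update_apply, val_mod, val_lit]
        split_ifs
        · omega
        · exact hb' i
      · intro i hi
        simp only [setMem_mem, if_true, Function.update_apply, val_reg, val_mul, val_add, val_load,
          val_mod, val_lit, h.r 6, h.r 7, h.r 8, h.r 2, h2, hx, h.m 2]
        split_ifs with hik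
        · subst hik
          rw [coord_rows s i h6, coord_rows s i h7, coord_rows s i h8]
          simp [ZMod.natCast_mod]
        · exact hm i (by omega)
    · rintro s' ⟨h, hb', hm⟩
      exact ⟨h, hb', fun i hi => hm i (by omega)⟩
  · rintro s₁ ⟨h, hb5, hm⟩
    have e3 := h.r 3
    refine Run.mono (run_eliminate hB (by simp [h.r 2, h2]) (by rw [e3]; exact h3)
      (fun k => by rw [h.m 2]; exact hg.b2 k) hb5
      (fun x => coord x (s.reg 6) + coord x (s.reg 7) + coord x (s.reg 8)) ?_) le_rfl ?_
    · intro A hA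
      rw [e3] at hA
      rw [rows_congr (h.m 2), hm 0 (by omega), Finset.sum_congr rfl fun i hi => hm (i + 1) ?_]
      · simp only [coord_add, coord_sum, Finset.sum_add_distrib]
        ring
      · have := Finset.mem_range.1 (hA hi)
        omega
    · rintro s₂ ⟨g, gb, g3, gF⟩
      have h' : Same [3, 4, 20, 21, 22, 23, 24, 25, 26] [2, 5] s s₁ := h.mono
      refine ⟨h'.trans g, ⟨by simp [g.r 2, h.r 2, h2], by omega, gb,
        fun k => by rw [g.m 5]; exact hb5 k⟩, by omega, fun F => ?_⟩
      rw [gF, famVal_congr (h.r 3) (h.r 4) (h.m 2)]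
      congr 1
      ext x
      congr

/-- Start with the family of all vectors. -/
def unitRows : Prog :=
  .seq (forLoop 20 (.reg 2 + lit 1) (forLoop 22 (.reg 2)
    (.store 2 (.reg 20 * .reg 2 + .reg 22) (equal (.reg 20) (.reg 22 + lit 1))))) <|
  .seq (.assign 3 (.reg 2)) (.assign 4 (lit 0))

theorem run_unitRows (hB : Big W S N) {s : State} (hg : Good N s) :
    Run W S unitRows (4 * (N * N)) s fun s' =>
      Same [3, 4, 20, 22] [2] s s' ∧ Good N s' ∧ ∀ F, famVal N s' F = ∑ x, F x := by
  have hlin := hB.lin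
  have hN := hB.hN
  have hWB := hB.hW
  have hSB := hB.hS
  have h2 := hg.r2
  have ht : (N + 1) * (3 * N + 2 + 2) = 3 * (N * N) + 7 * N + 4 := by ring
  refine Run.seq (T₁ := 3 * (N * N) + 7 * N + 6) (T₂ := 2) (R := fun s' => Same [20, 22] [2] s s' ∧
    Bits s' 2 ∧ ∀ i c, i ≤ N → c < N → s'.mem 2 (i * N + c) = if i = c + 1 then 1 else 0) ?_ ?_
    (by omega)
  · refine Run.for (N + 1) (fun k s' => Same [20, 22] [2] s s' ∧
      Bits s' 2 ∧ ∀ i c, i < k → c < N → s'.mem 2 (i * N + c) = if i = c + 1 then 1 else 0)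
      (T := 3 * N + 2) (by omega) (by omega) ⟨.refl, hg.b2, by simp⟩ ?_ ?_ ?_ ?_ (by omega)
    · rintro i s' v ⟨h, h'⟩
      exact ⟨h.setReg, h'⟩
    · rintro i s' - ⟨h, -⟩ -
      simp [h.r 2, h2]
      omega
    · rintro k s₁ hk ⟨h, hb', hm⟩ hx
      refine Run.for N (fun c₀ s' => Same [20, 22] [2] s s' ∧ s'.reg 20 = k ∧
        Bits s' 2 ∧ ∀ i c, i < k ∨ (i = k ∧ c < c₀) → c < N →
          s'.mem 2 (i * N + c) = if i = c + 1 then 1 else 0)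
        (T := 1) (by omega) (by omega)
        ⟨h, hx, hb', fun i c hi hc => hm i c (by omega) hc⟩ ?_ ?_ ?_ ?_ (by omega)
      · rintro i s' v ⟨h, h', h''⟩
        exact ⟨h.setReg, by simpa using h', h''⟩
      · rintro i s' - ⟨h, -⟩ -
        simp [h.r 2, h2]
      · rintro c₀ s' hc₀ ⟨h, h20, hb', hm⟩ hx
        have a1 := hB.addr (i := k) (by omega) hc₀
        refine Run.store ?_ ?_ ?_ ⟨by simp [hx], h.setMem, by simpa using h20, ?_, ?_⟩ le_rfl
        · simp only [safe_add, safe_mul, safe_reg, val_reg, val_mul, true_and, h.r 2, h2, hx, h20]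
          omega
        · refine .equal (by omega) (by simp) ?_
          simp only [safe_add, safe_reg, safe_lit, val_reg, val_lit, true_and, hx]
          omega
        · simp only [val_add, val_mul, val_reg, h.r 2, h2, hx, h20]
          omega
        · intro i
          simp only [setMem_mem, if_true, Function.update_apply, val_equal]
          split_ifs
          · omega
          · omega
          · exact hb' i
        · intro i c hi hc
          simp only [setMem_mem, if_true, Function.update_apply, val_equal, val_add, val_mul,
            val_reg, val_lit, h.r 2, h2, hx, h20]
          simp only [addr_eq hc hc₀]
          by_cases h1 : i = k ∧ c = c₀
          · simp [h1]
          · simp only [h1, if_false]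
            exact hm i c (by omega) hc
      · rintro s' ⟨h, h20, hb', hm⟩
        exact ⟨h20, h, hb', fun i c hi hc => hm i c (by omega) hc⟩
    · rintro s' ⟨h, hb', hm⟩
      exact ⟨h, hb', fun i c hi hc => hm i c (by omega) hc⟩
  · rintro s₁ ⟨h, hb', hm⟩
    have h' : Same [3, 4, 20, 22] [2] s s₁ := h.mono
    refine Run.assign_seq (by simp) (Run.assign (by simp) ⟨h'.setReg.setReg, ⟨?_, ?_, hb', ?_⟩, ?_⟩
      (by omega)) (by omega)
    · simp [h.r 2, h2]
    · simp [h.r 2, h2]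
    · intro k
      simp only [setReg_mem, h.m 5]
      exact hg.b5 k
    · intro F
      simp only [famVal, setReg_reg, val_reg, val_lit, h.r 2, h2, rows_setReg, if_true,
        Nat.reduceEqDiff, if_false]
      refine famSum_single _ ?_ ?_ F
      · ext c
        have := hm 0 c (by omega) c.2
        simp only [rows, this]
        simp
      · intro i hi
        ext c
        have := hm (i + 1) c (by omega) c.2
        simp only [rows, this]
        simp [eq_comm]

/-- If `e` is true, impose the equation `x e₁ + x e₂ + x e₃ = 0`. -/
def constrainIf (e e₁ e₂ e₃ : Expr) : Prog :=
  .ite e (.seq (.assign 6 e₁) <| .seq (.assign 7 e₂) <| .seq (.assign 8 e₃) constrain) .skip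

theorem run_constrainIf (hB : Big W S N) {s : State} (hg : Good N s) {e e₁ e₂ e₃ : Expr}
    {c₁ c₂ c₃ : ℕ} (he : e.Safe W S s) (h₁ : e₁.Safe W S s ∧ e₁.val s = c₁)
    (h₂ : ∀ v, e₂.Safe W S (s.setReg 6 v) ∧ e₂.val (s.setReg 6 v) = c₂)
    (h₃ : ∀ v w, e₃.Safe W S ((s.setReg 6 v).setReg 7 w) ∧
      e₃.val ((s.setReg 6 v).setReg 7 w) = c₃)
    (h₁' : c₁ < N) (h₂' : c₂ < N) (h₃' : c₃ < N)
    (hc : e.cost ≤ 299) (hc₁ : e₁.cost ≤ 299) (hc₂ : e₂.cost ≤ 299) (hc₃ : e₃.cost ≤ 299) :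
    Run W S (constrainIf e e₁ e₂ e₃) (7 * (N * N) + 4) s fun s' =>
      Same [3, 4, 6, 7, 8, 20, 21, 22, 23, 24, 25, 26] [2, 5] s s' ∧ Good N s' ∧
      Cuts N s s' fun x => e.val s ≠ 0 → coord x c₁ + coord x c₂ + coord x c₃ = 0 := by
  refine Run.ite he ?_ ?_ (by omega) hc
  · intro hv
    refine Run.assign_seq h₁.1 ?_ (by omega) hc₁
    refine Run.assign_seq (h₂ _).1 ?_ (by omega) hc₂
    refine Run.assign_seq (h₃ _ _).1 ?_ (by omega) hc₃
    rw [h₁.2, (h₂ _).2, (h₃ _ _).2]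
    refine Run.mono (run_constrain hB (s := ((s.setReg 6 c₁).setReg 7 c₂).setReg 8 c₃)
      ⟨by simpa using hg.r2, by simpa using hg.r3, hg.b2, hg.b5⟩ (by simpa) (by simpa) (by simpa))
      (by omega) ?_
    rintro s' ⟨h, hg', -, hF⟩
    refine ⟨(((Same.refl_setReg).setReg).setReg).trans h, hg', ?_⟩
    simp only [setReg_reg, Nat.reduceEqDiff, if_true, if_false] at hF
    intro F
    rw [hF, famVal_setReg, famVal_setReg, famVal_setReg]
    simp [hv]
    congr!
  · intro hv
    refine Run.skip ⟨.refl, hg, ?_⟩ (by omega)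
    exact (Cuts.of_eq rfl).congr (by simp [hv])

/-- The equations that belong to the index `p`, which encodes a tetrahedron `p / 64`, a face
`i = p / 16 % 4` of it and two of its vertices `a = p / 4 % 4` and `b = p % 4`.  The tables `G₀` and
`G₁` are those of the gluing maps.  Coordinate `16 t + 4 a + b` belongs to the edge of the
tetrahedron `t` from `a` to `b`. -/
def Equations (G₀ G₁ al : ℕ → ℕ) (κ p : ℕ) (x : Fin N → ZMod 2) : Prop :=
  let u := p / 64 * 16
  let i := p / 16 % 4
  let a := p / 4 % 4
  let b := p % 4
  ((a = b ∨ al (u + 4 * a + b) ≠ κ) →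
    coord x (u + 4 * a + b) + coord x (u + 4 * a + b) + coord x (u + 4 * a + b) = 0) ∧
  (coord x (u + 4 * a + b) + coord x (u + 4 * b + a) + coord x (u + 4 * a + a) = 0) ∧
  ((i ≠ a ∧ i ≠ b) → coord x (u + 4 * a + b) +
    coord x (16 * G₀ (u / 4 + i) + 4 * G₁ (u + 4 * i + a) + G₁ (u + 4 * i + b)) +
    coord x (u + 4 * a + a) = 0) ∧
  (al (u + 4 * a + b) + al (u + 4 * b + i) + al (u + 4 * i + a) + κ = 0 →
    coord x (u + 4 * a + b) + coord x (u + 4 * b + i) + coord x (u + 4 * i + a) = 0)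

/-- The coordinate of the edge between the vertices in the registers `v` and `w`. -/
abbrev edgeExpr (v w : ℕ) : Expr := .reg 28 + lit 4 * .reg v + .reg w

/-- Impose the equations that belong to the index in register `27`.  Register `5` holds `κ` and
segment `4` the colouring. -/
def imposeEquations : Prog :=
  .seq (.assign 28 (.reg 27 / lit 64 * lit 16)) <|
  .seq (.assign 29 (.reg 27 / lit 16 % lit 4)) <|
  .seq (.assign 30 (.reg 27 / lit 4 % lit 4)) <|
  .seq (.assign 31 (.reg 27 % lit 4)) <|
  .seq (constrainIf (lit 1 - equal (load 4 (edgeExpr 30 31)) (.reg 5) + equal (.reg 30) (.reg 31))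
    (edgeExpr 30 31) (edgeExpr 30 31) (edgeExpr 30 31)) <|
  .seq (constrainIf (lit 1) (edgeExpr 30 31) (edgeExpr 31 30) (edgeExpr 30 30)) <|
  .seq (constrainIf ((lit 1 - equal (.reg 29) (.reg 30)) * (lit 1 - equal (.reg 29) (.reg 31)))
    (edgeExpr 30 31) (lit 16 * load 0 (.reg 28 / lit 4 + .reg 29) +
      lit 4 * load 1 (edgeExpr 29 30) + load 1 (edgeExpr 29 31)) (edgeExpr 30 30))
  (constrainIf (lit 1 - (load 4 (edgeExpr 30 31) + load 4 (edgeExpr 31 29) +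
      load 4 (edgeExpr 29 30) + .reg 5)) (edgeExpr 30 31) (edgeExpr 31 29) (edgeExpr 29 30))

/-- The contents of the registers and segments that the equations at `(u / 16, i, a, b)` refer
to. -/
structure Cell (G₀ G₁ al : ℕ → ℕ) (κ u i a b : ℕ) (s : State) : Prop where
  r28 : s.reg 28 = u
  r29 : s.reg 29 = i
  r30 : s.reg 30 = a
  r31 : s.reg 31 = b
  r5 : s.reg 5 = κ
  m0 : s.mem 0 = G₀
  m1 : s.mem 1 = G₁
  m4 : s.mem 4 = al

theorem Cell.same {G₀ G₁ al : ℕ → ℕ} {κ u i a b : ℕ} {s s' : State}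
    (h : Cell G₀ G₁ al κ u i a b s)
    (hs : Same [3, 4, 6, 7, 8, 20, 21, 22, 23, 24, 25, 26] [2, 5] s s') :
    Cell G₀ G₁ al κ u i a b s' :=
  ⟨(hs.r 28).trans h.r28, (hs.r 29).trans h.r29, (hs.r 30).trans h.r30, (hs.r 31).trans h.r31,
    (hs.r 5).trans h.r5, (hs.m 0).trans h.m0, (hs.m 1).trans h.m1, (hs.m 4).trans h.m4⟩

/-- The gluing tables of `N / 16` tetrahedra. -/
structure Tables (N : ℕ) (G₀ G₁ : ℕ → ℕ) : Prop where
  dvd : 16 ∣ N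
  adj_lt : ∀ j < N / 4, 16 * G₀ j + 16 ≤ N
  glue_lt : ∀ j, G₁ j < 4

theorem run_imposeEquations (hB : Big W S N) {G₀ G₁ al : ℕ → ℕ} (hG : Tables N G₀ G₁)
    {κ p : ℕ} (hκ : κ ≤ 1) (hal : ∀ k, al k ≤ 1) {s : State} (hg : Good N s) (h27 : s.reg 27 = p)
    (hp : p < 4 * N) (h5 : s.reg 5 = κ) (h0 : s.mem 0 = G₀) (h1 : s.mem 1 = G₁)
    (h4 : s.mem 4 = al) :
    Run W S imposeEquations (29 * (N * N)) s fun s' =>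
      Same [3, 4, 6, 7, 8, 20, 21, 22, 23, 24, 25, 26, 28, 29, 30, 31] [2, 5] s s' ∧ Good N s' ∧
      Cuts N s s' (Equations G₀ G₁ al κ p) := by
  have hlin := hB.lin
  have hN := hB.hN
  have hWB := hB.hW
  have hSB := hB.hS
  refine Run.assign_seq (by simp [h27]; omega) ?_ (by omega)
  refine Run.assign_seq (by simp [h27]; omega) ?_ (by omega)
  refine Run.assign_seq (by simp [h27]; omega) ?_ (by omega)
  refine Run.assign_seq (by simp [h27]; omega) ?_ (by omega)
  simp only [val_reg, val_lit, val_mul, val_div, val_mod, setReg_reg, Nat.reduceEqDiff, if_false,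
    h27]
  unfold Equations
  generalize hs₀ : (((s.setReg 28 (p / 64 * 16)).setReg 29 (p / 16 % 4)).setReg 30
    (p / 4 % 4)).setReg 31 (p % 4) = s₀
  have hu : p / 64 * 16 + 16 ≤ N := by have := hG.dvd; omega
  have hu16 : p / 64 * 16 % 16 = 0 := by omega
  have hi : p / 16 % 4 < 4 := by omega
  have ha : p / 4 % 4 < 4 := by omega
  have hb : p % 4 < 4 := by omega
  have hc₀ : Cell G₀ G₁ al κ (p / 64 * 16) (p / 16 % 4) (p / 4 % 4) (p % 4) s₀ := by
    subst hs₀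
    constructor <;> simp [h5, h0, h1, h4]
  have hg₀ : Good N s₀ := by
    subst hs₀
    exact hg.congr (by simp) (by simp) rfl rfl
  have hs : Same [3, 4, 6, 7, 8, 20, 21, 22, 23, 24, 25, 26, 28, 29, 30, 31] [2, 5] s s₀ := by
    subst hs₀
    exact Same.setReg (Same.setReg (Same.setReg Same.refl_setReg))
  have hF₀ : Cuts N s s₀ fun _ => True := by
    subst hs₀
    exact Cuts.of_eq (by rw [famVal_setReg, famVal_setReg, famVal_setReg, famVal_setReg])
  clear hs₀
  dsimp only
  generalize p / 64 * 16 = u at *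
  generalize p / 16 % 4 = i at *
  generalize p / 4 % 4 = a at *
  generalize p % 4 = b at *
  -- the edge expressions in any state with the given cell
  have hE : ∀ {s' : State} {v w x y : ℕ}, s'.reg 28 = u → s'.reg v = x → s'.reg w = y → x < 4 →
      y < 4 → (edgeExpr v w).Safe W S s' ∧ (edgeExpr v w).val s' = u + 4 * x + y := by
    rintro s' v w x y g1 g2 g3 g4 g5
    simp only [safe_add, safe_mul, safe_reg, safe_lit, val_reg, val_lit, val_mul, val_add, g1, g2,
      g3, true_and, and_true]
    omega
  have al1 := hal (u + 4 * a + b)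
  have al2 := hal (u + 4 * b + i)
  have al3 := hal (u + 4 * i + a)
  have hadj := hG.adj_lt (u / 4 + i) (by omega)
  have hg1 := hG.glue_lt (u + 4 * i + a)
  have hg2 := hG.glue_lt (u + 4 * i + b)
  refine Run.seq (T₂ := 21 * (N * N) + 12) (run_constrainIf hB hg₀ (c₁ := u + 4 * a + b)
    (c₂ := u + 4 * a + b) (c₃ := u + 4 * a + b) ?_ (hE hc₀.r28 hc₀.r30 hc₀.r31 ha hb)
    (fun v => hE (by simpa using hc₀.r28) (by simpa using hc₀.r30) (by simpa using hc₀.r31) ha hb)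
    (fun v w => hE (by simpa using hc₀.r28) (by simpa using hc₀.r30) (by simpa using hc₀.r31) ha hb)
    (by omega) (by omega) (by omega) (by decide) (by decide) (by decide) (by decide)) ?_ (by omega)
  · have h1 := hE hc₀.r28 hc₀.r30 hc₀.r31 ha hb
    refine ⟨⟨by simp; omega, .equal (by omega) ⟨h1.1, ?_⟩ (by simp), ?_⟩,
      .equal (by omega) (by simp) (by simp), ?_⟩
    · rw [h1.2]; omega
    · change 1 - _ ≤ W; omega
    · change 1 - _ + (if _ then 1 else 0) ≤ W
      split_ifs <;> omega
  have v1 : (lit 1 - equal (load 4 (edgeExpr 30 31)) (.reg 5) +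
      equal (.reg 30) (.reg 31)).val s₀ ≠ 0 ↔ (a = b ∨ al (u + 4 * a + b) ≠ κ) := by
    simp only [val_add, val_sub, val_equal, val_load, val_lit, val_reg, val_mul, hc₀.r28, hc₀.r30,
      hc₀.r31, hc₀.r5, hc₀.m4]
    split_ifs with g1 g2 <;> simp [*]
  rintro s₁ ⟨h₁, hg₁, hF₁⟩
  have hc₁ := hc₀.same h₁
  refine Run.seq (T₂ := 14 * (N * N) + 8) (run_constrainIf hB hg₁ (c₁ := u + 4 * a + b)
    (c₂ := u + 4 * b + a) (c₃ := u + 4 * a + a) (by simp; omega)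
    (hE hc₁.r28 hc₁.r30 hc₁.r31 ha hb)
    (fun v => hE (by simpa using hc₁.r28) (by simpa using hc₁.r31) (by simpa using hc₁.r30) hb ha)
    (fun v w => hE (by simpa using hc₁.r28) (by simpa using hc₁.r30) (by simpa using hc₁.r30) ha ha)
    (by omega) (by omega) (by omega) (by decide) (by decide) (by decide) (by decide)) ?_ (by omega)
  rintro s₂ ⟨h₂, hg₂, hF₂⟩
  have hc₂ := hc₁.same h₂
  refine Run.seq (T₂ := 7 * (N * N) + 4) (run_constrainIf hB hg₂ (c₁ := u + 4 * a + b)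
    (c₂ := 16 * G₀ (u / 4 + i) + 4 * G₁ (u + 4 * i + a) + G₁ (u + 4 * i + b))
    (c₃ := u + 4 * a + a) ?_ (hE hc₂.r28 hc₂.r30 hc₂.r31 ha hb)
    (fun v => ?_)
    (fun v w => hE (by simpa using hc₂.r28) (by simpa using hc₂.r30) (by simpa using hc₂.r30) ha ha)
    (by omega) (by omega) (by omega) (by decide) (by decide) (by decide) (by decide)) ?_ (by omega)
  · refine ⟨⟨by simp; omega, .equal (by omega) (by simp) (by simp), ?_⟩,
      ⟨by simp; omega, .equal (by omega) (by simp) (by simp), ?_⟩, ?_⟩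
    · change 1 - _ ≤ W; omega
    · change 1 - _ ≤ W; omega
    · change (1 - _) * (1 - _) ≤ W
      exact (mul_bit_le (Nat.sub_le _ _) (Nat.sub_le _ _)).trans (by omega)
  · simp only [safe_add, safe_mul, safe_reg, safe_lit, safe_load, safe_div, val_reg, val_lit,
      val_mul, val_add, val_load, val_div, setReg_reg, setReg_mem, Nat.reduceEqDiff, if_false,
      hc₂.r28, hc₂.r29, hc₂.r30, hc₂.r31, hc₂.m0, hc₂.m1, true_and, and_true]
    omega
  have v2 : ((lit 1 - equal (.reg 29) (.reg 30)) * (lit 1 - equal (.reg 29) (.reg 31))).val s₂ ≠ 0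
      ↔ (i ≠ a ∧ i ≠ b) := by
    simp only [val_mul, val_sub, val_equal, val_lit, val_reg, hc₂.r29, hc₂.r30, hc₂.r31]
    split_ifs with g1 g2 <;> simp [*]
  rintro s₃ ⟨h₃, hg₃, hF₃⟩
  have hc₃ := hc₂.same h₃
  refine Run.mono (run_constrainIf hB hg₃ (c₁ := u + 4 * a + b)
    (c₂ := u + 4 * b + i) (c₃ := u + 4 * i + a) ?_
    (hE hc₃.r28 hc₃.r30 hc₃.r31 ha hb)
    (fun v => hE (by simpa using hc₃.r28) (by simpa using hc₃.r31) (by simpa using hc₃.r29) hb hi)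
    (fun v w => hE (by simpa using hc₃.r28) (by simpa using hc₃.r29) (by simpa using hc₃.r30) hi ha)
    (by omega) (by omega) (by omega) (by decide) (by decide) (by decide) (by decide))
    (by omega) ?_
  · simp only [safe_add, safe_mul, safe_reg, safe_lit, safe_load, safe_sub, val_reg, val_lit,
      val_mul, val_add, val_load, hc₃.r28, hc₃.r29, hc₃.r30, hc₃.r31, hc₃.m4, hc₃.r5,
      true_and]
    omega
  have v3 : (lit 1 - (load 4 (edgeExpr 30 31) + load 4 (edgeExpr 31 29) +
      load 4 (edgeExpr 29 30) + .reg 5)).val s₃ ≠ 0 ↔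
      al (u + 4 * a + b) + al (u + 4 * b + i) + al (u + 4 * i + a) + κ = 0 := by
    simp only [val_add, val_sub, val_load, val_lit, val_reg, val_mul, hc₃.r28, hc₃.r29, hc₃.r30,
      hc₃.r31, hc₃.r5, hc₃.m4]
    omega
  rintro s₄ ⟨h₄, hg₄, hF₄⟩
  refine ⟨(((hs.trans h₁).trans h₂).trans h₃).trans h₄, hg₄, ?_⟩
  refine ((((hF₀.trans hF₁).trans hF₂).trans hF₃).trans hF₄).congr fun x => ?_
  rw [v1, v2, v3]
  simp only [val_lit, ne_eq, one_ne_zero, not_false_eq_true, true_imp_iff, true_and, and_assoc]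

/-- The solutions of the equations of a colouring. -/
def Solution (N : ℕ) (G₀ G₁ al : ℕ → ℕ) (κ : ℕ) (x : Fin N → ZMod 2) : Prop :=
  ∀ p < 4 * N, Equations G₀ G₁ al κ p x

/-- Compute the family of all solutions of the equations. -/
def solve : Prog :=
  .seq unitRows (forLoop 27 (lit 4 * .reg 2) imposeEquations)

open Classical in
/-- Each of the `4 N` groups of equations costs `O(N²)` steps, so that a system is solved in cubic
time. -/
theorem run_solve (hB : Big W S N) {G₀ G₁ al : ℕ → ℕ} (hG : Tables N G₀ G₁)
    {κ : ℕ} (hκ : κ ≤ 1) (hal : ∀ k, al k ≤ 1) {s : State} (hg : Good N s)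
    (h5 : s.reg 5 = κ) (h0 : s.mem 0 = G₀) (h1 : s.mem 1 = G₁) (h4 : s.mem 4 = al) :
    Run W S solve (118 * (N * (N * N))) s fun s' =>
      Same [3, 4, 6, 7, 8, 20, 21, 22, 23, 24, 25, 26, 27, 28, 29, 30, 31] [2, 5] s s' ∧
      Good N s' ∧ ∀ F, famVal N s' F = ∑ x, if Solution N G₀ G₁ al κ x then F x else 0 := by
  have hlin := hB.lin
  have hN := hB.hN
  have hWB := hB.hW
  have h3 : 16 * (N * N) ≤ N * (N * N) := Nat.mul_le_mul_right _ hN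
  have ht : 4 * N * (29 * (N * N) + 2) = 116 * (N * (N * N)) + 8 * N := by ring
  refine Run.seq (T₂ := 116 * (N * (N * N)) + 8 * N + 2) (run_unitRows hB hg) ?_ (by omega)
  rintro s₁ ⟨h₁, hg₁, hF₁⟩
  refine Run.for (4 * N)
    (fun p s' => Same [3, 4, 6, 7, 8, 20, 21, 22, 23, 24, 25, 26, 27, 28, 29, 30, 31] [2, 5] s s' ∧
      Good N s' ∧ Cuts N s₁ s' fun x => ∀ q < p, Equations G₀ G₁ al κ q x) (T := 29 * (N * N))
    (by omega) (by omega) ⟨h₁.mono, hg₁, (Cuts.of_eq rfl).congr (by simp)⟩ ?_ ?_ ?_ ?_ (by omega)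
  · rintro p s' v ⟨h, hg', hF⟩
    refine ⟨h.setReg, hg'.congr (by simp) (by simp) rfl rfl, fun F => ?_⟩
    rw [← hF, famVal_setReg]
  · rintro p s' - ⟨h, hg', -⟩ -
    simp [hg'.r2]
    omega
  · rintro p s' hp ⟨h, hg', hF⟩ hx
    refine Run.mono (run_imposeEquations hB hG hκ hal hg' hx hp ((h.r 5).trans h5)
      ((h.m 0).trans h0) ((h.m 1).trans h1) ((h.m 4).trans h4)) le_rfl ?_
    rintro s'' ⟨h', hg'', hF'⟩
    refine ⟨by rw [h'.r 27, hx], h.trans h', hg'', (hF.trans hF').congr fun x => ?_⟩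
    constructor
    · rintro ⟨g1, g2⟩ q hq
      rcases Nat.lt_succ_iff_lt_or_eq.1 hq with h | rfl
      · exact g1 q h
      · exact g2
    · exact fun g => ⟨fun q hq => g q (by omega), g p (by omega)⟩
  · rintro s' ⟨h, hg', hF⟩
    exact ⟨h, hg', fun F => by rw [hF, hF₁]; simp only [Solution]; congr!⟩

end WordRAM

/-! ### Gauss sums of quadratic functions over `ℤ/2` -/

section Quadratic

open Finset

/-- The character of order two of `ℤ/2`. -/
def sgn (a : ZMod 2) : ℂ := if a = 0 then 1 else -1

theorem sgn_add (a b : ZMod 2) : sgn (a + b) = sgn a * sgn b := by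
  have h : ∀ a : ZMod 2, a = 0 ∨ a = 1 := by decide
  have h2 : (1 : ZMod 2) + 1 = 0 := by decide
  rcases h a with rfl | rfl <;> rcases h b with rfl | rfl <;> simp [sgn, h2]

/-- A function with `Q 0 = 0` whose third difference vanishes, that is, a quadratic form together
with a linear form. -/
def IsQuadratic {V : Type*} [Add V] (Q : V → ZMod 2) : Prop :=
  ∀ x y z, Q (x + y + z) = Q (x + y) + Q (x + z) + Q (y + z) + Q x + Q y + Q z

/-- The difference of a quadratic function in the direction `u` is affine. -/
theorem IsQuadratic.diff_sum {V : Type*} [AddCommGroup V] {Q : V → ZMod 2} (hQ : IsQuadratic Q)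
    (u v : V) (A : Finset ℕ) (f : ℕ → V) :
    Q (v + ∑ i ∈ A, f i + u) + Q (v + ∑ i ∈ A, f i) =
      Q (v + u) + Q v + ∑ i ∈ A, (Q (f i + u) + Q (f i) + Q u) := by
  classical
  induction A using Finset.induction_on with
  | empty => simp
  | insert a A ha ih =>
    rw [sum_insert ha, sum_insert ha]
    have h := hQ (v + ∑ i ∈ A, f i) (f a) u
    have h2 : (2 : ZMod 2) = 0 := by decide
    rw [show v + (f a + ∑ i ∈ A, f i) = v + ∑ i ∈ A, f i + f a by abel, h]
    linear_combination ih + (Q (v + ∑ i ∈ A, f i + f a)) * h2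

theorem sgn_add_sgn {V : Type*} [AddCommGroup V] (Q : V → ZMod 2) (u y : V) :
    sgn (Q y) + sgn (Q (y + u)) = 2 * if Q (y + u) + Q y = 0 then sgn (Q y) else 0 := by
  generalize Q y = a
  generalize Q (y + u) = b
  have h : ∀ a : ZMod 2, a = 0 ∨ a = 1 := by decide
  have h2 : (1 : ZMod 2) + 1 = 0 := by decide
  rcases h a with rfl | rfl <;> rcases h b with rfl | rfl <;> simp [sgn, h2] <;> norm_num

end Quadratic

namespace WordRAM

open WordRAM.Expr

variable {W S N : ℕ}

/-- The first plus the second elementary symmetric polynomial: for bits, the parity of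
`m (m + 1) / 2`, where `m` is the number of ones. -/
def symm12 (a b c d e f : ZMod 2) : ZMod 2 :=
  a + b + c + d + e + f + (a * b + a * c + a * d + a * e + a * f + b * c + b * d + b * e + b * f +
    c * d + c * e + c * f + d * e + d * f + e * f)

theorem natCast_symm12 {a b c d e f : ℕ} (ha : a < 2) (hb : b < 2) (hc : c < 2) (hd : d < 2)
    (he : e < 2) (hf : f < 2) :
    (((a + b + c + d + e + f) * (a + b + c + d + e + f + 1) / 2 : ℕ) : ZMod 2) =
      symm12 a b c d e f := by
  have key : ∀ a b c d e f : Fin 2, (((a.val + b.val + c.val + d.val + e.val + f.val) *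
      (a.val + b.val + c.val + d.val + e.val + f.val + 1) / 2 : ℕ) : ZMod 2) =
      symm12 a.val b.val c.val d.val e.val f.val := by decide
  exact key ⟨a, ha⟩ ⟨b, hb⟩ ⟨c, hc⟩ ⟨d, hd⟩ ⟨e, he⟩ ⟨f, hf⟩

/-- The contribution to `quad` of the six edges of the tetrahedron whose first coordinate is `u`. -/
def quadTet (x : Fin N → ZMod 2) (u : ℕ) : ZMod 2 :=
  symm12 (coord x (u + 1)) (coord x (u + 2)) (coord x (u + 3)) (coord x (u + 6)) (coord x (u + 7))
    (coord x (u + 11))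

/-- The sum over the three edges of face `p % 4` of tetrahedron `p / 4`. -/
def faceSum (x : Fin N → ZMod 2) (p : ℕ) : ZMod 2 :=
  coord x (p / 4 * 16 + 4 * ((p + 1) % 4) + (p + 2) % 4) +
    coord x (p / 4 * 16 + 4 * ((p + 2) % 4) + (p + 3) % 4) +
    coord x (p / 4 * 16 + 4 * ((p + 3) % 4) + (p + 1) % 4)

/-- The quadratic function built from the tetrahedra `t` with `tau t = 1` and the faces `p` with
`phi p = 1`. -/
def quad (n : ℕ) (tau phi : ℕ → ℕ) (x : Fin N → ZMod 2) : ZMod 2 :=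
  ∑ t ∈ Finset.range n, (tau t : ZMod 2) * quadTet x (16 * t) +
    ∑ p ∈ Finset.range (4 * n), (phi p : ZMod 2) * faceSum x p

theorem isQuadratic_quad (n : ℕ) (tau phi : ℕ → ℕ) : IsQuadratic (quad (N := N) n tau phi) := by
  have h2 : (2 : ZMod 2) = 0 := by decide
  have h1 : ∀ u (x y z : Fin N → ZMod 2), quadTet (x + y + z) u = quadTet (x + y) u +
      quadTet (x + z) u + quadTet (y + z) u + quadTet x u + quadTet y u + quadTet z u := by
    intro u x y z
    have : quadTet (x + y + z) u = quadTet (x + y) u + quadTet (x + z) u + quadTet (y + z) u -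
        quadTet x u - quadTet y u - quadTet z u := by
      simp only [quadTet, symm12, coord_add]
      ring
    linear_combination this - (quadTet x u + quadTet y u + quadTet z u) * h2
  have h3 : ∀ p (x y z : Fin N → ZMod 2), faceSum (x + y + z) p = faceSum (x + y) p +
      faceSum (x + z) p + faceSum (y + z) p + faceSum x p + faceSum y p + faceSum z p := by
    intro p x y z
    have : faceSum (x + y + z) p = faceSum (x + y) p + faceSum (x + z) p + faceSum (y + z) p -
        faceSum x p - faceSum y p - faceSum z p := by
      simp only [faceSum, coord_add]
      ring
    linear_combination this - (faceSum x p + faceSum y p + faceSum z p) * h2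
  intro x y z
  simp only [quad, h1, h3, mul_add, Finset.sum_add_distrib]
  ring

/-- The entry in column `c` of the sum of the row in register `34` and `e` times the row in
register `33`, where `e` is in register `35`. -/
abbrev entryExpr (c : Expr) : Expr :=
  (load 2 (.reg 34 * .reg 2 + c) + .reg 35 * load 2 (.reg 33 * .reg 2 + c)) % lit 2

/-- Evaluate the quadratic function given by the segments `9` and `10` at the sum of the row in
register `34` and `e` times the row in register `33`, where `e` is in register `35`. -/
def evalQuad : Prog :=
  .seq (.assign 38 (lit 0)) <|
  .seq (forLoop 36 (.reg 0) <|
    .seq (.assign 39 (lit 16 * .reg 36)) <|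
    .seq (.assign 37 (entryExpr (.reg 39 + lit 1) + entryExpr (.reg 39 + lit 2) +
      entryExpr (.reg 39 + lit 3) + entryExpr (.reg 39 + lit 6) + entryExpr (.reg 39 + lit 7) +
      entryExpr (.reg 39 + lit 11))) <|
    .assign 38 (.reg 38 + load 9 (.reg 36) * (.reg 37 * (.reg 37 + lit 1) / lit 2))) <|
  .seq (forLoop 36 (lit 4 * .reg 0) <|
    .seq (.assign 39 (.reg 36 / lit 4 * lit 16)) <|
    .seq (.assign 40 ((.reg 36 + lit 1) % lit 4)) <|
    .seq (.assign 41 ((.reg 36 + lit 2) % lit 4)) <|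
    .seq (.assign 42 ((.reg 36 + lit 3) % lit 4)) <|
    .assign 38 (.reg 38 + load 10 (.reg 36) * (entryExpr (.reg 39 + lit 4 * .reg 40 + .reg 41) +
      entryExpr (.reg 39 + lit 4 * .reg 41 + .reg 42) +
      entryExpr (.reg 39 + lit 4 * .reg 42 + .reg 40)))) <|
  .assign 38 (.reg 38 % lit 2)

theorem entryExpr_spec (hB : Big W S N) {s : State} (hb2 : Bits s 2) (h2 : s.reg 2 = N)
    {i m e : ℕ} (h34 : s.reg 34 = i) (h33 : s.reg 33 = m) (h35 : s.reg 35 = e) (hi : i ≤ N)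
    (hm : m ≤ N) (he : e ≤ 1) {c : Expr} (hc : c.Safe W S s) (hcN : c.val s < N) :
    (entryExpr c).Safe W S s ∧ (entryExpr c).val s < 2 ∧ ((entryExpr c).val s : ZMod 2) =
      coord (rows N s i + (e : ZMod 2) • rows N s m) (c.val s) := by
  have hWB := hB.hW
  have hSB := hB.hS
  have a1 := hB.addr hi hcN
  have a2 := hB.addr hm hcN
  have b1 := hb2 (i * N + c.val s)
  have b2 := hb2 (m * N + c.val s)
  have b3 := mul_bit_le he b2
  have hN := hB.hN
  have hlin := hB.lin
  refine ⟨?_, ?_, ?_⟩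
  · simp only [safe_add, safe_mul, safe_reg, safe_load, safe_mod, val_reg, val_mul, val_add,
      val_load, val_lit, safe_lit, true_and, h34, h33, h35, h2, hc]
    omega
  · simp only [val_mod, val_lit]
    omega
  · simp only [val_mod, val_lit, val_add, val_load, val_mul, val_reg, h34, h33, h35, h2]
    rw [ZMod.natCast_mod]
    simp [coord, hcN, rows]

theorem run_evalQuad {n : ℕ} (hB : Big W S N) (hn : N = 16 * n) {tau phi : ℕ → ℕ}
    (htau : ∀ k, tau k ≤ 1) (hphi : ∀ k, phi k ≤ 1) {s : State} (hb2 : Bits s 2)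
    (h0 : s.reg 0 = n) (h2 : s.reg 2 = N) (h9 : s.mem 9 = tau) (h10 : s.mem 10 = phi)
    {i m e : ℕ} (h34 : s.reg 34 = i) (h33 : s.reg 33 = m) (h35 : s.reg 35 = e) (hi : i ≤ N)
    (hm : m ≤ N) (he : e ≤ 1) :
    Run W S evalQuad (3 * N) s fun s' => Same [36, 37, 38, 39, 40, 41, 42] [] s s' ∧
      s'.reg 38 ≤ 1 ∧
      (s'.reg 38 : ZMod 2) = quad n tau phi (rows N s i + (e : ZMod 2) • rows N s m) := by
  have hlin := hB.lin
  have hN := hB.hN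
  have hWB := hB.hW
  have hSB := hB.hS
  set v := rows N s i + (e : ZMod 2) • rows N s m with hv
  refine Run.assign_seq (by simp) ?_ (by omega)
  refine Run.seq (T₁ := 5 * n + 2) (T₂ := 28 * n + 3) (R := fun s' =>
    Same [36, 37, 38, 39, 40, 41, 42] [] s s' ∧ s'.reg 38 ≤ 21 * n ∧ (s'.reg 38 : ZMod 2) =
      ∑ t ∈ Finset.range n, (tau t : ZMod 2) * quadTet v (16 * t)) ?_ ?_ (by omega)
  · refine Run.for n (fun k s' =>
      Same [36, 37, 38, 39, 40, 41, 42] [] s s' ∧ s'.reg 38 ≤ 21 * k ∧ (s'.reg 38 : ZMod 2) =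
      ∑ t ∈ Finset.range k, (tau t : ZMod 2) * quadTet v (16 * t)) (T := 3) (by omega) (by omega)
      ⟨.refl_setReg, by simp, by simp⟩ ?_ ?_ ?_ (fun _ h => h) (by omega)
    · rintro k s' v ⟨h, h', h''⟩
      exact ⟨h.setReg, by simpa using h', by simpa using h''⟩
    · rintro k s' - ⟨h, -⟩ -
      simp [h.r 0, h0]
    · rintro k s' hk ⟨h, h38, hsum⟩ hx
      refine Run.assign_seq (by simp [hx]; omega) ?_ (by omega)
      simp only [val_mul, val_lit, val_reg, hx]
      have hg : Same [36, 37, 38, 39, 40, 41, 42] [] s (s'.setReg 39 (16 * k)) := h.setReg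
      have hentry : ∀ j < 16, _ := fun j hj => entryExpr_spec hB
        (s := s'.setReg 39 (16 * k)) (fun i => by rw [hg.m 2]; exact hb2 i)
        ((hg.r 2).trans h2) ((hg.r 34).trans h34) ((hg.r 33).trans h33) ((hg.r 35).trans h35) hi hm
        he (c := .reg 39 + lit j) (by simp; omega) (by simp; omega)
      rw [rows_congr (hg.m 2), ← hv] at hentry
      simp only [val_add (s'.setReg 39 (16 * k)) (.reg 39) (lit _), val_reg, val_lit, setReg_reg,
        if_true] at hentry
      obtain ⟨s1, l1, e1⟩ := hentry 1 (by omega)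
      obtain ⟨s2, l2, e2⟩ := hentry 2 (by omega)
      obtain ⟨s3, l3, e3⟩ := hentry 3 (by omega)
      obtain ⟨s4, l4, e4⟩ := hentry 6 (by omega)
      obtain ⟨s5, l5, e5⟩ := hentry 7 (by omega)
      obtain ⟨s6, l6, e6⟩ := hentry 11 (by omega)
      have hcast := natCast_symm12 l1 l2 l3 l4 l5 l6
      rw [e1, e2, e3, e4, e5, e6, ← quadTet] at hcast
      clear hentry e1 e2 e3 e4 e5 e6
      generalize hE1 : entryExpr (.reg 39 + lit 1) = E1 at *
      generalize hE2 : entryExpr (.reg 39 + lit 2) = E2 at *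
      generalize hE3 : entryExpr (.reg 39 + lit 3) = E3 at *
      generalize hE4 : entryExpr (.reg 39 + lit 6) = E4 at *
      generalize hE5 : entryExpr (.reg 39 + lit 7) = E5 at *
      generalize hE6 : entryExpr (.reg 39 + lit 11) = E6 at *
      refine Run.assign_seq ?_ ?_ (by omega)
        (by rw [← hE1, ← hE2, ← hE3, ← hE4, ← hE5, ← hE6]; decide)
      · simp only [safe_add, s1, s2, s3, s4, s5, s6, true_and, val_add]
        omega
      simp only [val_add]
      clear hE1 hE2 hE3 hE4 hE5 hE6 s1 s2 s3 s4 s5 s6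
      generalize val (s'.setReg 39 (16 * k)) E1 = b1 at *
      generalize val (s'.setReg 39 (16 * k)) E2 = b2 at *
      generalize val (s'.setReg 39 (16 * k)) E3 = b3 at *
      generalize val (s'.setReg 39 (16 * k)) E4 = b4 at *
      generalize val (s'.setReg 39 (16 * k)) E5 = b5 at *
      generalize val (s'.setReg 39 (16 * k)) E6 = b6 at *
      generalize hb : b1 + b2 + b3 + b4 + b5 + b6 = b at *
      have hb6 : b ≤ 6 := by omega
      have hbb : b * (b + 1) ≤ 42 := Nat.mul_le_mul hb6 (Nat.succ_le_succ hb6)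
      have hprod : tau k * (b * (b + 1) / 2) ≤ 1 * 21 := Nat.mul_le_mul (htau k) (by omega)
      refine Run.assign ?_ ⟨by simp [hx], Same.setReg (Same.setReg hg), ?_, ?_⟩ (by omega)
      · simp only [safe_add, safe_mul, safe_div, safe_reg, safe_load, safe_lit, val_reg, val_lit,
          val_mul, val_add, val_div, val_load, setReg_reg, setReg_mem, Nat.reduceEqDiff, if_false,
          if_true, h.m 9, h9, hx, true_and]
        omega
      · simp only [val_reg, val_lit, val_mul, val_add, val_div, val_load, setReg_reg, setReg_mem,
          Nat.reduceEqDiff, if_false, if_true, h.m 9, h9, hx]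
        omega
      · simp only [val_reg, val_lit, val_mul, val_add, val_div, val_load, setReg_reg, setReg_mem,
          Nat.reduceEqDiff, if_false, if_true, h.m 9, h9, hx]
        rw [Finset.sum_range_succ, Nat.cast_add, hsum, Nat.cast_mul, hcast]
  rintro s₁ ⟨hs₁, hle₁, hsum₁⟩
  refine Run.seq (T₁ := 28 * n + 2) (T₂ := 1) (R := fun s' =>
    Same [36, 37, 38, 39, 40, 41, 42] [] s s' ∧ s'.reg 38 ≤ 33 * n ∧ (s'.reg 38 : ZMod 2) =
      quad n tau phi v) ?_ ?_ (by omega)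
  · refine Run.for (4 * n) (fun k s' =>
      Same [36, 37, 38, 39, 40, 41, 42] [] s s' ∧ s'.reg 38 ≤ 21 * n + 3 * k ∧
      (s'.reg 38 : ZMod 2) = ∑ t ∈ Finset.range n, (tau t : ZMod 2) * quadTet v (16 * t) +
        ∑ p ∈ Finset.range k, (phi p : ZMod 2) * faceSum v p) (T := 5) (by omega) (by omega)
      ⟨hs₁, by omega, by simpa using hsum₁⟩ ?_ ?_ ?_ (fun _ h => ⟨h.1, by omega, h.2.2⟩) (by omega)
    · rintro k s' v ⟨h, h', h''⟩
      exact ⟨h.setReg, by simpa using h', by simpa using h''⟩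
    · rintro k s' - ⟨h, -⟩ -
      simp [h.r 0, h0]
      omega
    · rintro k s' hk ⟨h, h38, hsum⟩ hx
      refine Run.assign_seq (by simp [hx]; omega) ?_ (by omega)
      refine Run.assign_seq (by simp [hx]; omega) ?_ (by omega)
      refine Run.assign_seq (by simp [hx]; omega) ?_ (by omega)
      refine Run.assign_seq (by simp [hx]; omega) ?_ (by omega)
      simp only [val_mul, val_div, val_mod, val_add, val_lit, val_reg, setReg_reg, hx,
        Nat.reduceEqDiff, if_false]
      generalize hs₂ : (((s'.setReg 39 (k / 4 * 16)).setReg 40 ((k + 1) % 4)).setReg 41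
        ((k + 2) % 4)).setReg 42 ((k + 3) % 4) = s₂
      have hg : Same [36, 37, 38, 39, 40, 41, 42] [] s s₂ := by
        rw [← hs₂]; exact Same.setReg (Same.setReg (Same.setReg h.setReg))
      have r39 : s₂.reg 39 = k / 4 * 16 := by simp [← hs₂]
      have r40 : s₂.reg 40 = (k + 1) % 4 := by simp [← hs₂]
      have r41 : s₂.reg 41 = (k + 2) % 4 := by simp [← hs₂]
      have r42 : s₂.reg 42 = (k + 3) % 4 := by simp [← hs₂]
      have r36 : s₂.reg 36 = k := by simp [← hs₂, hx]
      have r38 : s₂.reg 38 = s'.reg 38 := by simp [← hs₂]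
      clear hs₂
      have hentry : ∀ x y a b, s₂.reg x = a → s₂.reg y = b → a < 4 → b < 4 → _ :=
        fun x y a b hxa hyb ha hb => entryExpr_spec hB
          (s := s₂) (fun i => by rw [hg.m 2]; exact hb2 i)
          ((hg.r 2).trans h2) ((hg.r 34).trans h34) ((hg.r 33).trans h33) ((hg.r 35).trans h35) hi
          hm he (c := .reg 39 + lit 4 * .reg x + .reg y) (by simp [r39, hxa, hyb]; omega)
          (by simp [r39, hxa, hyb]; omega)
      rw [rows_congr (hg.m 2), ← hv] at hentry
      obtain ⟨s1, l1, e1⟩ := hentry 40 41 _ _ r40 r41 (by omega) (by omega)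
      obtain ⟨s2, l2, e2⟩ := hentry 41 42 _ _ r41 r42 (by omega) (by omega)
      obtain ⟨s3, l3, e3⟩ := hentry 42 40 _ _ r42 r40 (by omega) (by omega)
      have hcast : (((entryExpr (.reg 39 + lit 4 * .reg 40 + .reg 41)).val s₂ +
          (entryExpr (.reg 39 + lit 4 * .reg 41 + .reg 42)).val s₂ +
          (entryExpr (.reg 39 + lit 4 * .reg 42 + .reg 40)).val s₂ : ℕ) : ZMod 2) =
          faceSum v k := by
        rw [Nat.cast_add, Nat.cast_add, e1, e2, e3]
        simp only [val_add, val_mul, val_reg, val_lit, r39, r40, r41, r42]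
        rfl
      clear e1 e2 e3 hentry
      generalize hE1 : entryExpr (.reg 39 + lit 4 * .reg 40 + .reg 41) = E1 at *
      generalize hE2 : entryExpr (.reg 39 + lit 4 * .reg 41 + .reg 42) = E2 at *
      generalize hE3 : entryExpr (.reg 39 + lit 4 * .reg 42 + .reg 40) = E3 at *
      have hprod : phi k * (E1.val s₂ + E2.val s₂ + E3.val s₂) ≤ 1 * 3 :=
        Nat.mul_le_mul (hphi k) (by omega)
      refine Run.assign ?_ ⟨by simp [r36], hg.setReg, ?_, ?_⟩ (by omega)
        (by rw [← hE1, ← hE2, ← hE3]; decide)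
      · simp only [safe_add, safe_mul, safe_reg, safe_load, val_reg, val_add, val_load, val_mul,
          hg.m 10, h10, r36, r38, true_and, s1, s2, s3]
        omega
      · simp only [val_reg, val_mul, val_add, val_load, setReg_reg, if_true, hg.m 10, h10, r36, r38]
        omega
      · simp only [val_reg, val_mul, val_add, val_load, setReg_reg, if_true, hg.m 10, h10, r36, r38]
        rw [Finset.sum_range_succ, Nat.cast_add, hsum, Nat.cast_mul, hcast, add_assoc]
  · rintro s₂ ⟨hs₂, hle₂, hsum₂⟩
    refine Run.assign (by simp; omega) ⟨hs₂.setReg, by simp; omega, ?_⟩ (by omega)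
    simp [ZMod.natCast_mod, hsum₂]

/-- Remove the last direction `u` and impose on the rest of the family the affine equation
`Q (y + u) + Q y = 0`. -/
def popDirection : Prog :=
  .seq (.assign 33 (.reg 3)) <|
  .seq (.assign 3 (.reg 3 - lit 1)) <|
  .seq (.assign 10 (.reg 10 + lit 1)) <|
  .seq (.assign 34 (.reg 33)) <|
  .seq (.assign 35 (lit 0)) <|
  .seq evalQuad <|
  .seq (.assign 43 (.reg 38)) <|
  .seq (forLoop 44 (.reg 3 + lit 1) <|
    .seq (.assign 34 (.reg 44)) <|
    .seq (.assign 35 (lit 0)) <|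
    .seq evalQuad <|
    .seq (.assign 45 (.reg 38)) <|
    .seq (.assign 35 (lit 1)) <|
    .seq evalQuad <|
    .store 5 (.reg 44)
      ((.reg 45 + .reg 38 + .reg 43 * (lit 1 - equal (.reg 44) (lit 0))) % lit 2)) <|
  eliminate

/-- Pairing `y` with `y + u` gives `(-1) ^ Q y + (-1) ^ Q (y + u)`, which vanishes unless
`Q (y + u) + Q y = 0`.  Hence removing a direction and imposing this equation, which is affine since
`Q` is quadratic, halves the sum. -/
theorem run_popDirection {n : ℕ} (hB : Big W S N) (hn : N = 16 * n) {tau phi : ℕ → ℕ}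
    (htau : ∀ k, tau k ≤ 1) (hphi : ∀ k, phi k ≤ 1) {s : State} (hg : Good N s)
    (h0 : s.reg 0 = n) (h9 : s.mem 9 = tau) (h10 : s.mem 10 = phi) (h3 : s.reg 3 ≠ 0)
    (hr10 : s.reg 10 < N) :
    Run W S popDirection (14 * (N * N) - 1) s fun s' =>
      Same [3, 4, 10, 20, 21, 22, 23, 24, 25, 33, 34, 35, 36, 37, 38, 39, 40, 41, 42, 43, 44, 45]
        [2, 5] s s' ∧ Good N s' ∧ s'.reg 3 < s.reg 3 ∧ s'.reg 10 = s.reg 10 + 1 ∧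
      famVal N s (fun x => sgn (quad n tau phi x)) =
        2 * famVal N s' fun x => sgn (quad n tau phi x) := by
  have hlin := hB.lin
  have hN := hB.hN
  have hWB := hB.hW
  have hSB := hB.hS
  have h3N := hg.r3
  obtain ⟨d, hd⟩ : ∃ d, s.reg 3 = d + 1 := ⟨s.reg 3 - 1, by omega⟩
  have hmul : (d + 1) * (6 * N + 5 + 2) ≤ N * (6 * N + 5 + 2) := Nat.mul_le_mul_right _ (by omega)
  have hmul' : N * (6 * N + 5 + 2) = 6 * (N * N) + 7 * N := by ring
  set Q : (Fin N → ZMod 2) → ZMod 2 := quad n tau phi with hQ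
  have hQq : IsQuadratic Q := isQuadratic_quad n tau phi
  set R := rows N s with hR
  refine Run.assign_seq (by simp) ?_ (by omega)
  refine Run.assign_seq (by simp; omega) ?_ (by omega)
  refine Run.assign_seq (by simp; omega) ?_ (by omega)
  refine Run.assign_seq (by simp) ?_ (by omega)
  refine Run.assign_seq (by simp) ?_ (by omega)
  simp only [val_reg, val_lit, val_sub, val_add, setReg_reg, Nat.reduceEqDiff, if_false, if_true]
  generalize hs₁ : ((((s.setReg 33 (s.reg 3)).setReg 3 (s.reg 3 - 1)).setReg 10
    (s.reg 10 + 1)).setReg 34 (s.reg 3)).setReg 35 0 = s₁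
  have hg₁ : Same [3, 10, 33, 34, 35] [] s s₁ := by
    rw [← hs₁]
    exact Same.setReg (Same.setReg (Same.setReg (Same.setReg Same.refl_setReg)))
  have r3 : s₁.reg 3 = d := by simp [← hs₁, hd]
  have r10 : s₁.reg 10 = s.reg 10 + 1 := by simp [← hs₁]
  have r33 : s₁.reg 33 = d + 1 := by simp [← hs₁, hd]
  have r34 : s₁.reg 34 = d + 1 := by simp [← hs₁, hd]
  have r35 : s₁.reg 35 = 0 := by simp [← hs₁]
  clear hs₁
  refine Run.seq (T₂ := 14 * (N * N) - 1 - 5 - 3 * N) (run_evalQuad hB hn htau hphi (s := s₁)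
    (i := d + 1) (m := d + 1) (e := 0) (fun k => by rw [hg₁.m 2]; exact hg.b2 k)
    ((hg₁.r 0).trans h0) ((hg₁.r 2).trans hg.r2) ((hg₁.m 9).trans h9) ((hg₁.m 10).trans h10) r34
    r33 r35 (by omega) (by omega) (by omega)) ?_ (by omega)
  rintro s₂ ⟨hs₂, hle₂, hq₂⟩
  rw [Nat.cast_zero, zero_smul, add_zero, rows_congr (hg₁.m 2), ← hQ, ← hR] at hq₂
  refine Run.assign_seq (by simp) ?_ (by omega)
  have hg₃ : Same [3, 10, 33, 34, 35, 36, 37, 38, 39, 40, 41, 42, 43, 44, 45] [5] s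
      (s₂.setReg 43 (s₂.reg 38)) := by
    have : Same [3, 10, 33, 34, 35, 36, 37, 38, 39, 40, 41, 42, 43, 44, 45] [5] s s₁ := hg₁.mono
    exact (this.trans hs₂).setReg
  simp only [val_reg]
  refine Run.seq (T₁ := 6 * (N * N) + 7 * N + 2) (T₂ := 6 * (N * N)) (R := fun s' =>
    Same [3, 10, 33, 34, 35, 36, 37, 38, 39, 40, 41, 42, 43, 44, 45] [5] s s' ∧ Bits s' 5 ∧
    s'.reg 3 = d ∧ s'.reg 10 = s.reg 10 + 1 ∧
    ∀ i, i ≤ d → (s'.mem 5 i : ZMod 2) = Q (R i + R (d + 1)) + Q (R i) +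
      if i = 0 then 0 else Q (R (d + 1))) ?_ ?_ (by omega)
  · refine Run.for (d + 1) (fun k s' =>
      (Same [3, 10, 33, 34, 35, 36, 37, 38, 39, 40, 41, 42, 43, 44, 45] [5] s s' ∧ Bits s' 5 ∧
      s'.reg 3 = d ∧ s'.reg 10 = s.reg 10 + 1 ∧ s'.reg 33 = d + 1 ∧ s'.reg 43 = s₂.reg 38) ∧
      ∀ i, i < k → (s'.mem 5 i : ZMod 2) = Q (R i + R (d + 1)) + Q (R i) +
        if i = 0 then 0 else Q (R (d + 1))) (T := 6 * N + 5)
      (by omega) (by omega) ⟨⟨hg₃, ?_, ?_, ?_, ?_, ?_⟩, by simp⟩ ?_ ?_ ?_ ?_ (by omega)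
    · intro k
      rw [hg₃.m 2 |> fun _ => (show (s₂.setReg 43 (s₂.reg 38)).mem 5 = s.mem 5 from
        (hs₂.m 5).trans (hg₁.m 5))]
      exact hg.b5 k
    · simp [hs₂.r 3, r3]
    · simp [hs₂.r 10, r10]
    · simp [hs₂.r 33, r33]
    · simp
    · rintro k s' v ⟨⟨h, h', h''⟩, hm⟩
      exact ⟨⟨h.setReg, h', by simpa using h''⟩, hm⟩
    · rintro k s' - ⟨⟨h, h', h3', -⟩, -⟩ -
      simp [h3']
      omega
    · rintro k s' hk ⟨⟨h, hb5, h3', h10', h33', h43'⟩, hm⟩ hx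
      refine Run.assign_seq (by simp) ?_ (by omega)
      refine Run.assign_seq (by simp) ?_ (by omega)
      simp only [val_reg, val_lit, hx]
      refine Run.seq (T₂ := 3 * N + 3) (run_evalQuad hB hn htau hphi
        (i := k) (m := d + 1) (e := 0) ?_ ?_ ?_ ?_ ?_ ?_ ?_ ?_ (by omega) (by omega)
        (by omega)) ?_ (by omega)
      · intro k; rw [setReg_mem, setReg_mem, h.m 2]; exact hg.b2 k
      · simp [h.r 0, h0]
      · simp [h.r 2, hg.r2]
      · simp [h.m 9, h9]
      · simp [h.m 10, h10]
      · simp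
      · simp [h33']
      · simp
      rintro s₃ ⟨hs₃, hle₃, hq₃⟩
      rw [Nat.cast_zero, zero_smul, add_zero, rows_setReg, rows_setReg, rows_congr (h.m 2), ← hQ,
        ← hR] at hq₃
      have h₃ : Same [3, 10, 33, 34, 35, 36, 37, 38, 39, 40, 41, 42, 43, 44, 45] [5] s s₃ :=
        (h.setReg.setReg).trans hs₃
      refine Run.assign_seq (by simp) ?_ (by omega)
      refine Run.assign_seq (by simp; omega) ?_ (by omega)
      simp only [val_reg, val_lit]
      refine Run.seq (T₂ := 1) (run_evalQuad hB hn htau hphi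
        (i := k) (m := d + 1) (e := 1) ?_ ?_ ?_ ?_ ?_ ?_ ?_ ?_ (by omega) (by omega)
        (by omega)) ?_ (by omega)
      · intro k; rw [setReg_mem, setReg_mem, h₃.m 2]; exact hg.b2 k
      · simp [h₃.r 0, h0]
      · simp [h₃.r 2, hg.r2]
      · simp [h₃.m 9, h9]
      · simp [h₃.m 10, h10]
      · simp [hs₃.r 34]
      · simp [hs₃.r 33, h33']
      · simp
      rintro s₄ ⟨hs₄, hle₄, hq₄⟩
      rw [Nat.cast_one, one_smul, rows_setReg, rows_setReg, rows_congr (h₃.m 2), ← hQ,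
        ← hR] at hq₄
      have h₄ : Same [3, 10, 33, 34, 35, 36, 37, 38, 39, 40, 41, 42, 43, 44, 45] [5] s s₄ :=
        (h₃.setReg.setReg).trans hs₄
      have r44 : s₄.reg 44 = k := by simp [hs₄.r 44, hs₃.r 44, hx]
      have r45 : s₄.reg 45 = s₃.reg 38 := by simp [hs₄.r 45]
      have r43 : s₄.reg 43 = s₂.reg 38 := by simp [hs₄.r 43, hs₃.r 43, h43']
      have m5 : s₄.mem 5 = s'.mem 5 := by simp [hs₄.m 5, hs₃.m 5]
      have hmb := mul_bit_le hle₂ (Nat.sub_le 1 (if k = 0 then 1 else 0))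
      refine Run.store (by simp) ?_ (by simp [r44]; omega)
        ⟨by simp [r44], ⟨h₄.setMem, ?_, ?_, ?_, ?_, ?_⟩, ?_⟩ le_rfl
      · refine ⟨⟨by simp; omega, ⟨by simp, ⟨by simp; omega, .equal (by omega) (by simp) (by simp),
          ?_⟩, ?_⟩, ?_⟩, by simp; omega, ?_⟩
        · change 1 - _ ≤ W
          omega
        · change (_ * (1 - if _ then 1 else 0) : ℕ) ≤ W
          simp only [val_reg, val_lit, r43, r44]
          omega
        · change (_ + _ + (_ * (1 - if _ then 1 else 0)) : ℕ) ≤ W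
          simp only [val_reg, val_lit, r43, r44, r45]
          omega
        · change _ % 2 ≤ W
          omega
      · intro i
        simp only [setMem_mem, if_true, Function.update_apply, val_mod, val_lit, m5]
        split_ifs
        · omega
        · exact hb5 i
      · simp [hs₄.r 3, hs₃.r 3, h3']
      · simp [hs₄.r 10, hs₃.r 10, h10']
      · simp [hs₄.r 33, hs₃.r 33, h33']
      · simp [r43]
      · intro i hi
        simp only [setMem_mem, if_true, Function.update_apply, m5, val_reg, r44]
        by_cases hik : i = k
        · simp only [hik, if_true, val_mod, val_lit, ZMod.natCast_mod, val_add, val_mul, val_sub,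
            val_equal, val_reg, r43, r44, r45, Nat.cast_add, Nat.cast_mul, hq₃, hq₄, hq₂]
          split_ifs <;> simp [add_comm]
        · rw [if_neg hik]
          exact hm i (by omega)
    · rintro s' ⟨⟨h, h', h3', h10', -⟩, hm⟩
      exact ⟨h, h', h3', h10', fun i hi => hm i (by omega)⟩
  · rintro s₃ ⟨h₃, hb5, h3', h10', hm⟩
    refine Run.mono (run_eliminate hB (s := s₃) ((h₃.r 2).trans hg.r2) (by omega)
      (fun k => by rw [h₃.m 2]; exact hg.b2 k) hb5 (fun y => Q (y + R (d + 1)) + Q y) ?_) le_rfl ?_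
    · intro A hA
      rw [rows_congr (h₃.m 2), ← hR, hQq.diff_sum, hm 0 (by omega), if_pos rfl, add_zero]
      congr 1
      refine Finset.sum_congr rfl fun i hi => ?_
      have := Finset.mem_range.1 (hA hi)
      rw [hm (i + 1) (by omega), if_neg (by omega)]
    · rintro s₄ ⟨h₄, hb2, h34, hF⟩
      have hh : Same [3, 4, 10, 20, 21, 22, 23, 24, 25, 33, 34, 35, 36, 37, 38, 39, 40, 41, 42, 43,
        44, 45] [2, 5] s s₃ := h₃.mono
      refine ⟨hh.trans h₄, ⟨?_, by omega, hb2, fun k => ?_⟩, by omega, ?_, ?_⟩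
      · rw [h₄.r 2, h₃.r 2, hg.r2]
      · rw [h₄.m 5]; exact hb5 k
      · rw [h₄.r 10, h10']
      · rw [hF]
        simp only [famVal, h₃.r 4, h3', hd, rows_congr (h₃.m 2)]
        rw [← hR, famSum_succ]
        simp only [sgn_add_sgn]
        split_ifs
        · simp only [famSum, Finset.mul_sum]
        · simp

/-- Evaluate the Gauss sum of the quadratic function over the family: register `10` receives an
exponent of `2` and register `38` a sign. -/
def gaussSum : Prog :=
  .seq (.assign 10 (lit 0)) <|
  .seq (forLoop 32 (.reg 2) (.ite (.reg 3) popDirection .skip)) <|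
  .seq (.assign 33 (lit 0)) <|
  .seq (.assign 34 (lit 0)) <|
  .seq (.assign 35 (lit 0)) evalQuad

/-- The Gauss sum of a quadratic function over an affine family is zero or a power of two up to
sign, and it is found in cubic time although the family has exponentially many members. -/
theorem run_gaussSum {n : ℕ} (hB : Big W S N) (hn : N = 16 * n) {tau phi : ℕ → ℕ}
    (htau : ∀ k, tau k ≤ 1) (hphi : ∀ k, phi k ≤ 1) {s : State} (hg : Good N s)
    (h0 : s.reg 0 = n) (h9 : s.mem 9 = tau) (h10 : s.mem 10 = phi) :
    Run W S gaussSum (15 * (N * (N * N))) s fun s' =>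
      Same [3, 4, 10, 20, 21, 22, 23, 24, 25, 32, 33, 34, 35, 36, 37, 38, 39, 40, 41, 42, 43, 44,
        45] [2, 5] s s' ∧ Good N s' ∧ s'.reg 10 ≤ N ∧ s'.reg 38 ≤ 1 ∧
      famVal N s (fun x => sgn (quad n tau phi x)) =
        if s'.reg 4 = 0 then 2 ^ s'.reg 10 * (-1) ^ s'.reg 38 else 0 := by
  have hlin := hB.lin
  have hN := hB.hN
  have hWB := hB.hW
  have hSB := hB.hS
  have hNN : 16 * (N * N) ≤ N * (N * N) := Nat.mul_le_mul_right _ hN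
  have ht : N * (14 * (N * N) + 2) = 14 * (N * (N * N)) + 2 * N := by ring
  refine Run.assign_seq (by simp) ?_ (by omega)
  refine Run.seq (T₁ := 14 * (N * (N * N)) + 2 * N + 2) (T₂ := 3 * N + 3) (R := fun s' =>
    Same [3, 4, 10, 20, 21, 22, 23, 24, 25, 32, 33, 34, 35, 36, 37, 38, 39, 40, 41, 42, 43, 44,
      45] [2, 5] s s' ∧ Good N s' ∧ s'.reg 10 ≤ N ∧ s'.reg 3 = 0 ∧
    famVal N s (fun x => sgn (quad n tau phi x)) =
      2 ^ s'.reg 10 * famVal N s' fun x => sgn (quad n tau phi x)) ?_ ?_ (by omega)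
  · refine Run.for N (fun k s' =>
      Same [3, 4, 10, 20, 21, 22, 23, 24, 25, 32, 33, 34, 35, 36, 37, 38, 39, 40, 41, 42, 43, 44,
        45] [2, 5] s s' ∧ Good N s' ∧ s'.reg 10 ≤ k ∧ (s'.reg 3 = 0 ∨ s'.reg 3 + k ≤ N) ∧
      famVal N s (fun x => sgn (quad n tau phi x)) =
        2 ^ s'.reg 10 * famVal N s' fun x => sgn (quad n tau phi x)) (T := 14 * (N * N)) (by omega)
      (by omega) ⟨.refl_setReg, ?_, by simp, ?_, ?_⟩ ?_ ?_ ?_ ?_ (by omega)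
    · exact hg.congr (by simp) (by simp) rfl rfl
    · simpa using .inr hg.r3
    · rw [famVal_setReg]; simp
    · rintro k s' v ⟨h, hg', h10', h3', hF⟩
      exact ⟨h.setReg, hg'.congr (by simp) (by simp) rfl rfl, by simpa using h10',
        by simpa using h3', by rw [famVal_setReg, hF]; simp⟩
    · rintro k s' - ⟨h, hg', -⟩ -
      simp [hg'.r2]
    · rintro k s' hk ⟨h, hg', h10', h3', hF⟩ hx
      refine Run.ite (by simp) ?_ ?_ (by omega)
      · intro hv
        refine Run.mono (run_popDirection hB hn htau hphi hg' ((h.r 0).trans h0)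
          ((h.m 9).trans h9) ((h.m 10).trans h10) hv (by omega)) le_rfl ?_
        rintro s'' ⟨h', hg'', h3'', h10'', hF'⟩
        refine ⟨by rw [h'.r 32, hx], h.trans h', hg'', by omega, by omega, ?_⟩
        rw [hF, hF', h10'', pow_succ, mul_assoc]
      · intro hv
        exact Run.skip ⟨hx, h, hg', by omega, .inl hv, hF⟩ (by omega)
    · rintro s' ⟨h, hg', h10', h3', hF⟩
      exact ⟨h, hg', h10', by omega, hF⟩
  · rintro s' ⟨h, hg', h10', h3', hF⟩
    refine Run.assign_seq (by simp) ?_ (by omega)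
    refine Run.assign_seq (by simp) ?_ (by omega)
    refine Run.assign_seq (by simp) ?_ (by omega)
    simp only [val_lit]
    refine Run.mono (run_evalQuad hB hn htau hphi (i := 0) (e := 0) (m := 0) ?_ ?_ ?_ ?_ ?_
      ?_ ?_ ?_ (by omega) (by omega) (by omega)) (by omega) ?_
    · intro k; exact hg'.b2 k
    · simp [h.r 0, h0]
    · simp [hg'.r2]
    · simp [h.m 9, h9]
    · simp [h.m 10, h10]
    · simp
    · simp
    · simp
    · rintro s'' ⟨h'', h38, hq⟩
      rw [Nat.cast_zero, zero_smul, add_zero, rows_setReg, rows_setReg,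
        rows_setReg] at hq
      refine ⟨(h.setReg.setReg.setReg).trans h'', ?_, ?_, h38, ?_⟩
      · exact hg'.congr (by simp [h''.r 2]) (by simp [h''.r 3]) (by simp [h''.m 2])
          (by simp [h''.m 5])
      · simp [h''.r 10, h10']
      · rw [hF]
        simp only [famVal, h''.r 4, h''.r 10, setReg_reg, Nat.reduceEqDiff, if_false, h3']
        split_ifs
        · rw [famSum]
          simp only [Finset.range_zero, Finset.powerset_empty, Finset.sum_singleton,
            Finset.sum_empty, add_zero, ← hq]
          congr 1
          have : s''.reg 38 = 0 ∨ s''.reg 38 = 1 := by omega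
          rcases this with h | h <;> simp [h, sgn]
        · simp

end WordRAM

/-! ### Binary arithmetic -/

namespace WordRAM

open WordRAM.Expr

variable {W S : ℕ}

/-- Add (`reg 17 = 1`) or subtract (`reg 17 = 0`) `2 ^ reg 16` to the binary number with `reg 48`
digits in segment `g`, by propagating a carry or a borrow.  Afterwards `reg 16 = reg 48` if the
carry leaves the number. -/
def ripple (g : ℕ) : Prog :=
  forLoop 46 (.reg 48) <|
    .ite (equal (.reg 46) (.reg 16))
      (.seq (.assign 47 (load g (.reg 46))) <|
      .seq (.store g (.reg 46) (lit 1 - .reg 47)) <|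
      .ite (equal (.reg 47) (.reg 17)) (.assign 16 (.reg 16 + lit 1)) .skip)
      .skip

theorem binary_setMem (s : State) (g i v L : ℕ) (hi : i < L) :
    ((s.setMem g i v).binary g L : ℤ) = s.binary g L + ((v : ℤ) - s.mem g i) * 2 ^ i := by
  have key : ∀ f : ℕ → ℕ, ((∑ k ∈ Finset.range L, Function.update f i v k * 2 ^ k : ℕ) : ℤ) =
      (∑ k ∈ Finset.range L, f k * 2 ^ k : ℕ) + ((v : ℤ) - f i) * 2 ^ i := by
    intro f
    have hi' := Finset.mem_range.2 hi
    rw [← Finset.add_sum_erase _ _ hi', ← Finset.add_sum_erase _ (fun k => f k * 2 ^ k) hi',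
      Finset.sum_congr rfl fun k hk => by
        rw [Function.update_of_ne (Finset.ne_of_mem_erase hk)]]
    push_cast
    rw [Function.update_self]
    ring
  simpa [State.binary] using key (s.mem g)

theorem binary_lt {s : State} {g : ℕ} (L : ℕ) (hb : ∀ i < L, s.mem g i ≤ 1) :
    s.binary g L < 2 ^ L := by
  unfold State.binary
  induction L with
  | zero => simp
  | succ L ih =>
    rw [Finset.sum_range_succ, pow_succ]
    have := Nat.mul_le_mul_right (2 ^ L) (hb L (by omega))
    have := ih fun i hi => hb i (by omega)
    omega

/-- The equation holds over `ℤ`; the correction term on the left is the carry that leaves the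
number, so that the accumulators are exact modulo `2 ^ L`. -/
theorem run_ripple {L p v : ℕ} (g : ℕ) (hW : L + 1 ≤ W) (hS : L ≤ S) {s : State}
    (hb : ∀ i < L, s.mem g i ≤ 1) (h48 : s.reg 48 = L) (h16 : s.reg 16 = p) (hp : p ≤ L)
    (h17 : s.reg 17 = v) (hv : v ≤ 1) :
    Run W S (ripple g) (7 * L + 2) s fun s' => Same [16, 46, 47] [g] s s' ∧
      ((∀ i < L, s'.mem g i ≤ 1) ∧ ∀ i, L ≤ i → s'.mem g i = s.mem g i) ∧
      ((s'.binary g L : ℤ) + (if s'.reg 16 = L then (2 * (v : ℤ) - 1) * 2 ^ L else 0) =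
        s.binary g L + (2 * (v : ℤ) - 1) * 2 ^ p) := by
  refine Run.for L (fun i s' => Same [16, 46, 47] [g] s s' ∧
      ((∀ i < L, s'.mem g i ≤ 1) ∧ ∀ i, L ≤ i → s'.mem g i = s.mem g i) ∧ s'.reg 16 ≤ L ∧
      ((s'.binary g L : ℤ) + (if i ≤ s'.reg 16 then (2 * (v : ℤ) - 1) * 2 ^ s'.reg 16 else 0) =
        s.binary g L + (2 * (v : ℤ) - 1) * 2 ^ p)) (T := 5) (by omega) (by omega)
    ⟨.refl, ⟨hb, fun _ _ => rfl⟩, by omega, by simp [h16]⟩ ?_ ?_ ?_ ?_ (by omega)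
  · rintro i s' w ⟨h, h', h'', h'''⟩
    exact ⟨h.setReg, h', by simpa using h'', by simpa [State.binary] using h'''⟩
  · rintro i s' - ⟨h, -⟩ -
    simp [h.r 48, h48]
  · rintro i s' hi ⟨h, hb', hL, hsum⟩ hx
    have hbi := hb'.1 i hi
    refine Run.ite (.equal (by omega) (by simp) (by simp)) ?_ ?_ (by omega)
    · intro hv'
      simp only [val_equal, val_reg, hx, ne_eq, ite_eq_right_iff, one_ne_zero, imp_false,
        not_not] at hv'
      refine Run.assign_seq (by simp [hx]; omega) ?_ (by omega)
      refine Run.store_seq (by simp) (by simp [hx]; omega) (by simp [hx]; omega) ?_ (by omega)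
      simp only [val_load, val_reg, val_sub, val_lit, setReg_reg, hx, if_true,
        Nat.reduceEqDiff, if_false]
      have hbin := binary_setMem (s'.setReg 47 (s'.mem g i)) g i (1 - s'.mem g i) L hi
      rw [show (s'.setReg 47 (s'.mem g i)).binary g L = s'.binary g L from rfl, setReg_mem] at hbin
      have hs : Same [16, 46, 47] [g] s ((s'.setReg 47 (s'.mem g i)).setMem g i (1 - s'.mem g i)) :=
        (h.setReg).setMem (by simp)
      have hbits : (∀ k < L,
          ((s'.setReg 47 (s'.mem g i)).setMem g i (1 - s'.mem g i)).mem g k ≤ 1) ∧ ∀ k, L ≤ k →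
          ((s'.setReg 47 (s'.mem g i)).setMem g i (1 - s'.mem g i)).mem g k = s.mem g k := by
        simp only [setMem_mem, if_true, Function.update_apply]
        refine ⟨fun k hk => ?_, fun k hk => ?_⟩
        · split_ifs
          · omega
          · exact hb'.1 k hk
        · rw [if_neg (by omega)]
          exact hb'.2 k hk
      rw [if_pos hv'.le, ← hv'] at hsum
      refine Run.ite (.equal (by omega) (by simp) (by simp)) ?_ ?_ (by omega)
      · intro hc
        have hc' : s'.mem g i = v := by
          by_contra hne
          simp [h.r 17, h17, hne] at hc
        refine Run.assign (by simp [← hv']; omega) ⟨by simp [hx], hs.setReg, hbits,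
          by simp [← hv']; omega, ?_⟩ (by omega)
        rw [show ∀ s : State, ∀ x v, (s.setReg x v).binary g L = s.binary g L from
          fun _ _ _ => rfl, hbin, ← hsum, hc']
        simp only [setReg_reg, val_add, val_reg, val_lit, setMem_reg, Nat.reduceEqDiff, if_false,
          if_true, ← hv', le_refl, pow_succ]
        have : v = 0 ∨ v = 1 := by omega
        rcases this with rfl | rfl <;> push_cast <;> ring
      · intro hc
        have hc' : s'.mem g i ≠ v := by
          intro hne
          simp [h.r 17, h17, hne] at hc
        refine Run.skip ⟨by simp [hx], hs, hbits, by simpa using hL, ?_⟩ (by omega)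
        rw [hbin, ← hsum]
        simp only [setReg_reg, setMem_reg, Nat.reduceEqDiff, if_false, ← hv']
        rw [if_neg (by omega)]
        have : v = 0 ∨ v = 1 := by omega
        rcases this with rfl | rfl
        · rw [show s'.mem g i = 1 by omega]; push_cast; ring
        · rw [show s'.mem g i = 0 by omega]; push_cast; ring
    · intro hv'
      have hne : i ≠ s'.reg 16 := by
        intro hne
        simp [hx, hne] at hv'
      refine Run.skip ⟨hx, h, hb', hL, ?_⟩ (by omega)
      rw [← hsum]
      have : i + 1 ≤ s'.reg 16 ↔ i ≤ s'.reg 16 := by omega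
      simp only [this]
  · rintro s' ⟨h, hb', hL, hsum⟩
    refine ⟨h, hb', ?_⟩
    rw [← hsum]
    have : L ≤ s'.reg 16 ↔ s'.reg 16 = L := by omega
    simp only [this]
    split_ifs with h
    · rw [h]
    · rfl

theorem eq_zero_of_lt_two_mul {M k D : ℤ} (h : D = 2 * M * k) (h1 : -(2 * M) < D)
    (h2 : D < 2 * M) : k = 0 := by
  have hM : 0 < M := by linarith
  have h3 : k < 1 := by by_contra h; nlinarith
  have h4 : -1 < k := by by_contra h; nlinarith
  omega

/-- Replace the two's complement number with `reg 14` digits in segment `g` by its absolute value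
in segment `h` and its sign in register `x`. -/
def absolute (g h x : ℕ) : Prog :=
  .seq (.assign x (load g (.reg 14 - lit 1))) <|
  .seq (forLoop 46 (.reg 14) (.store h (.reg 46) ((load g (.reg 46) + .reg x) % lit 2))) <|
  .ite (.reg x)
    (.seq (.assign 16 (lit 0)) <| .seq (.assign 17 (lit 1)) <| .seq (.assign 48 (.reg 14)) <|
      ripple h)
    .skip

/-- A number `a` with `|a| < 2 ^ (L - 1)` is recovered from its residue modulo `2 ^ L`: the top
digit is its sign, and the absolute value is the number itself, or one plus its complement. -/
theorem run_absolute {L : ℕ} (g h x : ℕ) (hgh : g ≠ h) (hx : 49 ≤ x) (hW : L + 2 ≤ W) (hS : L ≤ S)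
    (hL : 1 ≤ L) {s : State} (hb : Bits s g) (h14 : s.reg 14 = L) {a : ℤ}
    (ha : |a| < 2 ^ (L - 1)) (hmod : (s.binary g L : ℤ) ≡ a [ZMOD 2 ^ L]) :
    Run W S (absolute g h x) (10 * L + 9) s fun s' => Same [16, 17, 46, 47, 48, x] [h] s s' ∧
      (∀ i < L, s'.mem h i ≤ 1) ∧ a = (-1) ^ s'.reg x * s'.binary h L := by
  have hx46 : x ≠ 46 := by omega
  have hx46' : 46 ≠ x := by omega
  have hx14 : 14 ≠ x := by omega
  have hx16 : x ≠ 16 := by omega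
  have hx17 : x ≠ 17 := by omega
  have hx48 : x ≠ 48 := by omega
  have htop := hb (L - 1)
  generalize ht : s.mem g (L - 1) = t at htop
  have hbin : s.binary g L = s.binary g (L - 1) + t * 2 ^ (L - 1) := by
    obtain ⟨l, rfl⟩ : ∃ l, L = l + 1 := ⟨L - 1, by omega⟩
    rw [State.binary, Finset.sum_range_succ, Nat.add_sub_cancel] at *
    rw [ht]; rfl
  have hlow := binary_lt (L - 1) fun i _ => hb i
  have hpow : 2 ^ L = 2 * 2 ^ (L - 1) := by
    rw [← pow_succ']; congr 1; omega
  have hpowZ : (2 : ℤ) ^ L = 2 * 2 ^ (L - 1) := by exact_mod_cast hpow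
  obtain ⟨ha1, ha2⟩ := abs_lt.1 ha
  obtain ⟨k, hk⟩ := hmod.dvd
  have hbZ : (s.binary g L : ℤ) = s.binary g (L - 1) + t * 2 ^ (L - 1) := by
    rw [hbin]; push_cast; ring
  have hlowZ : (s.binary g (L - 1) : ℤ) < 2 ^ (L - 1) := by exact_mod_cast hlow
  have hlow0 : (0 : ℤ) ≤ s.binary g (L - 1) := by positivity
  refine Run.assign_seq (by simp [h14]; omega) ?_ (by omega)
  simp only [val_load, val_sub, val_reg, val_lit, h14, ht]
  refine Run.seq (T₁ := 3 * L + 2) (T₂ := 7 * L + 6) (R := fun s' =>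
    Same [16, 17, 46, 47, 48, x] [h] s s' ∧ s'.reg x = t ∧
      ∀ k, s'.mem h k = if k < L then (s.mem g k + t) % 2 else s.mem h k) ?_ ?_ (by omega)
  · refine Run.for L (fun i s' => Same [16, 17, 46, 47, 48, x] [h] s s' ∧ s'.reg x = t ∧
      ∀ k, s'.mem h k = if k < i then (s.mem g k + t) % 2 else s.mem h k) (T := 1) (by omega)
      (by omega) ⟨.refl_setReg (by simp), by simp, by simp⟩ ?_ ?_ ?_ (fun _ h => h) (by omega)
    · rintro i s' v ⟨h1, h2, h3⟩
      exact ⟨h1.setReg (by simp), by simp [hx46, h2], h3⟩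
    · rintro i s' - ⟨h1, -⟩ -
      simp [h1.r 14 (by simp [hx14]), h14]
    · rintro i s' hi ⟨h1, h2, h3⟩ hxi
      have e1 := h1.m g (by simp [hgh])
      have b1 := hb i
      refine Run.store (by simp) (by simp [hxi, h2, e1]; omega) (by simp [hxi]; omega)
        ⟨by simp [hxi], h1.setMem (by simp), by simp [h2], fun k => ?_⟩ le_rfl
      simp only [setMem_mem, if_true, Function.update_apply, val_reg, hxi, val_mod, val_add,
        val_load, val_lit, h2, e1, h3]
      by_cases hki : k = i
      · simp [hki]
      · have : k < i + 1 ↔ k < i := by omega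
        simp [hki, this]
  rintro s₁ ⟨h1, h2, h3⟩
  refine Run.ite (by simp) ?_ ?_ (by omega)
  · intro ht'
    simp only [val_reg, h2] at ht'
    have ht1 : t = 1 := by omega
    subst ht1
    refine Run.assign_seq (by simp) ?_ (by omega)
    refine Run.assign_seq (by simp; omega) ?_ (by omega)
    refine Run.assign_seq (by simp) ?_ (by omega)
    have e14 := h1.r 14 (by simp [hx14])
    -- all digits are complemented, so that the number becomes `2 ^ L - 1` minus its former value
    have hcompl : s₁.binary h L + s.binary g L + 1 = 2 ^ L := by
      have : ∀ l ≤ L, s₁.binary h l + s.binary g l + 1 = 2 ^ l := by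
        intro l
        unfold State.binary
        induction l with
        | zero => simp
        | succ l ih =>
          intro hl
          have := ih (by omega)
          rw [Finset.sum_range_succ, Finset.sum_range_succ, pow_succ, h3, if_pos (by omega)]
          have := hb l
          have : s.mem g l = 0 ∨ s.mem g l = 1 := by omega
          rcases this with h | h <;> simp [h] <;> omega
      exact this L le_rfl
    refine Run.mono (run_ripple (L := L) (p := 0) (v := 1) h (by omega) (by omega) ?_ ?_ ?_
      (by omega)
      ?_ (by omega)) (by omega) ?_
    · intro k hk
      rw [setReg_mem, setReg_mem, setReg_mem, h3, if_pos hk]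
      omega
    · simp [e14, h14]
    · simp
    · simp
    · rintro s₂ ⟨h4, h5, h6⟩
      refine ⟨(((h1.setReg (by simp)).setReg (by simp)).setReg (by simp)).trans h4 (by simp)
        (by simp), h5.1, ?_⟩
      rw [h4.r x (by simp [hx46, hx16]; omega)]
      simp only [setReg_reg, hx48, hx17, hx16, if_false, h2]
      have hreg : ∀ s : State, ∀ x v, (s.setReg x v).binary h L = s.binary h L := fun _ _ _ => rfl
      rw [hreg, hreg, hreg] at h6
      have hcZ : (s₁.binary h L : ℤ) + s.binary g L + 1 = 2 ^ L := by exact_mod_cast hcompl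
      have h0 : (0 : ℤ) ≤ s₂.binary h L := by positivity
      push_cast at hbZ h6
      have hk' : k = -1 := by
        have := eq_zero_of_lt_two_mul (M := 2 ^ (L - 1)) (k := k + 1)
          (D := a - s.binary g L + 2 * 2 ^ (L - 1)) (by rw [hk, hpowZ]; ring) (by linarith)
          (by linarith)
        omega
      rw [pow_one]
      rw [hk'] at hk
      split_ifs at h6 <;> linarith
  · intro ht'
    simp only [val_reg, h2] at ht'
    subst ht'
    have hsame : s₁.binary h L = s.binary g L := by
      unfold State.binary
      refine Finset.sum_congr rfl fun i hi => ?_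
      have := hb i
      rw [h3, if_pos (Finset.mem_range.1 hi), Nat.mod_eq_of_lt (by omega), add_zero]
    refine Run.skip ⟨h1, fun i hi => ?_, ?_⟩ (by omega)
    · rw [h3, if_pos hi]
      omega
    · rw [h2, hsame, pow_zero, one_mul]
      push_cast at hbZ
      have hk' := eq_zero_of_lt_two_mul (M := 2 ^ (L - 1)) (k := k)
        (D := a - s.binary g L) (by rw [hk, hpowZ])
        (by linarith) (by linarith)
      rw [hk'] at hk
      linarith

end WordRAM

/-! ### The contribution of one cocycle -/

namespace WordRAM

open WordRAM.Expr

variable {W S N : ℕ}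

/-- Whether the colouring is nonzero on tetrahedron `t`. -/
def tauOf (al : ℕ → ℕ) (t : ℕ) : ℕ :=
  if al (16 * t + 1) + al (16 * t + 2) + al (16 * t + 3) + al (16 * t + 6) + al (16 * t + 7) +
    al (16 * t + 11) = 0 then 0 else 1

/-- Whether the colouring is nonzero on face `p % 4` of tetrahedron `p / 4`, and this face precedes
the one to which it is glued.  The second condition selects one face of each pair. -/
def phiOf (G₀ G₁ al : ℕ → ℕ) (p : ℕ) : ℕ :=
  if al (p / 4 * 16 + 4 * ((p + 1) % 4) + (p + 2) % 4) +
      al (p / 4 * 16 + 4 * ((p + 2) % 4) + (p + 3) % 4) +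
      al (p / 4 * 16 + 4 * ((p + 3) % 4) + (p + 1) % 4) ≠ 0 ∧
    p < 4 * G₀ p + G₁ (p / 4 * 16 + 4 * (p % 4) + p % 4) then 1 else 0

/-- Tabulate and count the tetrahedra (segment `9`, register `12`) and triangles (segment `10`,
register `11`) at which the colouring is nonzero. -/
def tally : Prog :=
  .seq (.assign 11 (lit 0)) <|
  .seq (.assign 12 (lit 0)) <|
  .seq (forLoop 49 (.reg 0) <|
    .seq (.assign 39 (lit 16 * .reg 49)) <|
    .ite (load 4 (.reg 39 + lit 1) + load 4 (.reg 39 + lit 2) + load 4 (.reg 39 + lit 3) +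
        load 4 (.reg 39 + lit 6) + load 4 (.reg 39 + lit 7) + load 4 (.reg 39 + lit 11))
      (.seq (.store 9 (.reg 49) (lit 1)) (.assign 12 (.reg 12 + lit 1)))
      (.store 9 (.reg 49) (lit 0))) <|
  forLoop 49 (lit 4 * .reg 0) <|
    .seq (.assign 39 (.reg 49 / lit 4 * lit 16)) <|
    .seq (.assign 40 ((.reg 49 + lit 1) % lit 4)) <|
    .seq (.assign 41 ((.reg 49 + lit 2) % lit 4)) <|
    .seq (.assign 42 ((.reg 49 + lit 3) % lit 4)) <|
    .ite ((load 4 (.reg 39 + lit 4 * .reg 40 + .reg 41) +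
          load 4 (.reg 39 + lit 4 * .reg 41 + .reg 42) +
          load 4 (.reg 39 + lit 4 * .reg 42 + .reg 40)) *
        less (.reg 49) (lit 4 * load 0 (.reg 49) +
          load 1 (.reg 39 + lit 4 * (.reg 49 % lit 4) + .reg 49 % lit 4)))
      (.seq (.store 10 (.reg 49) (lit 1)) (.assign 11 (.reg 11 + lit 1)))
      (.store 10 (.reg 49) (lit 0))

theorem run_tally {n : ℕ} (hB : Big W S N) (hn : N = 16 * n) {G₀ G₁ al : ℕ → ℕ}
    (hG : Tables N G₀ G₁) (hal : ∀ k, al k ≤ 1) {s : State} (h0 : s.reg 0 = n)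
    (m0 : s.mem 0 = G₀) (m1 : s.mem 1 = G₁) (m4 : s.mem 4 = al) (hb9 : Bits s 9)
    (hb10 : Bits s 10) :
    Run W S tally (3 * N) s fun s' => Same [11, 12, 39, 40, 41, 42, 49] [9, 10] s s' ∧
      Bits s' 9 ∧ Bits s' 10 ∧ (∀ t < n, s'.mem 9 t = tauOf al t) ∧
      (∀ p < 4 * n, s'.mem 10 p = phiOf G₀ G₁ al p) ∧
      s'.reg 12 = ∑ t ∈ Finset.range n, tauOf al t ∧ s'.reg 12 ≤ n ∧
      s'.reg 11 = ∑ p ∈ Finset.range (4 * n), phiOf G₀ G₁ al p ∧ s'.reg 11 ≤ 4 * n := by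
  have hlin := hB.lin
  have hN := hB.hN
  have hWB := hB.hW
  have hSB := hB.hS
  refine Run.assign_seq (by simp) ?_ (by omega)
  refine Run.assign_seq (by simp) ?_ (by omega)
  refine Run.seq (T₁ := 6 * n + 2) (T₂ := 36 * n + 2) (R := fun s' =>
    Same [11, 12, 39, 40, 41, 42, 49] [9, 10] s s' ∧ Bits s' 9 ∧ Bits s' 10 ∧ s'.reg 11 = 0 ∧
    (∀ t < n, s'.mem 9 t = tauOf al t) ∧ s'.reg 12 = ∑ t ∈ Finset.range n, tauOf al t ∧
    s'.reg 12 ≤ n) ?_ ?_ (by omega)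
  · refine Run.for n (fun k s' =>
      Same [11, 12, 39, 40, 41, 42, 49] [9, 10] s s' ∧ Bits s' 9 ∧ Bits s' 10 ∧ s'.reg 11 = 0 ∧
      (∀ t < k, s'.mem 9 t = tauOf al t) ∧ s'.reg 12 = ∑ t ∈ Finset.range k, tauOf al t ∧
      s'.reg 12 ≤ k) (T := 4) (by omega) (by omega)
      ⟨Same.setReg Same.refl_setReg, hb9, hb10, by simp, by simp, by simp, by simp⟩ ?_ ?_ ?_
      (fun _ h => h) (by omega)
    · rintro k s' v ⟨h, h1, h2, h3, h4, h5, h6⟩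
      exact ⟨h.setReg, h1, h2, by simpa using h3, h4, by simpa using h5, by simpa using h6⟩
    · rintro k s' - ⟨h, -⟩ -
      simp [h.r 0, h0]
    · rintro k s' hk ⟨h, h1, h2, h3, h4, h5, h6⟩ hx
      refine Run.assign_seq (by simp [hx]; omega) ?_ (by omega)
      simp only [val_mul, val_lit, val_reg, hx]
      have b1 := hal (16 * k + 1)
      have b2 := hal (16 * k + 2)
      have b3 := hal (16 * k + 3)
      have b4 := hal (16 * k + 6)
      have b5 := hal (16 * k + 7)
      have b6 := hal (16 * k + 11)
      have e4 : (s'.setReg 39 (16 * k)).mem 4 = al := (h.m 4).trans m4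
      refine Run.ite ?_ ?_ ?_ (by omega)
      · simp only [safe_add, safe_load, safe_reg, safe_lit, val_add, val_load, val_reg, val_lit,
          setReg_reg, if_true, e4, true_and]
        omega
      · intro hv
        simp only [val_add, val_load, val_reg, val_lit, setReg_reg, if_true, e4] at hv
        have ht : tauOf al k = 1 := if_neg hv
        refine Run.store_seq (by simp) (by simp; omega) (by simp [hx]; omega) ?_ (by omega)
        refine Run.assign (by simp; omega) ⟨by simp [hx], h.setReg.setMem.setReg, ?_, h2, by simpa,
          ?_, ?_, by simpa using h6⟩ (by omega)
        · intro j
          simp only [setReg_mem, setMem_mem, if_true, Function.update_apply, val_lit]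
          split_ifs
          · omega
          · exact h1 j
        · intro t ht'
          simp only [setReg_mem, setMem_mem, if_true, Function.update_apply, val_lit, val_reg,
            setReg_reg, Nat.reduceEqDiff, if_false, hx]
          split_ifs with htk
          · rw [htk, ht]
          · exact h4 t (by omega)
        · rw [Finset.sum_range_succ, ht, ← h5]
          simp
      · intro hv
        simp only [val_add, val_load, val_reg, val_lit, setReg_reg, if_true, e4] at hv
        have ht : tauOf al k = 0 := if_pos hv
        refine Run.store (by simp) (by simp) (by simp [hx]; omega) ⟨by simp [hx], h.setReg.setMem,
          ?_, h2, by simpa, ?_, ?_, by simp; omega⟩ (by omega)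
        · intro j
          simp only [setReg_mem, setMem_mem, if_true, Function.update_apply, val_lit]
          split_ifs
          · omega
          · exact h1 j
        · intro t ht'
          simp only [setReg_mem, setMem_mem, if_true, Function.update_apply, val_lit, val_reg,
            setReg_reg, Nat.reduceEqDiff, if_false, hx]
          split_ifs with htk
          · rw [htk, ht]
          · exact h4 t (by omega)
        · rw [Finset.sum_range_succ, ht, ← h5]
          simp
  rintro s₁ ⟨g, g1, g2, g3, g4, g5, g6⟩
  refine Run.for (4 * n) (fun k s' =>
    (Same [11, 12, 39, 40, 41, 42, 49] [9, 10] s s' ∧ Bits s' 10 ∧ s'.mem 9 = s₁.mem 9 ∧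
      s'.reg 12 = s₁.reg 12) ∧ (∀ p < k, s'.mem 10 p = phiOf G₀ G₁ al p) ∧
      s'.reg 11 = ∑ p ∈ Finset.range k, phiOf G₀ G₁ al p ∧
      s'.reg 11 ≤ k) (T := 7) (by omega) (by omega)
    ⟨⟨g, g2, rfl, rfl⟩, by simp, by simp [g3], by simp [g3]⟩ ?_ ?_ ?_ ?_ (by omega)
  · rintro k s' v ⟨⟨h, h1, h2, h3⟩, h4, h5, h6⟩
    exact ⟨⟨h.setReg, h1, h2, by simpa using h3⟩, h4, by simpa using h5, by simpa using h6⟩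
  · rintro k s' - ⟨⟨h, -⟩, -⟩ -
    simp [h.r 0, h0]
    omega
  · rintro k s' hk ⟨⟨h, h1, h2, h3⟩, h4, h5, h6⟩ hx
    refine Run.assign_seq (by simp [hx]; omega) ?_ (by omega)
    refine Run.assign_seq (by simp [hx]; omega) ?_ (by omega)
    refine Run.assign_seq (by simp [hx]; omega) ?_ (by omega)
    refine Run.assign_seq (by simp [hx]; omega) ?_ (by omega)
    simp only [val_mul, val_div, val_mod, val_add, val_lit, val_reg, setReg_reg, hx,
      Nat.reduceEqDiff, if_false]
    generalize hs₂ : (((s'.setReg 39 (k / 4 * 16)).setReg 40 ((k + 1) % 4)).setReg 41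
      ((k + 2) % 4)).setReg 42 ((k + 3) % 4) = s₂
    have hg : Same [11, 12, 39, 40, 41, 42, 49] [9, 10] s s₂ := by
      rw [← hs₂]; exact Same.setReg (Same.setReg (Same.setReg h.setReg))
    have r39 : s₂.reg 39 = k / 4 * 16 := by simp [← hs₂]
    have r40 : s₂.reg 40 = (k + 1) % 4 := by simp [← hs₂]
    have r41 : s₂.reg 41 = (k + 2) % 4 := by simp [← hs₂]
    have r42 : s₂.reg 42 = (k + 3) % 4 := by simp [← hs₂]
    have r49 : s₂.reg 49 = k := by simp [← hs₂, hx]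
    have r11 : s₂.reg 11 = s'.reg 11 := by simp [← hs₂]
    have r12 : s₂.reg 12 = s'.reg 12 := by simp [← hs₂]
    have m : s₂.mem = s'.mem := by simp [← hs₂]
    clear hs₂
    have e4 : s₂.mem 4 = al := (hg.m 4).trans m4
    have e0 : s₂.mem 0 = G₀ := (hg.m 0).trans m0
    have e1 : s₂.mem 1 = G₁ := (hg.m 1).trans m1
    have b1 := hal (k / 4 * 16 + 4 * ((k + 1) % 4) + (k + 2) % 4)
    have b2 := hal (k / 4 * 16 + 4 * ((k + 2) % 4) + (k + 3) % 4)
    have b3 := hal (k / 4 * 16 + 4 * ((k + 3) % 4) + (k + 1) % 4)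
    have b4 := hG.adj_lt k (by omega)
    have b5 := hG.glue_lt (k / 4 * 16 + 4 * (k % 4) + k % 4)
    refine Run.ite ?_ ?_ ?_ (by omega)
    · refine ⟨?_, .less (by omega) (by simp) ?_, ?_⟩
      · simp only [safe_add, safe_mul, safe_load, safe_reg, safe_lit, val_add, val_mul, val_load,
          val_reg, val_lit, r39, r40, r41, r42, e4, true_and]
        omega
      · simp only [safe_add, safe_mul, safe_mod, safe_load, safe_reg, safe_lit, val_add, val_mul,
          val_mod, val_load, val_reg, val_lit, r39, r49, e0, e1, true_and]
        omega
      · change _ * (if _ then 1 else 0) ≤ W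
        refine (Nat.mul_le_mul_left _ (ite_le_one (le_refl 1) (Nat.zero_le 1))).trans ?_
        simp only [val_add, val_mul, val_load, val_reg, val_lit, r39, r40, r41, r42, e4]
        omega
    · intro hv
      simp only [val_add, val_mul, val_mod, val_load, val_less, val_reg, val_lit, r39, r40, r41,
        r42, r49, e4, e0, e1] at hv
      have ht : phiOf G₀ G₁ al k = 1 := by
        refine if_pos ⟨left_ne_zero_of_mul hv, ?_⟩
        by_contra hlt
        exact right_ne_zero_of_mul hv (if_neg hlt)
      refine Run.store_seq (by simp) (by simp; omega) (by simp [r49]; omega) ?_ (by omega)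
      refine Run.assign (by simp [r11]; omega) ⟨by simp [r49], ⟨hg.setMem.setReg, ?_, ?_, ?_⟩,
        ?_, ?_, by simpa [r11] using h6⟩ (by omega)
      · intro j
        simp only [setReg_mem, setMem_mem, if_true, Function.update_apply, val_lit, m]
        split_ifs
        · omega
        · exact h1 j
      · simp [m, h2]
      · simp [r12, h3]
      · intro t ht'
        simp only [setReg_mem, setMem_mem, if_true, Function.update_apply, val_lit, val_reg, r49, m]
        split_ifs with htk
        · rw [htk, ht]
        · exact h4 t (by omega)
      · rw [Finset.sum_range_succ, ht, ← h5]
        simp [r11]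
    · intro hv
      simp only [val_add, val_mul, val_mod, val_load, val_less, val_reg, val_lit, r39, r40, r41,
        r42, r49, e4, e0, e1] at hv
      have ht : phiOf G₀ G₁ al k = 0 := by
        refine if_neg ?_
        rintro ⟨hne, hlt⟩
        rw [if_pos hlt, mul_one] at hv
        exact hne hv
      refine Run.store (by simp) (by simp) (by simp [r49]; omega) ⟨by simp [r49],
        ⟨hg.setMem, ?_, ?_, ?_⟩, ?_, ?_, by simp [r11]; omega⟩ (by omega)
      · intro j
        simp only [setMem_mem, if_true, Function.update_apply, val_lit, m]
        split_ifs
        · omega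
        · exact h1 j
      · simp [m, h2]
      · simp [r12, h3]
      · intro t ht'
        simp only [setMem_mem, if_true, Function.update_apply, val_lit, val_reg, r49, m]
        split_ifs with htk
        · rw [htk, ht]
        · exact h4 t (by omega)
      · rw [Finset.sum_range_succ, ht, ← h5]
        simp [r11]
  · rintro s' ⟨⟨h, h1, h2, h3⟩, h4, h5, h6⟩
    exact ⟨h, fun k => by rw [h2]; exact g1 k, h1, fun t ht => by rw [h2]; exact g4 t ht, h4,
      by rw [h3]; exact g5, by rw [h3]; exact g6, h5, h6⟩

theorem solution_zero (G₀ G₁ al : ℕ → ℕ) (κ : ℕ) : Solution N G₀ G₁ al κ 0 := by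
  have h : ∀ c, coord (0 : Fin N → ZMod 2) c = 0 := by
    intro c; unfold coord; split_ifs <;> rfl
  intro p _
  simp [Equations, h]

open Classical in
/-- The numbers of solutions are powers of two; this is the exponent. -/
noncomputable def solutionDim (N : ℕ) (G₀ G₁ al : ℕ → ℕ) (κ : ℕ) : ℕ :=
  Nat.log 2 (Finset.univ.filter (Solution N G₀ G₁ al κ)).card

theorem famSum_one {V : Type*} [AddCommGroup V] (d : ℕ) (R : ℕ → V) :
    famSum d R (fun _ => 1) = 2 ^ d := by
  simp [famSum]

open Classical in
theorem solve_dim {G₀ G₁ al : ℕ → ℕ} {κ : ℕ} {s : State}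
    (h : ∀ F, famVal N s F = ∑ x, if Solution N G₀ G₁ al κ x then F x else 0) :
    s.reg 4 = 0 ∧ s.reg 3 = solutionDim N G₀ G₁ al κ ∧
      (Finset.univ.filter (Solution N G₀ G₁ al κ)).card = 2 ^ solutionDim N G₀ G₁ al κ := by
  have h1 := h fun _ => 1
  rw [← Finset.sum_filter, Finset.sum_const, nsmul_eq_mul, mul_one, famVal, famSum_one] at h1
  have hpos : (Finset.univ.filter (Solution N G₀ G₁ al κ)).card ≠ 0 := by
    rw [Finset.card_ne_zero]
    exact ⟨0, by simp [solution_zero]⟩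
  split_ifs at h1 with h4
  · have h2 : 2 ^ s.reg 3 = (Finset.univ.filter (Solution N G₀ G₁ al κ)).card := by
      exact_mod_cast h1
    have h3 : s.reg 3 = solutionDim N G₀ G₁ al κ := by
      rw [solutionDim, ← h2, Nat.log_pow (by omega)]
    exact ⟨h4, h3, by rw [← h2, h3]⟩
  · exact absurd (by exact_mod_cast h1.symm) hpos

open Classical in
/-- The sum of the weights of all admissible colourings in which the edges of colour `1` are those
given by the cocycle `al`. The number `-[2] = ∓√2` occurs once for each edge, triangle and
tetrahedron at which the cocycle is nonzero, each such triangle contributes a further `1 / 2`, and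
the vertex contributes `1 / 4`. What remains is a sign, which is a quadratic function of the edges
of colour `2`. -/
noncomputable def cocycleWeight (n : ℕ) (G₀ G₁ al : ℕ → ℕ) (q : ℕ) : ℂ :=
  1 / 4 * (if q = 1 then -(Real.sqrt 2 : ℂ) else (Real.sqrt 2 : ℂ)) ^
      (solutionDim (16 * n) G₀ G₁ al 1 + ∑ p ∈ Finset.range (4 * n), phiOf G₀ G₁ al p +
        ∑ t ∈ Finset.range n, tauOf al t) /
    2 ^ (∑ p ∈ Finset.range (4 * n), phiOf G₀ G₁ al p) *
    ∑ x : Fin (16 * n) → ZMod 2, if Solution (16 * n) G₀ G₁ al 0 x then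
      sgn (quad n (tauOf al) (phiOf G₀ G₁ al) x) else 0

/-- Add the weight of the cocycle in segment `4` to the two's complement accumulators in the
segments `7` (for the multiples of `1`) and `8` (for the multiples of `√2`). -/
def addWeight : Prog :=
  .seq (.assign 5 (lit 1)) <|
  .seq solve <|
  .seq (.assign 13 (.reg 3)) <|
  .seq (.assign 5 (lit 0)) <|
  .seq solve <|
  .seq tally <|
  .seq gaussSum <|
  .ite (.reg 4) .skip <|
    .seq (.assign 13 (.reg 13 + .reg 11 + .reg 12)) <|
    .seq (.assign 16 (.reg 13 / lit 2 + .reg 10 + (lit 4 * .reg 0 - .reg 11))) <|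
    .seq (.assign 17 (lit 1 - (.reg 13 * equal (.reg 1) (lit 1) + .reg 38) % lit 2)) <|
    .seq (.assign 48 (lit 4 * .reg 2)) <|
    .ite (.reg 13 % lit 2) (ripple 8) (ripple 7)

theorem quad_congr {n : ℕ} {tau tau' phi phi' : ℕ → ℕ} (h : ∀ t < n, tau t = tau' t)
    (h' : ∀ p < 4 * n, phi p = phi' p) (x : Fin N → ZMod 2) :
    quad n tau phi x = quad n tau' phi' x := by
  unfold quad
  congr 1
  · exact Finset.sum_congr rfl fun t ht => by rw [h t (Finset.mem_range.1 ht)]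
  · exact Finset.sum_congr rfl fun t ht => by rw [h' t (Finset.mem_range.1 ht)]

theorem sqrt_two_pow (p : ℕ) :
    (Real.sqrt 2 : ℂ) ^ p = 2 ^ (p / 2) * if p % 2 = 0 then 1 else (Real.sqrt 2 : ℂ) := by
  have h2 : (Real.sqrt 2 : ℂ) ^ 2 = 2 := by
    rw [← Complex.ofReal_pow, Real.sq_sqrt (by norm_num)]; norm_num
  conv_lhs => rw [← Nat.div_add_mod p 2, pow_add, pow_mul, h2]
  congr 1
  rcases Nat.mod_two_eq_zero_or_one p with h | h <;> simp [h]

/-- The value of a single contribution in terms of its sign and binary exponent. The common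
denominator `2 ^ (4 n + 2)` makes the exponent of the numerator nonnegative, as there are at most
`4 n` triangles. -/
theorem weight_value (n p F e c q : ℕ) (hF : F ≤ 4 * n) :
    1 / 4 * (if q = 1 then -(Real.sqrt 2 : ℂ) else (Real.sqrt 2 : ℂ)) ^ p / 2 ^ F *
      (2 ^ e * (-1) ^ c) =
    (((2 * ((1 - (p * (if q = 1 then 1 else 0) + c) % 2 : ℕ) : ℤ) - 1) *
      2 ^ (p / 2 + e + (4 * n - F)) : ℤ) : ℂ) * (if p % 2 = 0 then 1 else (Real.sqrt 2 : ℂ)) /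
      2 ^ (4 * n + 2) := by
  have hsign : ((2 * ((1 - (p * (if q = 1 then 1 else 0) + c) % 2 : ℕ) : ℤ) - 1 : ℤ) : ℂ) =
      (if q = 1 then (-1) ^ p else 1) * (-1) ^ c := by
    have key : ∀ a : ℕ, ((2 * ((1 - a % 2 : ℕ) : ℤ) - 1 : ℤ) : ℂ) = (-1) ^ a := by
      intro a
      rw [neg_one_pow_eq_pow_mod_two]
      rcases Nat.mod_two_eq_zero_or_one a with h | h <;> norm_num [h]
    rw [key, pow_add]
    split_ifs <;> simp
  have hw : (if q = 1 then -(Real.sqrt 2 : ℂ) else (Real.sqrt 2 : ℂ)) ^ p =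
      (if q = 1 then (-1) ^ p else 1) * (Real.sqrt 2 : ℂ) ^ p := by
    split_ifs
    · rw [neg_pow]
    · simp
  rw [hw, sqrt_two_pow, Int.cast_mul, hsign]
  have hpow : (2 : ℂ) ^ (4 * n + 2) = 2 ^ F * 2 ^ (4 * n - F) * 4 := by
    rw [← pow_add, show F + (4 * n - F) = 4 * n by omega, pow_add]; norm_num
  rw [hpow]
  push_cast
  rw [pow_add, pow_add]
  field_simp

/-- The weight of one cocycle is added to the accumulators in cubic time. -/
theorem run_addWeight {n q : ℕ} (hB : Big W S N) (hn : N = 16 * n) {G₀ G₁ al : ℕ → ℕ}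
    (hG : Tables N G₀ G₁) (hal : ∀ k, al k ≤ 1) {s : State} (hg : Good N s) (h0 : s.reg 0 = n)
    (h1 : s.reg 1 = q)
    (m0 : s.mem 0 = G₀) (m1 : s.mem 1 = G₁) (m4 : s.mem 4 = al) (hb7 : Bits s 7) (hb8 : Bits s 8)
    (hb9 : Bits s 9) (hb10 : Bits s 10) :
    Run W S addWeight (252 * (N * (N * N))) s fun s' =>
      Same [3, 4, 5, 6, 7, 8, 10, 11, 12, 13, 16, 17, 20, 21, 22, 23, 24, 25, 26, 27, 28, 29, 30,
        31, 32, 33, 34, 35, 36, 37, 38, 39, 40, 41, 42, 43, 44, 45, 46, 47, 48, 49]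
        [2, 5, 7, 8, 9, 10] s s' ∧ Good N s' ∧ Bits s' 7 ∧ Bits s' 8 ∧ Bits s' 9 ∧ Bits s' 10 ∧
      ∃ a b : ℤ, |a| ≤ 2 ^ (2 * N) ∧ |b| ≤ 2 ^ (2 * N) ∧
        (s'.binary 7 (4 * N) : ℤ) ≡ s.binary 7 (4 * N) + a [ZMOD 2 ^ (4 * N)] ∧
        (s'.binary 8 (4 * N) : ℤ) ≡ s.binary 8 (4 * N) + b [ZMOD 2 ^ (4 * N)] ∧
        cocycleWeight n G₀ G₁ al q = (a + b * (Real.sqrt 2 : ℂ)) / 2 ^ (4 * n + 2) := by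
  classical
  have hlin := hB.lin
  have hN := hB.hN
  have hWB := hB.hW
  have hSB := hB.hS
  have hNN : 16 * (N * N) ≤ N * (N * N) := Nat.mul_le_mul_right _ hN
  refine Run.assign_seq (by simp; omega) ?_ (by omega)
  simp only [val_lit]
  refine Run.seq (T₂ := 252 * (N * (N * N)) - 1 - 118 * (N * (N * N)))
    (run_solve hB hG (κ := 1) (by omega) hal (s := s.setReg 5 1) ?_
    (by simp) m0 m1 m4) ?_ (by omega)
  · exact hg.congr (by simp) (by simp) rfl rfl
  rintro s₁ ⟨h₁, hg₁, hF₁⟩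
  obtain ⟨-, hdim, -⟩ := solve_dim hF₁
  have h₁' : Same [3, 4, 5, 6, 7, 8, 10, 11, 12, 13, 16, 17, 20, 21, 22, 23, 24, 25, 26, 27, 28, 29,
      30, 31, 32, 33, 34, 35, 36, 37, 38, 39, 40, 41, 42, 43, 44, 45, 46, 47, 48, 49]
        [2, 5, 7, 8, 9, 10] s s₁ := (Same.refl_setReg).trans h₁
  refine Run.assign_seq (by simp) ?_ (by omega)
  refine Run.assign_seq (by simp) ?_ (by omega)
  simp only [val_reg, val_lit, hdim]
  generalize hs₁' : (s₁.setReg 13 (solutionDim N G₀ G₁ al 1)).setReg 5 0 = s₁'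
  have h₁'' : Same [3, 4, 5, 6, 7, 8, 10, 11, 12, 13, 16, 17, 20, 21, 22, 23, 24, 25, 26, 27, 28,
      29, 30, 31, 32, 33, 34, 35, 36, 37, 38, 39, 40, 41, 42, 43, 44, 45, 46, 47, 48, 49]
        [2, 5, 7, 8, 9, 10] s s₁' := by
    rw [← hs₁']; exact Same.setReg h₁'.setReg
  have e13 : s₁'.reg 13 = solutionDim N G₀ G₁ al 1 := by simp [← hs₁']
  have e5 : s₁'.reg 5 = 0 := by simp [← hs₁']
  have hE : solutionDim N G₀ G₁ al 1 ≤ N := by rw [← hdim]; exact hg₁.r3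
  have hm₁ : s₁'.mem = s₁.mem := by rw [← hs₁']; rfl
  have hg₁' : Good N s₁' := by
    rw [← hs₁']
    exact hg₁.congr (by simp) (by simp) rfl rfl
  clear hs₁'
  have k7 : s₁'.mem 7 = s.mem 7 := by rw [hm₁]; exact h₁.m 7
  have k8 : s₁'.mem 8 = s.mem 8 := by rw [hm₁]; exact h₁.m 8
  have k9 : s₁'.mem 9 = s.mem 9 := by rw [hm₁]; exact h₁.m 9
  have k10 : s₁'.mem 10 = s.mem 10 := by rw [hm₁]; exact h₁.m 10
  refine Run.seq (T₂ := 252 * (N * (N * N)) - 3 - 236 * (N * (N * N)))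
    (run_solve hB hG (κ := 0) (by omega) hal hg₁' e5 ((h₁''.m 0).trans m0) ((h₁''.m 1).trans m1)
    ((h₁''.m 4).trans m4)) ?_ (by omega)
  rintro s₂ ⟨h₂, hg₂, hF₂⟩
  refine Run.seq (T₂ := 252 * (N * (N * N)) - 3 - 236 * (N * (N * N)) - 3 * N)
    (run_tally hB hn hG hal (s := s₂) ?_ ?_ ?_ ?_ ?_ ?_) ?_ (by omega)
  · rw [h₂.r 0, h₁''.r 0, h0]
  · rw [h₂.m 0, h₁''.m 0, m0]
  · rw [h₂.m 1, h₁''.m 1, m1]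
  · rw [h₂.m 4, h₁''.m 4, m4]
  · intro k; rw [h₂.m 9, k9]; exact hb9 k
  · intro k; rw [h₂.m 10, k10]; exact hb10 k
  rintro s₃ ⟨h₃, hb9', hb10', ht, hp, hT, hTn, hFF, hFn⟩
  have h₃' : Same [3, 4, 5, 6, 7, 8, 10, 11, 12, 13, 16, 17, 20, 21, 22, 23, 24, 25, 26, 27, 28, 29,
      30, 31, 32, 33, 34, 35, 36, 37, 38, 39, 40, 41, 42, 43, 44, 45, 46, 47, 48, 49]
        [2, 5, 7, 8, 9, 10] s s₃ := (h₁''.trans h₂).trans h₃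
  refine Run.seq (T₂ := 252 * (N * (N * N)) - 3 - 251 * (N * (N * N)) - 3 * N)
    (run_gaussSum hB hn hb9' hb10' (s := s₃) (hg₂.congr (h₃.r 2) (h₃.r 3) (h₃.m 2) (h₃.m 5))
    ((h₃'.r 0).trans h0) rfl rfl) ?_ (by omega)
  rintro s₄ ⟨h₄, hg₄, hs₄, hc₄, hF₄⟩
  have h₄' : Same [3, 4, 5, 6, 7, 8, 10, 11, 12, 13, 16, 17, 20, 21, 22, 23, 24, 25, 26, 27, 28, 29,
      30, 31, 32, 33, 34, 35, 36, 37, 38, 39, 40, 41, 42, 43, 44, 45, 46, 47, 48, 49]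
        [2, 5, 7, 8, 9, 10] s s₄ := h₃'.trans h₄
  have e13' : s₄.reg 13 = solutionDim N G₀ G₁ al 1 := by rw [h₄.r 13, h₃.r 13, h₂.r 13, e13]
  have e11 := h₄.r 11
  have e12 := h₄.r 12
  have k7' : s₄.mem 7 = s.mem 7 := by rw [h₄.m 7, h₃.m 7, h₂.m 7, k7]
  have k8' : s₄.mem 8 = s.mem 8 := by rw [h₄.m 8, h₃.m 8, h₂.m 8, k8]
  have b7' : Bits s₄ 7 := fun k => by rw [k7']; exact hb7 k
  have b8' : Bits s₄ 8 := fun k => by rw [k8']; exact hb8 k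
  have b9' : Bits s₄ 9 := fun k => by rw [h₄.m 9]; exact hb9' k
  have b10' : Bits s₄ 10 := fun k => by rw [h₄.m 10]; exact hb10' k
  -- the weight in terms of the results in the registers
  have hweight : cocycleWeight n G₀ G₁ al q =
      1 / 4 * (if q = 1 then -(Real.sqrt 2 : ℂ) else (Real.sqrt 2 : ℂ)) ^
        (solutionDim N G₀ G₁ al 1 + s₃.reg 11 + s₃.reg 12) / 2 ^ s₃.reg 11 *
        if s₄.reg 4 = 0 then 2 ^ s₄.reg 10 * (-1) ^ s₄.reg 38 else 0 := by
    rw [← hF₄, hT, hFF, cocycleWeight, famVal_congr (h₃.r 3) (h₃.r 4) (h₃.m 2), hF₂]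
    subst hn
    congr 1
    refine Finset.sum_congr rfl fun x _ => ?_
    rw [quad_congr ht hp]
  have hbin : ∀ g, s₄.mem g = s.mem g → s₄.binary g (4 * N) = s.binary g (4 * N) := by
    intro g hg; unfold State.binary; rw [hg]
  refine Run.ite (by simp) ?_ ?_ (by omega)
  · intro hz
    simp only [val_reg] at hz
    refine Run.skip ⟨h₄', hg₄, b7', b8', b9', b10', 0, 0, by simp, by simp, ?_, ?_, ?_⟩ (by omega)
    · rw [hbin 7 k7', add_zero]
    · rw [hbin 8 k8', add_zero]
    · rw [hweight, if_neg hz]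
      simp
  · intro hz
    simp only [val_reg] at hz
    rw [if_pos hz] at hweight
    generalize hP : solutionDim N G₀ G₁ al 1 + s₃.reg 11 + s₃.reg 12 = P at hweight
    have e1 := h₄'.r 1
    have e0 := h₄'.r 0
    have e2 := hg₄.r2
    refine Run.assign_seq (by simp [e13', e11, e12]; omega) ?_ (by omega)
    simp only [val_add, val_reg, e13', e11, e12, hP]
    refine Run.assign_seq (by simp [e0, e11, h0]; omega) ?_ (by omega)
    simp only [val_add, val_sub, val_mul, val_div, val_reg, val_lit, setReg_reg, e0, e11, h0,
      Nat.reduceEqDiff, if_true, if_false]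
    have hmul : (if q = 1 then P else 0) ≤ 2 * N := by split_ifs <;> omega
    refine Run.assign_seq ?_ ?_ (by omega)
    · refine ⟨by simp; omega, ⟨⟨⟨by simp, .equal (by omega) (by simp) (by simp; omega), ?_⟩,
        by simp, ?_⟩, by simp; omega, ?_⟩, ?_⟩
      · change _ * (if _ then 1 else 0) ≤ W
        simp [e1, h1]
        omega
      · change _ * (if _ then 1 else 0) + _ ≤ W
        simp [e1, h1]
        omega
      · change _ % 2 ≤ W
        omega
      · change 1 - _ ≤ W
        omega
    simp only [val_add, val_sub, val_mul, val_mod, val_equal, val_reg, val_lit, setReg_reg,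
      Nat.reduceEqDiff, if_true, if_false, e1, h1]
    refine Run.assign_seq (by simp [e2]; omega) ?_ (by omega)
    simp only [val_mul, val_reg, val_lit, setReg_reg, Nat.reduceEqDiff, if_false, e2]
    have hval := weight_value n P (s₃.reg 11) (s₄.reg 10) (s₄.reg 38) q hFn
    rw [← hweight] at hval
    generalize hv : 1 - (P * (if q = 1 then 1 else 0) + s₄.reg 38) % 2 = v at hval ⊢
    have hv1 : v ≤ 1 := by omega
    generalize hpos : P / 2 + s₄.reg 10 + (4 * n - s₃.reg 11) = pos at hval ⊢
    have hpos2 : pos ≤ 2 * N := by omega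
    clear hP
    generalize hs₅ : (((s₄.setReg 13 P).setReg 16 pos).setReg 17 v).setReg 48 (4 * N) = s₅
    have h₅ : Same [3, 4, 5, 6, 7, 8, 10, 11, 12, 13, 16, 17, 20, 21, 22, 23, 24, 25, 26, 27, 28,
        29, 30, 31, 32, 33, 34, 35, 36, 37, 38, 39, 40, 41, 42, 43, 44, 45, 46, 47, 48, 49]
        [2, 5, 7, 8, 9, 10] s s₅ := by
      rw [← hs₅]; exact Same.setReg (Same.setReg (Same.setReg h₄'.setReg))
    have hm₅ : s₅.mem = s₄.mem := by rw [← hs₅]; rfl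
    have hg₅ : Good N s₅ := by
      rw [← hs₅]; exact hg₄.congr (by simp) (by simp) rfl rfl
    have r16 : s₅.reg 16 = pos := by simp [← hs₅]
    have r17 : s₅.reg 17 = v := by simp [← hs₅]
    have r48 : s₅.reg 48 = 4 * N := by simp [← hs₅]
    have r13 : s₅.reg 13 = P := by simp [← hs₅]
    clear hs₅
    have hbin₅ : ∀ g, s₅.binary g (4 * N) = s₄.binary g (4 * N) := by
      intro g; unfold State.binary; rw [hm₅]
    have habs : |(2 * (v : ℤ) - 1) * 2 ^ pos| ≤ 2 ^ (2 * N) := by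
      have : |2 * (v : ℤ) - 1| = 1 := by
        have : v = 0 ∨ v = 1 := by omega
        rcases this with rfl | rfl <;> rfl
      rw [abs_mul, this, one_mul, abs_of_pos (by positivity)]
      exact pow_le_pow_right₀ (by norm_num) hpos2
    have hcong : ∀ X Y D : ℤ, ∀ c : Prop, [Decidable c] →
        (X + (if c then (2 * (v : ℤ) - 1) * 2 ^ (4 * N) else 0) = Y + D) →
        X ≡ Y + D [ZMOD 2 ^ (4 * N)] := by
      intro X Y D c _ h
      rw [← h]
      split_ifs
      · exact (Int.modEq_iff_dvd.2 ⟨2 * (v : ℤ) - 1, by ring⟩)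
      · rw [add_zero]
    refine Run.ite (by simp; omega) ?_ ?_ (by omega)
    · intro hodd
      simp only [val_mod, val_reg, val_lit, r13] at hodd
      refine Run.mono (run_ripple (L := 4 * N) 8 (by omega) (by omega)
        (fun i _ => by rw [hm₅]; exact b8' i) r48 r16 (by omega) r17 hv1) (by omega) ?_
      rintro s₆ ⟨h₆, ⟨h6b, h6b'⟩, h6⟩
      refine ⟨h₅.trans h₆, hg₅.congr (h₆.r 2) (h₆.r 3) (h₆.m 2) (h₆.m 5), ?_, ?_, ?_, ?_, 0, _,
        by simp, habs, ?_, ?_, ?_⟩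
      · intro k; rw [h₆.m 7, hm₅]; exact b7' k
      · intro k
        by_cases hk : k < 4 * N
        · exact h6b k hk
        · rw [h6b' k (by omega), hm₅]; exact b8' k
      · intro k; rw [h₆.m 9, hm₅]; exact b9' k
      · intro k; rw [h₆.m 10, hm₅]; exact b10' k
      · rw [add_zero, ← hbin 7 k7', ← hbin₅]
        unfold State.binary
        rw [h₆.m 7]
      · rw [← hbin 8 k8', ← hbin₅]
        exact hcong _ _ _ _ h6
      · rw [hval, if_neg hodd]
        simp
    · intro heven
      simp only [val_mod, val_reg, val_lit, r13] at heven
      refine Run.mono (run_ripple (L := 4 * N) 7 (by omega) (by omega)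
        (fun i _ => by rw [hm₅]; exact b7' i) r48 r16 (by omega) r17 hv1) (by omega) ?_
      rintro s₆ ⟨h₆, ⟨h6b, h6b'⟩, h6⟩
      refine ⟨h₅.trans h₆, hg₅.congr (h₆.r 2) (h₆.r 3) (h₆.m 2) (h₆.m 5), ?_, ?_, ?_, ?_, _, 0,
        habs, by simp, ?_, ?_, ?_⟩
      · intro k
        by_cases hk : k < 4 * N
        · exact h6b k hk
        · rw [h6b' k (by omega), hm₅]; exact b7' k
      · intro k; rw [h₆.m 8, hm₅]; exact b8' k
      · intro k; rw [h₆.m 9, hm₅]; exact b9' k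
      · intro k; rw [h₆.m 10, hm₅]; exact b10' k
      · rw [← hbin 7 k7', ← hbin₅]
        exact hcong _ _ _ _ h6
      · rw [add_zero, ← hbin 8 k8', ← hbin₅]
        unfold State.binary
        rw [h₆.m 8]
      · rw [hval, if_pos heven]
        simp

end WordRAM

/-! ### Enumeration of the cocycles -/

namespace WordRAM

open WordRAM.Expr

variable {W S N : ℕ}

/-- The rows of length `N` of an array of bits, as vectors over `ℤ/2`. -/
def rowsOf (N : ℕ) (f : ℕ → ℕ) (i : ℕ) : Fin N → ZMod 2 := fun c => (f (i * N + c) : ZMod 2)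

/-- A vector over `ℤ/2` as an array of bits, padded by zeros. -/
def bitsOf (x : Fin N → ZMod 2) (c : ℕ) : ℕ := (coord x c).val

theorem bitsOf_le (x : Fin N → ZMod 2) (c : ℕ) : bitsOf x c ≤ 1 :=
  Nat.le_of_lt_succ (ZMod.val_lt _)

theorem bitsOf_zero : bitsOf (0 : Fin N → ZMod 2) = 0 := by
  ext c
  simp [bitsOf, coord]

/-- The member of the family with rows `R` whose coefficients are the binary digits of `k`. -/
def member {V : Type*} [AddCommMonoid V] (d : ℕ) (R : ℕ → V) (k : ℕ) : V :=
  R 0 + ∑ i ∈ Finset.range d, if k.testBit i then R (i + 1) else 0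

/-- Counting from `0` to `2 ^ d - 1` visits every member of the family once. -/
theorem sum_member {V : Type*} [AddCommGroup V] (d : ℕ) (R : ℕ → V) (F : V → ℂ) :
    ∑ k ∈ Finset.range (2 ^ d), F (member d R k) = famSum d R F := by
  induction d generalizing F with
  | zero => simp [member, famSum]
  | succ d ih =>
    rw [famSum_succ, ← ih, pow_succ, mul_two, Finset.sum_range_add, ← Finset.sum_add_distrib]
    refine Finset.sum_congr rfl fun k hk => ?_
    have hk := Finset.mem_range.1 hk
    have h1 : member (d + 1) R k = member d R k := by
      rw [member, Finset.sum_range_succ, Nat.testBit_lt_two_pow hk]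
      simp [member]
    have h2 : member (d + 1) R (2 ^ d + k) = member d R k + R (d + 1) := by
      rw [member, Finset.sum_range_succ, Nat.testBit_two_pow_add_eq, Nat.testBit_lt_two_pow hk,
        member, Finset.sum_congr rfl fun i hi => by
          rw [Nat.testBit_two_pow_add_gt (Finset.mem_range.1 hi)]]
      simp [add_assoc]
    rw [h1, h2]

theorem testBit_binary {s : State} {g : ℕ} (hb : Bits s g) (L : ℕ) :
    ∀ i < L, (s.binary g L).testBit i = decide (s.mem g i = 1) := by
  induction L with
  | zero => simp
  | succ L ih =>
    intro i hi
    have hlt := binary_lt (s := s) (g := g) L fun i _ => hb i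
    have hs : s.binary g (L + 1) = s.mem g L * 2 ^ L + s.binary g L := by
      rw [State.binary, Finset.sum_range_succ, add_comm]; rfl
    have h01 : s.mem g L = 0 ∨ s.mem g L = 1 := by have := hb L; omega
    rcases Nat.lt_succ_iff_lt_or_eq.1 hi with h | rfl
    · rw [← ih i h, hs]
      rcases h01 with h' | h'
      · rw [h', zero_mul, zero_add]
      · rw [h', one_mul, Nat.testBit_two_pow_add_gt h]
    · rw [hs]
      rcases h01 with h' | h'
      · rw [h', zero_mul, zero_add, Nat.testBit_lt_two_pow hlt]; rfl
      · rw [h', one_mul, Nat.testBit_two_pow_add_eq, Nat.testBit_lt_two_pow hlt]; rfl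

/-- Write to segment `4` the combination of the rows of segment `3` with the coefficients in
segment `6`. -/
def combine : Prog :=
  forLoop 46 (.reg 2) <|
    .seq (.assign 47 (load 3 (.reg 46))) <|
    .seq (forLoop 49 (.reg 9) (.assign 47
      (.reg 47 + load 6 (.reg 49) * load 3 ((.reg 49 + lit 1) * .reg 2 + .reg 46)))) <|
    .store 4 (.reg 46) (.reg 47 % lit 2)

theorem run_combine (hB : Big W S N) {d : ℕ} (hd : d ≤ N) {s : State} (h2 : s.reg 2 = N)
    (h9 : s.reg 9 = d) (hb3 : Bits s 3) (hb6 : Bits s 6) (h4 : ∀ c, N ≤ c → s.mem 4 c = 0) :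
    Run W S combine (4 * (N * N)) s fun s' => Same [46, 47, 49] [4] s s' ∧
      s'.mem 4 = bitsOf (member d (rowsOf N (s.mem 3)) (s.binary 6 d)) := by
  have hlin := hB.lin
  have hN := hB.hN
  have hWB := hB.hW
  have hSB := hB.hS
  have hmul : N * (3 * N + 4 + 2) = 3 * (N * N) + 6 * N := by ring
  refine Run.for N (fun c s' => Same [46, 47, 49] [4] s s' ∧ (∀ c, N ≤ c → s'.mem 4 c = 0) ∧
    ∀ c' < c, s'.mem 4 c' = (s.mem 3 c' + ∑ i ∈ Finset.range d,
      s.mem 6 i * s.mem 3 ((i + 1) * N + c')) % 2) (T := 3 * N + 4) (by omega) (by omega)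
    ⟨.refl, h4, by simp⟩ ?_ ?_ ?_ ?_ (by omega)
  · rintro i s' v ⟨h, h', h''⟩
    exact ⟨h.setReg, h', h''⟩
  · rintro i s' - ⟨h, -⟩ -
    simp [h.r 2, h2]
  · rintro c s' hc ⟨h, h', h''⟩ hx
    refine Run.assign_seq (by simp [hx]; omega) ?_ (by omega)
    simp only [val_load, val_reg, hx, h.m 3]
    refine Run.seq (T₁ := 3 * N + 2) (T₂ := 1) (R := fun s'' => Same [46, 47, 49] [4] s s'' ∧
      s''.mem 4 = s'.mem 4 ∧ s''.reg 46 = c ∧ s''.reg 47 = s.mem 3 c + ∑ i ∈ Finset.range d,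
      s.mem 6 i * s.mem 3 ((i + 1) * N + c)) ?_ ?_ (by omega)
    · refine Run.for d (fun k s'' => Same [46, 47, 49] [4] s s'' ∧
        s''.mem 4 = s'.mem 4 ∧ s''.reg 46 = c ∧ s''.reg 47 ≤ 1 + k ∧
        s''.reg 47 = s.mem 3 c + ∑ i ∈ Finset.range k, s.mem 6 i * s.mem 3 ((i + 1) * N + c))
        (T := 1) (by omega) (by omega) ⟨h.setReg, rfl, by simp [hx], by simpa using hb3 c, by simp⟩
        ?_ ?_ ?_ ?_ (by omega)
      · rintro k s'' v ⟨g, g1, g2, g3, g4⟩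
        exact ⟨g.setReg, g1, by simpa using g2, by simpa using g3, by simpa using g4⟩
      · rintro k s'' - ⟨g, -⟩ -
        simp [g.r 9, h9]
      · rintro k s'' hk ⟨g, g1, g2, g3, g4⟩ hx'
        have hb := mul_bit_le (hb6 k) (hb3 ((k + 1) * N + c))
        have ha := hB.addr (i := k + 1) (by omega) hc
        have hv : (load 6 (.reg 49) * load 3 ((.reg 49 + lit 1) * .reg 2 + .reg 46)).val s'' =
            s.mem 6 k * s.mem 3 ((k + 1) * N + c) := by
          simp [hx', g2, g.r 2, h2, g.m 3, g.m 6]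
        refine Run.assign ⟨trivial, ⟨?_, ?_, ?_⟩, ?_⟩ ⟨by simp [hx'], g.setReg, g1,
          by simpa using g2, ?_, ?_⟩ le_rfl
        · simp [hx']; omega
        · simp only [safe_load, safe_add, safe_mul, safe_reg, safe_lit, val_add, val_mul, val_reg,
            val_lit, hx', g2, g.r 2, h2, true_and]
          omega
        · change (load 6 (.reg 49) * load 3 ((.reg 49 + lit 1) * .reg 2 + .reg 46)).val s'' ≤ W
          omega
        · change s''.reg 47 +
            (load 6 (.reg 49) * load 3 ((.reg 49 + lit 1) * .reg 2 + .reg 46)).val s'' ≤ W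
          omega
        · simp only [setReg_reg, if_true]
          rw [val_add, hv, val_reg]
          omega
        · simp only [setReg_reg, if_true]
          rw [val_add, hv, val_reg, g4, Finset.sum_range_succ, add_assoc]
      · rintro s'' ⟨g, g1, g2, -, g4⟩
        exact ⟨g, g1, g2, g4⟩
    · rintro s'' ⟨g, g1, g2, g3⟩
      refine Run.store (by simp) (by simp; omega) (by simp [g2]; omega)
        ⟨by simpa using g2, g.setMem, ?_, ?_⟩ le_rfl
      · intro c' hc'
        simp only [setMem_mem, if_true, Function.update_apply, val_reg, g2, g1]
        rw [if_neg (by omega), h' c' hc']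
      · intro c' hc'
        simp only [setMem_mem, if_true, Function.update_apply, val_reg, val_mod, val_lit, g2, g1]
        split_ifs with hcc
        · rw [hcc, g3]
        · exact h'' c' (by omega)
  · rintro s' ⟨h, h', h''⟩
    refine ⟨h, ?_⟩
    ext c
    by_cases hc : c < N
    · rw [h'' c hc, ← ZMod.val_natCast, bitsOf, coord, dif_pos hc]
      congr 1
      push_cast
      rw [member, Pi.add_apply, Finset.sum_apply]
      congr 1
      · simp [rowsOf]
      · refine Finset.sum_congr rfl fun i hi => ?_
        rw [testBit_binary hb6 d i (Finset.mem_range.1 hi)]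
        have : s.mem 6 i = 0 ∨ s.mem 6 i = 1 := by have := hb6 i; omega
        rcases this with h | h <;> simp [h, rowsOf]
    · rw [h' c (by omega), bitsOf, coord, dif_neg hc]
      rfl

/-- The state after the weights of the first `k` of the `2 ^ d` cocycles have been added up.
Segment `6` holds the binary counter and segment `3` the family `Z` of all cocycles. -/
structure Progress (N n q d : ℕ) (G₀ G₁ Z : ℕ → ℕ) (k : ℕ) (s : State) : Prop where
  good : Good N s
  r0 : s.reg 0 = n
  r1 : s.reg 1 = q
  r9 : s.reg 9 = d
  r14 : s.reg 14 = 4 * N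
  m0 : s.mem 0 = G₀
  m1 : s.mem 1 = G₁
  m3 : s.mem 3 = Z
  m4 : ∀ c, N ≤ c → s.mem 4 c = 0
  b6 : Bits s 6
  b7 : Bits s 7
  b8 : Bits s 8
  b9 : Bits s 9
  b10 : Bits s 10
  counter : k < 2 ^ d → s.reg 15 = 1 ∧ s.binary 6 d = k
  done : k = 2 ^ d → s.reg 15 = 0
  total : ∃ a b : ℤ, |a| ≤ k * 2 ^ (2 * N) ∧ |b| ≤ k * 2 ^ (2 * N) ∧
    (s.binary 7 (4 * N) : ℤ) ≡ a [ZMOD 2 ^ (4 * N)] ∧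
    (s.binary 8 (4 * N) : ℤ) ≡ b [ZMOD 2 ^ (4 * N)] ∧
    ∑ j ∈ Finset.range k, cocycleWeight n G₀ G₁ (bitsOf (member d (rowsOf N Z) j)) q =
      (a + b * (Real.sqrt 2 : ℂ)) / 2 ^ (4 * n + 2)

/-- Add the weight of the cocycle given by the counter, and increment the counter.  An overflow of
the counter ends the enumeration. -/
def nextCocycle : Prog :=
  .seq combine <|
  .seq addWeight <|
  .seq (.assign 16 (lit 0)) <|
  .seq (.assign 17 (lit 1)) <|
  .seq (.assign 48 (.reg 9)) <|
  .seq (ripple 6) <|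
  .ite (equal (.reg 16) (.reg 9)) (.assign 15 (lit 0)) .skip

theorem run_nextCocycle {n q d : ℕ} (hB : Big W S N) (hn : N = 16 * n) {G₀ G₁ Z : ℕ → ℕ}
    (hG : Tables N G₀ G₁) (hd : d ≤ N) (hZ : ∀ j, Z j ≤ 1) {k : ℕ} (hk : k < 2 ^ d) {s : State}
    (h : Progress N n q d G₀ G₁ Z k s) :
    Run W S nextCocycle (254 * (N * (N * N))) s (Progress N n q d G₀ G₁ Z (k + 1)) := by
  have hlin := hB.lin
  have hN := hB.hN
  have hWB := hB.hW
  have hSB := hB.hS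
  have hNN : 16 * (N * N) ≤ N * (N * N) := Nat.mul_le_mul_right _ hN
  have hb3 : Bits s 3 := fun j => by rw [h.m3]; exact hZ j
  refine Run.seq (T₂ := 253 * (N * (N * N)))
    (run_combine hB hd h.good.r2 h.r9 hb3 h.b6 h.m4) ?_ (by omega)
  rintro s₁ ⟨h₁, e4⟩
  rw [h.m3, (h.counter hk).2] at e4
  have hbin : ∀ g s s', s'.mem g = s.mem g → ∀ L, State.binary s' g L = State.binary s g L := by
    intro g s s' hg L; unfold State.binary; rw [hg]
  refine Run.seq (T₂ := N * (N * N)) (run_addWeight (q := q) hB hn hG (bitsOf_le _)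
    (h.good.congr (h₁.r 2) (h₁.r 3) (h₁.m 2) (h₁.m 5)) ((h₁.r 0).trans h.r0)
    ((h₁.r 1).trans h.r1) ((h₁.m 0).trans h.m0) ((h₁.m 1).trans h.m1) e4
    (fun j => by rw [h₁.m 7]; exact h.b7 j) (fun j => by rw [h₁.m 8]; exact h.b8 j)
    (fun j => by rw [h₁.m 9]; exact h.b9 j) (fun j => by rw [h₁.m 10]; exact h.b10 j)) ?_ (by omega)
  rintro s₂ ⟨h₂, hg₂, b7, b8, b9, b10, a, b, ha, hb, h7, h8, hw⟩
  refine Run.assign_seq (by simp) ?_ (by omega)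
  refine Run.assign_seq (by simp; omega) ?_ (by omega)
  refine Run.assign_seq (by simp) ?_ (by omega)
  simp only [val_lit, val_reg, setReg_reg, Nat.reduceEqDiff, if_false]
  generalize hs₃ : ((s₂.setReg 16 0).setReg 17 1).setReg 48 (s₂.reg 9) = s₃
  have r16 : s₃.reg 16 = 0 := by simp [← hs₃]
  have r17 : s₃.reg 17 = 1 := by simp [← hs₃]
  have r48 : s₃.reg 48 = d := by rw [← hs₃]; simp [h₂.r 9, h₁.r 9, h.r9]
  have h₃ : Same [16, 17, 48] [] s₂ s₃ := by
    rw [← hs₃]; exact Same.setReg (Same.setReg Same.refl_setReg)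
  clear hs₃
  have m6 : s₃.mem 6 = s.mem 6 := by rw [h₃.m 6, h₂.m 6, h₁.m 6]
  refine Run.seq (T₁ := 7 * d + 2) (T₂ := 2) (run_ripple (L := d) 6 (by omega) (by omega) ?_ r48 r16
    (Nat.zero_le _) r17 le_rfl) ?_ (by omega)
  · intro i _; rw [m6]; exact h.b6 i
  rintro s₄ ⟨h₄, ⟨hb₄, hb₄'⟩, h6⟩
  rw [hbin 6 s s₃ m6, (h.counter hk).2] at h6
  have hlt := binary_lt d hb₄
  have b6 : Bits s₄ 6 := by
    intro i
    by_cases hi : i < d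
    · exact hb₄ i hi
    · rw [hb₄' i (by omega), m6]; exact h.b6 i
  have hall : ∀ s₅, Same [15] [] s₄ s₅ →
      (k + 1 < 2 ^ d → s₅.reg 15 = 1 ∧ s₅.binary 6 d = k + 1) → (k + 1 = 2 ^ d → s₅.reg 15 = 0) →
      Progress N n q d G₀ G₁ Z (k + 1) s₅ := by
    intro s₅ h₅ hc hd'
    have h₃' : Same [15, 16, 17, 46, 47, 48] [6] s₂ s₃ := h₃.mono
    have h₃₅ : Same [15, 16, 17, 46, 47, 48] [6] s₂ s₅ := (h₃'.trans h₄).trans h₅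
    refine ⟨hg₂.congr (h₃₅.r 2) (h₃₅.r 3) (h₃₅.m 2) (h₃₅.m 5), ?_, ?_, ?_, ?_, ?_, ?_, ?_, ?_, ?_,
      ?_, ?_, ?_, ?_, hc, hd', ?_⟩
    · rw [h₃₅.r 0, h₂.r 0, h₁.r 0, h.r0]
    · rw [h₃₅.r 1, h₂.r 1, h₁.r 1, h.r1]
    · rw [h₃₅.r 9, h₂.r 9, h₁.r 9, h.r9]
    · rw [h₃₅.r 14, h₂.r 14, h₁.r 14, h.r14]
    · rw [h₃₅.m 0, h₂.m 0, h₁.m 0, h.m0]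
    · rw [h₃₅.m 1, h₂.m 1, h₁.m 1, h.m1]
    · rw [h₃₅.m 3, h₂.m 3, h₁.m 3, h.m3]
    · intro c hc
      rw [h₃₅.m 4, h₂.m 4, e4, bitsOf, coord, dif_neg (by omega)]
      rfl
    · intro i; rw [h₅.m 6]; exact b6 i
    · intro i; rw [h₃₅.m 7]; exact b7 i
    · intro i; rw [h₃₅.m 8]; exact b8 i
    · intro i; rw [h₃₅.m 9]; exact b9 i
    · intro i; rw [h₃₅.m 10]; exact b10 i
    · obtain ⟨a', b', ha', hb', h7', h8', hw'⟩ := h.total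
      refine ⟨a' + a, b' + b, ?_, ?_, ?_, ?_, ?_⟩
      · push_cast
        rw [add_mul, one_mul]
        exact (abs_add_le _ _).trans (add_le_add ha' ha)
      · push_cast
        rw [add_mul, one_mul]
        exact (abs_add_le _ _).trans (add_le_add hb' hb)
      · rw [hbin 7 s₂ s₅ (h₃₅.m 7)]
        exact h7.trans ((hbin 7 s s₁ (h₁.m 7) (4 * N) ▸ h7').add_right a)
      · rw [hbin 8 s₂ s₅ (h₃₅.m 8)]
        exact h8.trans ((hbin 8 s s₁ (h₁.m 8) (4 * N) ▸ h8').add_right b)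
      · rw [Finset.sum_range_succ, hw', hw]
        push_cast
        ring
  have r9 : s₄.reg 9 = d := by rw [h₄.r 9, h₃.r 9, h₂.r 9, h₁.r 9, h.r9]
  have r15 : s₄.reg 15 = 1 := by
    rw [h₄.r 15, h₃.r 15, h₂.r 15, h₁.r 15, (h.counter hk).1]
  refine Run.ite (.equal (by omega) (by simp) (by simp)) ?_ ?_ (by omega)
  · intro hv
    have hv : s₄.reg 16 = d := by
      by_contra hne
      exact hv (by simp [r9, hne])
    rw [if_pos hv] at h6
    have : k + 1 = 2 ^ d := by
      have : (k : ℤ) + 1 = 2 ^ d + s₄.binary 6 d := by push_cast at h6; linarith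
      have : k + 1 = 2 ^ d + s₄.binary 6 d := by exact_mod_cast this
      omega
    exact Run.assign (by simp) (hall _ Same.refl_setReg (by omega) (by simp)) (by omega)
  · intro hv
    have hv : s₄.reg 16 ≠ d := by
      intro he
      simp [r9, he] at hv
    rw [if_neg hv] at h6
    have h6' : s₄.binary 6 d = k + 1 := by
      have : (s₄.binary 6 d : ℤ) = k + 1 := by push_cast at h6; linarith
      exact_mod_cast this
    exact Run.skip (hall _ .refl (fun _ => ⟨r15, h6'⟩) (by omega)) (by omega)

/-- The program: compute the space of all cocycles, add up the weights of the cocycles, and convert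
the accumulators to sign and absolute value. -/
def main : Prog :=
  .seq (.assign 2 (lit 16 * .reg 0)) <|
  .seq solve <|
  .seq (forLoop 46 ((.reg 3 + lit 1) * .reg 2) (.store 3 (.reg 46) (load 2 (.reg 46)))) <|
  .seq (.assign 9 (.reg 3)) <|
  .seq (.assign 14 (lit 4 * .reg 2)) <|
  .seq (.assign 15 (lit 1)) <|
  .seq (.while (.reg 15) nextCocycle) <|
  .seq (absolute 7 0 50) <|
  .seq (absolute 8 1 51) <|
  .seq (.assign 3 (lit 4 * .reg 0 + lit 2)) <|
  .seq (.assign 0 (.reg 14)) <|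
  .seq (.assign 1 (.reg 50)) (.assign 2 (.reg 51))

open Classical in
theorem run_main {n q : ℕ} (hB : Big W S N) (hn : N = 16 * n) {G₀ G₁ : ℕ → ℕ}
    (hG : Tables N G₀ G₁) {s : State} (h0 : s.reg 0 = n) (h1 : s.reg 1 = q)
    (hr : ∀ x, 2 ≤ x → s.reg x = 0) (m0 : s.mem 0 = G₀) (m1 : s.mem 1 = G₁)
    (hm : ∀ a, 2 ≤ a → s.mem a = 0) :
    Run W S main (400 * (2 ^ solutionDim N G₀ G₁ 0 0 * (N * (N * N)))) s fun s' => s'.Outputs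
      (∑ x : Fin N → ZMod 2, if Solution N G₀ G₁ 0 0 x then cocycleWeight n G₀ G₁ (bitsOf x) q
        else 0) := by
  have hlin := hB.lin
  have hN := hB.hN
  have hWB := hB.hW
  have hSB := hB.hS
  have hNN : 16 * (N * N) ≤ N * (N * N) := Nat.mul_le_mul_right _ hN
  have hpow := Nat.one_le_two_pow (n := solutionDim N G₀ G₁ 0 0)
  have hpow' := Nat.mul_le_mul_right (N * (N * N)) hpow
  rw [one_mul] at hpow'
  generalize hD : 2 ^ solutionDim N G₀ G₁ 0 0 * (N * (N * N)) = D at hpow' ⊢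
  refine Run.assign_seq (by simp [h0]; omega) ?_ (by omega)
  simp only [val_mul, val_lit, val_reg, h0, ← hn]
  have hbits : ∀ a, 2 ≤ a → Bits s a := fun a ha j => by rw [hm a ha]; exact Nat.zero_le _
  refine Run.seq (T₂ := 400 * D - 1 - 118 * (N * (N * N)))
    (run_solve hB hG (κ := 0) (al := 0) (by omega) (fun _ => Nat.zero_le _) (s := s.setReg 2 N)
      ⟨by simp, by simp [hr 3], hbits 2 (by omega), hbits 5 (by omega)⟩ (by simp [hr 5]) m0 m1
      (hm 4 (by omega))) ?_ (by omega)
  rintro s₁ ⟨h₁, hg₁, hF₁⟩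
  obtain ⟨hflag, hdim, -⟩ := solve_dim hF₁
  generalize solutionDim N G₀ G₁ 0 0 = d at *
  have hd : d ≤ N := hdim ▸ hg₁.r3
  have h₁' : Same [2, 3, 4, 6, 7, 8, 20, 21, 22, 23, 24, 25, 26, 27, 28, 29, 30, 31] [2, 5] s s₁ :=
    (Same.refl_setReg).trans h₁
  have hdN : (d + 1) * N ≤ (N + 1) * N := Nat.mul_le_mul_right _ (by omega)
  have hdN' : (N + 1) * N = N * N + N := Nat.succ_mul _ _
  refine Run.seq (T₁ := 3 * ((d + 1) * N) + 2) (T₂ := 260 * D) (R := fun s' => Same [46] [3] s₁ s' ∧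
    ∀ j, s'.mem 3 j = if j < (d + 1) * N then s₁.mem 2 j else 0) ?_ ?_ (by omega)
  · refine Run.for ((d + 1) * N) (fun k s' => Same [46] [3] s₁ s' ∧
      ∀ j, s'.mem 3 j = if j < k then s₁.mem 2 j else 0) (T := 1) (by omega) (by omega)
      ⟨.refl, by rw [h₁'.m 3, hm 3 (by omega)]; simp⟩ ?_ ?_ ?_ (fun _ h => h) (by omega)
    · rintro k s' v ⟨h, h'⟩
      exact ⟨h.setReg, h'⟩
    · rintro k s' - ⟨h, -⟩ -
      simp [h.r 3, h.r 2, hdim, hg₁.r2]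
      omega
    · rintro k s' hk ⟨h, h'⟩ hx
      refine Run.store (by simp) (by simp [hx]; omega) (by simp [hx]; omega)
        ⟨by simp [hx], h.setMem, fun j => ?_⟩ le_rfl
      simp only [setMem_mem, if_true, Function.update_apply, val_reg, val_load, hx, h.m 2]
      by_cases hj : j = k
      · rw [if_pos hj, if_pos (by omega), hj]
      · rw [if_neg hj, h' j]
        congr 1
        exact propext (by omega)
  rintro s₂ ⟨h₂, h3⟩
  have h₂' : Same [2, 3, 4, 6, 7, 8, 20, 21, 22, 23, 24, 25, 26, 27, 28, 29, 30, 31, 46] [2, 3, 5]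
    s s₂ := Same.trans (Same.mono h₁') h₂
  refine Run.assign_seq (by simp) ?_ (by omega)
  refine Run.assign_seq (by simp [h₂.r 2, hg₁.r2]; omega) ?_ (by omega)
  refine Run.assign_seq (by simp; omega) ?_ (by omega)
  simp only [val_mul, val_lit, val_reg, setReg_reg, Nat.reduceEqDiff, if_false, h₂.r 3, h₂.r 2,
    hdim, hg₁.r2]
  generalize hs₃ : ((s₂.setReg 9 d).setReg 14 (4 * N)).setReg 15 1 = s₃
  have h₃ : Same [9, 14, 15] [] s₂ s₃ := by
    rw [← hs₃]; exact Same.setReg (Same.setReg Same.refl_setReg)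
  have r9 : s₃.reg 9 = d := by simp [← hs₃]
  have r14 : s₃.reg 14 = 4 * N := by simp [← hs₃]
  have r15 : s₃.reg 15 = 1 := by simp [← hs₃]
  clear hs₃
  have hzero : ∀ a, a ∉ [0, 1, 2, 3, 5] → s₃.mem a = 0 := by
    intro a ha
    simp only [List.mem_cons, List.not_mem_nil, not_or] at ha
    rw [h₃.m a (by simp), h₂'.m a (by simp; omega), hm a (by omega)]
  have hbits₃ : ∀ a, a ∉ [0, 1, 2, 3, 5] → Bits s₃ a := fun a ha j => by
    rw [hzero a ha]; exact Nat.zero_le _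
  have hbin₃ : ∀ a, a ∉ [0, 1, 2, 3, 5] → ∀ L, s₃.binary a L = 0 := fun a ha L => by
    unfold State.binary; rw [hzero a ha]; simp
  have hstart : Progress N n q d G₀ G₁ (s₂.mem 3) 0 s₃ := by
    refine ⟨hg₁.congr (by rw [h₃.r 2, h₂.r 2]) (by rw [h₃.r 3, h₂.r 3]) (by rw [h₃.m 2, h₂.m 2])
      (by rw [h₃.m 5, h₂.m 5]), ?_, ?_, r9, r14, ?_, ?_, h₃.m 3, ?_, hbits₃ 6 (by decide),
      hbits₃ 7 (by decide), hbits₃ 8 (by decide), hbits₃ 9 (by decide), hbits₃ 10 (by decide),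
      fun _ => ⟨r15, hbin₃ 6 (by decide) _⟩, ?_, 0, 0, by simp, by simp, ?_, ?_, by simp⟩
    · rw [h₃.r 0, h₂'.r 0, h0]
    · rw [h₃.r 1, h₂'.r 1, h1]
    · rw [h₃.m 0, h₂'.m 0, m0]
    · rw [h₃.m 1, h₂'.m 1, m1]
    · intro c _; rw [hzero 4 (by decide)]; rfl
    · intro h; omega
    · rw [hbin₃ 7 (by decide)]; rfl
    · rw [hbin₃ 8 (by decide)]; rfl
  have hZ : ∀ j, s₂.mem 3 j ≤ 1 := by
    intro j
    rw [h3]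
    split_ifs
    · exact hg₁.b2 j
    · exact Nat.zero_le _
  have hsum : ∑ j ∈ Finset.range (2 ^ d),
      cocycleWeight n G₀ G₁ (bitsOf (member d (rowsOf N (s₂.mem 3)) j)) q =
      ∑ x : Fin N → ZMod 2, if Solution N G₀ G₁ 0 0 x then cocycleWeight n G₀ G₁ (bitsOf x) q
        else 0 := by
    rw [sum_member d (rowsOf N (s₂.mem 3)) fun x => cocycleWeight n G₀ G₁ (bitsOf x) q, ← hF₁,
      famVal, if_pos hflag, hdim]
    refine famSum_congr (fun i hi => ?_) _
    ext c
    have hc := c.2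
    have : i * N + c < (d + 1) * N := by
      have := Nat.mul_le_mul_right N hi
      rw [Nat.succ_mul]
      omega
    rw [rowsOf, rows, h3, if_pos this]
  have hK : 2 ^ d * (254 * (N * (N * N)) + 1) + 1 ≤ 255 * D := by
    have h4 : 2 ^ d * 1 ≤ 2 ^ d * (N * (N * N)) := Nat.mul_le_mul_left _ (by omega)
    have h5 : 2 ^ d * (254 * (N * (N * N)) + 1) = 254 * (2 ^ d * (N * (N * N))) + 2 ^ d * 1 := by
      ring
    have h6 : 2 ^ d * 1 + 1 ≤ 2 ^ d * (N * (N * N)) := by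
      have : 2 ^ d * 2 ≤ 2 ^ d * (N * (N * N)) := Nat.mul_le_mul_left _ (by omega)
      omega
    omega
  refine Run.seq (T₁ := 255 * D) (T₂ := 2 * (10 * (4 * N) + 9) + 4)
    (R := Progress N n q d G₀ G₁ (s₂.mem 3) (2 ^ d)) (Run.while hstart ?_ ?_ hK) ?_ (by omega)
  · intro k s' hk h
    exact ⟨trivial, by simp [(h.counter hk).1], run_nextCocycle hB hn hG hd hZ hk h⟩
  · intro s' h
    exact ⟨trivial, by simp [h.done rfl], h⟩
  intro s₄ h₄
  obtain ⟨a, b, ha, hb, h7, h8, hw⟩ := h₄.total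
  rw [hsum] at hw
  have hbound : ((2 ^ d : ℕ) : ℤ) * 2 ^ (2 * N) < 2 ^ (4 * N - 1) := by
    push_cast
    rw [← pow_add]
    exact pow_lt_pow_right₀ (by norm_num) (by omega)
  refine Run.seq (T₁ := 10 * (4 * N) + 9) (T₂ := 10 * (4 * N) + 9 + 4) (run_absolute
    (L := 4 * N) 7 0 50 (by decide) (by decide) (by omega) (by omega) (by omega) h₄.b7 h₄.r14
    (ha.trans_lt hbound) h7)
    ?_ (by omega)
  rintro s₅ ⟨h₅, hbits5, ha5⟩
  refine Run.seq (T₁ := 10 * (4 * N) + 9) (T₂ := 4) (run_absolute (L := 4 * N) 8 1 51 (s := s₅)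
    (a := b) (by decide) (by decide) (by omega) (by omega) (by omega) ?_ ((h₅.r 14).trans h₄.r14)
    (hb.trans_lt hbound) ?_) ?_ (by omega)
  · intro j; rw [h₅.m 8]; exact h₄.b8 j
  · unfold State.binary at h8 ⊢
    rw [h₅.m 8]
    exact h8
  rintro s₆ ⟨h₆, hbits6, hb6⟩
  have r0 : s₆.reg 0 = n := by rw [h₆.r 0, h₅.r 0, h₄.r0]
  have r14' : s₆.reg 14 = 4 * N := by rw [h₆.r 14, h₅.r 14, h₄.r14]
  have r50 : s₆.reg 50 = s₅.reg 50 := h₆.r 50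
  have hm0 : s₆.mem 0 = s₅.mem 0 := h₆.m 0
  refine Run.assign_seq (by simp [r0]; omega) ?_ (by omega)
  refine Run.assign_seq (by simp) ?_ (by omega)
  refine Run.assign_seq (by simp) ?_ (by omega)
  refine Run.assign (by simp) ?_ (by omega)
  simp only [val_add, val_mul, val_lit, val_reg, setReg_reg, Nat.reduceEqDiff, if_false, r0, r14']
  constructor
  · simp only [setReg_reg, Nat.reduceEqDiff, if_false, if_true, setReg_mem]
    intro i hi
    exact ⟨by rw [hm0]; exact hbits5 i hi, hbits6 i hi⟩
  · rw [hw, ha5, hb6]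
    unfold State.binary
    simp only [setReg_reg, Nat.reduceEqDiff, if_false, if_true, setReg_mem, r50, hm0]
    push_cast
    rfl

end WordRAM

/-! ### Edges and triangles of a triangulation -/

namespace Triangulation

variable {n : ℕ} (T : Triangulation n)

theorem edge_comm (t : Fin n) {a b : Fin 4} (h : a ≠ b) : T.edge t a b h = T.edge t b a h.symm := by
  unfold edge
  congr 3
  exact Finset.pair_comm a b

theorem edge_glue (t : Fin n) {i a b : Fin 4} (h : a ≠ b) (ha : i ≠ a) (hb : i ≠ b) :
    T.edge t a b h = T.edge (T.adj t i) (T.glue t i a) (T.glue t i b)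
      ((T.glue t i).injective.ne h) := by
  refine Quot.sound ⟨i, by simp [ha, hb], rfl, ?_⟩
  simp [Finset.map_insert]

theorem exists_edge (e : T.Face 1) : ∃ t a b h, e = T.edge t a b h := by
  induction e using Quot.ind with
  | mk f =>
    obtain ⟨t, s, hs⟩ := f
    obtain ⟨a, b, h, rfl⟩ := Finset.card_eq_two.1 hs
    exact ⟨t, a, b, h, rfl⟩

/-- The class of the triangle of tetrahedron `t` with vertices `a`, `b`, `c`. -/
def triangle (t : Fin n) {a b c : Fin 4} (hab : a ≠ b) (hac : a ≠ c) (hbc : b ≠ c) : T.Face 2 :=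
  Quot.mk _ (t, ⟨{a, b, c}, Finset.card_eq_three.2 ⟨a, b, c, hab, hac, hbc, rfl⟩⟩)

theorem exists_triangle (f : T.Face 2) :
    ∃ t, ∃ (a b c : Fin 4) (hab : a ≠ b) (hac : a ≠ c) (hbc : b ≠ c),
      f = T.triangle t hab hac hbc := by
  induction f using Quot.ind with
  | mk f =>
    obtain ⟨t, s, hs⟩ := f
    obtain ⟨a, b, c, hab, hac, hbc, rfl⟩ := Finset.card_eq_three.1 hs
    exact ⟨t, a, b, c, hab, hac, hbc, rfl⟩

theorem facets_triangle (t : Fin n) {a b c : Fin 4} (hab : a ≠ b) (hac : a ≠ c) (hbc : b ≠ c) :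
    T.facets (T.triangle t hab hac hbc) =
      {T.edge t a b hab, T.edge t b c hbc, T.edge t c a hac.symm} := by
  have hu : (Finset.univ : Finset {v // v ∈ ({a, b, c} : Finset (Fin 4))}) =
      {⟨c, by simp⟩, ⟨a, by simp⟩, ⟨b, by simp⟩} := by
    ext ⟨v, hv⟩
    simp only [Finset.mem_insert, Finset.mem_singleton] at hv
    simp only [Finset.mem_univ, Finset.mem_insert, Finset.mem_singleton, Subtype.mk.injEq, true_iff]
    tauto
  change T.localFacets _ = _
  unfold localFacets
  dsimp only
  rw [hu, Finset.insert_val_of_notMem (by simp [hac.symm, hbc.symm]),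
    Finset.insert_val_of_notMem (by simp [hab]), Finset.singleton_val]
  simp only [Multiset.map_cons, Multiset.map_singleton, Multiset.insert_eq_cons, edge]
  have h1 : ({a, b, c} : Finset (Fin 4)).erase c = {a, b} := by
    ext v; simp only [Finset.mem_erase, Finset.mem_insert, Finset.mem_singleton]
    constructor
    · tauto
    · rintro (rfl | rfl) <;> simp [*]
  have h2 : ({a, b, c} : Finset (Fin 4)).erase a = {b, c} := by
    ext v; simp only [Finset.mem_erase, Finset.mem_insert, Finset.mem_singleton]
    constructor
    · tauto
    · rintro (rfl | rfl)
      · exact ⟨hab.symm, by simp⟩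
      · exact ⟨hac.symm, by simp⟩
  have h3 : ({a, b, c} : Finset (Fin 4)).erase b = {c, a} := by
    ext v; simp only [Finset.mem_erase, Finset.mem_insert, Finset.mem_singleton]
    constructor
    · tauto
    · rintro (rfl | rfl)
      · exact ⟨hbc.symm, by simp⟩
      · exact ⟨hab, by simp⟩
  congr! 5
  exact Subtype.ext h3

/-! ### Triangles as pairs of faces of tetrahedra -/

/-- Face `i` of tetrahedron `t`. -/
def localTriangle (p : Fin n × Fin 4) : LocalFace n 2 :=
  (p.1, ⟨{p.2}ᶜ, by rw [Finset.card_compl, Finset.card_singleton, Fintype.card_fin]⟩)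

theorem localTriangle_surjective : Function.Surjective (localTriangle (n := n)) := by
  rintro ⟨t, s, hs⟩
  have : sᶜ.card = 1 := by rw [Finset.card_compl, hs, Fintype.card_fin]
  obtain ⟨i, hi⟩ := Finset.card_eq_one.1 this
  refine ⟨(t, i), ?_⟩
  simp only [localTriangle, ← hi, compl_compl]

/-- The face to which a given face is glued. -/
def partner (p : Fin n × Fin 4) : Fin n × Fin 4 := (T.adj p.1 p.2, T.glue p.1 p.2 p.2)

theorem partner_partner (p : Fin n × Fin 4) : T.partner (T.partner p) = p := by
  obtain ⟨t, i⟩ := p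
  simp [partner, T.adj_adj, T.glue_glue]

theorem partner_ne (p : Fin n × Fin 4) : T.partner p ≠ p := T.no_fixed_face p.1 p.2

theorem faceRel_localTriangle (p p' : Fin n × Fin 4) :
    T.FaceRel 2 (localTriangle p) (localTriangle p') ↔ p' = T.partner p := by
  obtain ⟨t, i⟩ := p
  obtain ⟨t', i'⟩ := p'
  have h : ∀ j, (({j} : Finset (Fin 4))ᶜ).map (T.glue t j).toEmbedding = {T.glue t j j}ᶜ := by
    intro j
    ext v
    simp only [Finset.mem_map_equiv, Finset.mem_compl, Finset.mem_singleton, Equiv.symm_apply_eq]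
  constructor
  · rintro ⟨j, hj, h1, h2⟩
    simp only [localTriangle, Finset.mem_compl, Finset.mem_singleton, not_not] at hj h1 h2
    subst hj
    rw [h, compl_inj_iff, Finset.singleton_inj] at h2
    rw [h1, h2, partner]
  · intro h'
    obtain ⟨rfl, rfl⟩ := Prod.mk.inj h'
    exact ⟨i, by simp [localTriangle], rfl, (h i).symm⟩

/-- The class of a face of a tetrahedron. -/
def face (p : Fin n × Fin 4) : T.Face 2 := Quot.mk _ (localTriangle p)

theorem face_eq_iff (p p' : Fin n × Fin 4) : T.face p = T.face p' ↔ p' = p ∨ p' = T.partner p := by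
  constructor
  · intro h
    have key : ∀ f f', Relation.EqvGen (T.FaceRel 2) f f' → ∀ p p', f = localTriangle p →
        f' = localTriangle p' → p' = p ∨ p' = T.partner p := by
      intro f f' hf
      have hinj : Function.Injective (localTriangle (n := n)) := by
        rintro ⟨t, i⟩ ⟨t', i'⟩ h
        simpa [localTriangle] using h
      induction hf with
      | rel f f' hr =>
        rintro p p' rfl rfl
        exact .inr ((T.faceRel_localTriangle p p').1 hr)
      | refl f =>
        rintro p p' h h'
        exact .inl (hinj (h'.symm.trans h))
      | symm f f' _ ih =>
        rintro p p' h h'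
        rcases ih p' p h' h with rfl | rfl
        · exact .inl rfl
        · exact .inr (T.partner_partner _).symm
      | trans f f' f'' _ _ ih ih' =>
        rintro p p'' h h''
        obtain ⟨p', h'⟩ := localTriangle_surjective f'
        rcases ih p p' h h'.symm with rfl | rfl
        · exact ih' _ _ h'.symm h''
        · rcases ih' _ _ h'.symm h'' with rfl | rfl
          · exact .inr rfl
          · exact .inl (T.partner_partner _)
    exact key _ _ (Quot.eqvGen_exact h) p p' rfl rfl
  · rintro (rfl | rfl)
    · rfl
    · exact Quot.sound ((T.faceRel_localTriangle _ _).2 rfl)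

theorem face_surjective : Function.Surjective T.face := by
  intro f
  induction f using Quot.ind with
  | mk f =>
    obtain ⟨p, rfl⟩ := localTriangle_surjective f
    exact ⟨p, rfl⟩

/-- The number of a face of a tetrahedron. -/
def faceIndex (p : Fin n × Fin 4) : ℕ := 4 * p.1 + p.2

theorem faceIndex_injective : Function.Injective (faceIndex (n := n)) := by
  rintro ⟨t, i⟩ ⟨t', i'⟩ h
  simp only [faceIndex] at h
  have h1 := i.2
  have h2 := i'.2
  exact Prod.ext (Fin.ext (by dsimp only; omega)) (Fin.ext (by dsimp only; omega))

/-- A product over all triangles, as a product over the faces of tetrahedra that precede their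
partners. -/
theorem prod_face {M : Type*} [CommMonoid M] (h : T.Face 2 → M) :
    ∏ f, h f = ∏ p : Fin n × Fin 4,
      if faceIndex p < faceIndex (T.partner p) then h (T.face p) else 1 := by
  classical
  rw [← Finset.prod_filter]
  symm
  refine Finset.prod_bij (fun p _ => T.face p) (fun _ _ => Finset.mem_univ _) ?_ ?_
    (fun _ _ => rfl)
  · intro p hp p' hp' heq
    simp only [Finset.mem_filter, Finset.mem_univ, true_and] at hp hp'
    rcases (T.face_eq_iff p p').1 heq with h | rfl
    · exact h.symm
    · rw [T.partner_partner] at hp'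
      omega
  · intro f _
    obtain ⟨p, rfl⟩ := T.face_surjective f
    have hne : faceIndex p ≠ faceIndex (T.partner p) :=
      fun h => T.partner_ne p (faceIndex_injective h).symm
    by_cases hlt : faceIndex p < faceIndex (T.partner p)
    · exact ⟨p, by simpa using hlt, rfl⟩
    · refine ⟨T.partner p, ?_, ((T.face_eq_iff _ _).2 (.inr rfl)).symm⟩
      simp only [Finset.mem_filter, Finset.mem_univ, true_and, T.partner_partner]
      omega

/-- The three edges of face `i` of tetrahedron `t`. -/
theorem face_eq_triangle (t : Fin n) (i : Fin 4) :
    T.face (t, i) = T.triangle t (a := i + 1) (b := i + 2) (c := i + 3)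
      (by revert i; decide) (by revert i; decide) (by revert i; decide) := by
  have h : ∀ i : Fin 4, ({i}ᶜ : Finset (Fin 4)) = {i + 1, i + 2, i + 3} := by decide
  unfold face triangle localTriangle
  congr! 3
  exact h i

end Triangulation

/-! ### Functions on the edges as solutions of the equations -/

namespace Triangulation

open WordRAM

variable {n : ℕ} (T : Triangulation n)

/-- A function of the local edges that is compatible with the gluing maps is a function of the
edges. -/
theorem exists_of_local {M : Type*} (y : Fin n → Fin 4 → Fin 4 → M)
    (hsymm : ∀ t a b, y t a b = y t b a)
    (hglue : ∀ t i a b, i ≠ a → i ≠ b → y t a b = y (T.adj t i) (T.glue t i a) (T.glue t i b)) :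
    ∃ g : T.Face 1 → M, ∀ t a b h, g (T.edge t a b h) = y t a b := by
  have hex : ∀ f : LocalFace n 1, ∃ m, ∀ a b, a ≠ b → f.2.1 = {a, b} → m = y f.1 a b := by
    rintro ⟨t, s, hs⟩
    obtain ⟨a, b, hab, rfl⟩ := Finset.card_eq_two.1 hs
    refine ⟨y t a b, fun a' b' hab' h => ?_⟩
    have ha : a ∈ ({a', b'} : Finset (Fin 4)) := by rw [← h]; simp
    have hb : b ∈ ({a', b'} : Finset (Fin 4)) := by rw [← h]; simp
    simp only [Finset.mem_insert, Finset.mem_singleton] at ha hb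
    rcases ha with rfl | rfl <;> rcases hb with rfl | rfl
    · exact absurd rfl hab
    · rfl
    · exact hsymm t _ _
    · exact absurd rfl hab
  choose Y hY using hex
  refine ⟨Quot.lift Y ?_, fun t a b h => hY _ a b h rfl⟩
  rintro ⟨t, s, hs⟩ ⟨t', s', hs'⟩ ⟨i, hi, h1, h2⟩
  obtain ⟨a, b, hab, rfl⟩ := Finset.card_eq_two.1 hs
  dsimp only at hi h1 h2
  subst h1 h2
  simp only [Finset.mem_insert, Finset.mem_singleton, not_or] at hi
  rw [hY _ a b hab rfl, hY _ _ _ ((T.glue t i).injective.ne hab) (by simp [Finset.map_insert]),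
    hglue t i a b hi.1 hi.2]

/-- The value of a function at the edge from `a` to `b`, and `0` if `a = b`. -/
def edgeVal (g : T.Face 1 → ZMod 2) (t : Fin n) (a b : Fin 4) : ZMod 2 :=
  if h : a ≠ b then g (T.edge t a b h) else 0

theorem edgeVal_of_ne (g : T.Face 1 → ZMod 2) (t : Fin n) {a b : Fin 4} (h : a ≠ b) :
    T.edgeVal g t a b = g (T.edge t a b h) := dif_pos h

theorem edgeVal_self (g : T.Face 1 → ZMod 2) (t : Fin n) (a : Fin 4) : T.edgeVal g t a a = 0 :=
  dif_neg (by simp)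

theorem edgeVal_comm (g : T.Face 1 → ZMod 2) (t : Fin n) (a b : Fin 4) :
    T.edgeVal g t a b = T.edgeVal g t b a := by
  by_cases h : a = b
  · rw [h]
  · rw [T.edgeVal_of_ne g t h, T.edgeVal_of_ne g t (Ne.symm h), T.edge_comm]

theorem edgeVal_glue (g : T.Face 1 → ZMod 2) (t : Fin n) {i a b : Fin 4} (ha : i ≠ a)
    (hb : i ≠ b) :
    T.edgeVal g t a b = T.edgeVal g (T.adj t i) (T.glue t i a) (T.glue t i b) := by
  by_cases h : a = b
  · rw [h, edgeVal_self, edgeVal_self]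
  · rw [T.edgeVal_of_ne g t h, T.edgeVal_of_ne g _ ((T.glue t i).injective.ne h),
      T.edge_glue t h ha hb]

/-- The vector of the values of a function on the edges at all local edges. -/
def pull (g : T.Face 1 → ZMod 2) : Fin (16 * n) → ZMod 2 := fun c =>
  T.edgeVal g ⟨c / 16, by omega⟩ (Fin.ofNat 4 (c / 4)) (Fin.ofNat 4 c)

theorem cell_lt (t : Fin n) (a b : Fin 4) : 16 * (t : ℕ) + 4 * a + b < 16 * n := by
  omega

theorem coord_pull (g : T.Face 1 → ZMod 2) (t : Fin n) (a b : Fin 4) :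
    coord (T.pull g) (16 * t + 4 * a + b) = T.edgeVal g t a b := by
  rw [coord, dif_pos (cell_lt t a b), pull]
  congr 1
  · ext; dsimp only; omega
  · ext; simp only [Fin.ofNat]; omega
  · ext; simp only [Fin.ofNat]; omega

theorem bitsOf_pull (g : T.Face 1 → ZMod 2) (t : Fin n) (a b : Fin 4) :
    bitsOf (T.pull g) (16 * t + 4 * a + b) = (T.edgeVal g t a b).val := by
  rw [bitsOf, coord_pull]

theorem pull_injective : Function.Injective T.pull := by
  intro g g' h
  ext e
  obtain ⟨t, a, b, hab, rfl⟩ := T.exists_edge e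
  have := T.coord_pull g t a b
  rw [h, coord_pull, edgeVal_of_ne _ _ _ hab, edgeVal_of_ne _ _ _ hab] at this
  exact this.symm

theorem pull_zero : T.pull 0 = 0 := by
  ext c
  unfold pull edgeVal
  split_ifs <;> rfl

theorem ext_coord {x y : Fin (16 * n) → ZMod 2}
    (h : ∀ (t : Fin n) (a b : Fin 4), coord x (16 * t + 4 * a + b) = coord y (16 * t + 4 * a + b)) :
    x = y := by
  ext c
  have hc := c.2
  have := h ⟨c / 16, by omega⟩ ⟨c / 4 % 4, by omega⟩ ⟨c % 4, by omega⟩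
  dsimp only at this
  rw [show 16 * ((c : ℕ) / 16) + 4 * (c / 4 % 4) + c % 4 = c by omega] at this
  rw [coord, coord, dif_pos hc, dif_pos hc] at this
  exact this

theorem input_adj (q : ℕ) (t : Fin n) (i : Fin 4) :
    (input T q).mem 0 (4 * t + i) = T.adj t i := by
  have h : (4 * (t : ℕ) + i) / 4 < n := by omega
  simp only [input, if_true, dif_pos h]
  congr 2
  · ext; dsimp only; omega
  · ext; simp only [Fin.ofNat]; omega

theorem input_glue (q : ℕ) (t : Fin n) (i a : Fin 4) :
    (input T q).mem 1 (16 * t + 4 * i + a) = T.glue t i a := by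
  have h : (16 * (t : ℕ) + 4 * i + a) / 16 < n := by omega
  have e1 : (⟨(16 * (t : ℕ) + 4 * i + a) / 16, h⟩ : Fin n) = t := by ext; dsimp only; omega
  have e2 : Fin.ofNat 4 ((16 * (t : ℕ) + 4 * i + a) / 4) = i := by
    ext; simp only [Fin.ofNat]; omega
  have e3 : Fin.ofNat 4 (16 * (t : ℕ) + 4 * i + a) = a := by
    ext; simp only [Fin.ofNat]; omega
  simp only [input, one_ne_zero, if_false, if_true, dif_pos h, e1, e2, e3]

theorem tables_input (q : ℕ) : Tables (16 * n) ((input T q).mem 0) ((input T q).mem 1) where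
  dvd := Dvd.intro _ rfl
  adj_lt j hj := by
    have h : j / 4 < n := by omega
    simp only [input, if_true, dif_pos h]
    omega
  glue_lt j := by
    simp only [input, one_ne_zero, if_false, if_true]
    split_ifs <;> omega

theorem equations_iff (q : ℕ) (α : T.Face 1 → ZMod 2) (κ : ℕ) (x : Fin (16 * n) → ZMod 2)
    (t : Fin n) (i a b : Fin 4) :
    Equations ((input T q).mem 0) ((input T q).mem 1) (bitsOf (T.pull α)) κ
      (64 * t + 16 * i + 4 * a + b) x ↔
    ((a = b ∨ (T.edgeVal α t a b).val ≠ κ) → coord x (16 * t + 4 * a + b) = 0) ∧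
    (coord x (16 * t + 4 * a + b) + coord x (16 * t + 4 * b + a) +
      coord x (16 * t + 4 * a + a) = 0) ∧
    ((i ≠ a ∧ i ≠ b) → coord x (16 * t + 4 * a + b) +
      coord x (16 * T.adj t i + 4 * T.glue t i a + T.glue t i b) +
      coord x (16 * t + 4 * a + a) = 0) ∧
    ((T.edgeVal α t a b).val + (T.edgeVal α t b i).val + (T.edgeVal α t i a).val + κ = 0 →
      coord x (16 * t + 4 * a + b) + coord x (16 * t + 4 * b + i) +
      coord x (16 * t + 4 * i + a) = 0) := by
  have h1 : (64 * (t : ℕ) + 16 * i + 4 * a + b) / 64 * 16 = 16 * t := by omega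
  have h2 : (64 * (t : ℕ) + 16 * i + 4 * a + b) / 16 % 4 = i := by omega
  have h3 : (64 * (t : ℕ) + 16 * i + 4 * a + b) / 4 % 4 = a := by omega
  have h4 : (64 * (t : ℕ) + 16 * i + 4 * a + b) % 4 = b := by omega
  have h5 : 16 * (t : ℕ) / 4 = 4 * t := by omega
  have h6 : ∀ z : ZMod 2, z + z + z = 0 ↔ z = 0 := by decide
  simp only [Equations, h1, h2, h3, h4, h5, h6, input_adj, input_glue, bitsOf_pull, Fin.ext_iff,
    ne_eq]

theorem solution_iff_equations (q : ℕ) (α : T.Face 1 → ZMod 2) (κ : ℕ)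
    (x : Fin (16 * n) → ZMod 2) :
    Solution (16 * n) ((input T q).mem 0) ((input T q).mem 1) (bitsOf (T.pull α)) κ x ↔
      ∀ (t : Fin n) (i a b : Fin 4), Equations ((input T q).mem 0) ((input T q).mem 1)
        (bitsOf (T.pull α)) κ (64 * t + 16 * i + 4 * a + b) x := by
  constructor
  · intro h t i a b
    exact h _ (by omega)
  · intro h p hp
    have := h ⟨p / 64, by omega⟩ ⟨p / 16 % 4, by omega⟩ ⟨p / 4 % 4, by omega⟩ ⟨p % 4, by omega⟩
    dsimp only at this
    rwa [show 64 * (p / 64) + 16 * (p / 16 % 4) + 4 * (p / 4 % 4) + p % 4 = p by omega] at this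

/-- The solutions are the functions on the edges that vanish outside the edges of colour `κ` and,
for `κ = 0`, have sum zero over each triangle whose edges have colour `0`. -/
theorem solution_iff (q : ℕ) (α : T.Face 1 → ZMod 2) (κ : ℕ) (x : Fin (16 * n) → ZMod 2) :
    Solution (16 * n) ((input T q).mem 0) ((input T q).mem 1) (bitsOf (T.pull α)) κ x ↔
      ∃ g, T.pull g = x ∧ (∀ e, (α e).val ≠ κ → g e = 0) ∧
        (κ = 0 → ∀ f, (∀ e ∈ T.facets f, α e = 0) → ((T.facets f).map g).sum = 0) := by
  have h2 : ∀ y z : ZMod 2, y + z = 0 ↔ y = z := by decide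
  rw [solution_iff_equations]
  simp only [equations_iff]
  constructor
  · intro h
    have hdiag : ∀ (t : Fin n) (a : Fin 4), coord x (16 * t + 4 * a + a) = 0 := fun t a =>
      (h t 0 a a).1 (.inl rfl)
    obtain ⟨g, hg⟩ := T.exists_of_local (fun t a b => coord x (16 * t + 4 * a + b))
      (fun t a b => by
        have := (h t 0 a b).2.1
        rwa [hdiag, add_zero, h2] at this)
      (fun t i a b ha hb => by
        have := (h t i a b).2.2.1 ⟨ha, hb⟩
        rwa [hdiag, add_zero, h2] at this)
    refine ⟨g, ext_coord fun t a b => ?_, fun e he => ?_, fun hκ f hf => ?_⟩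
    · rw [coord_pull]
      by_cases hab : a = b
      · rw [hab, edgeVal_self, hdiag]
      · rw [edgeVal_of_ne _ _ _ hab, hg]
    · obtain ⟨t, a, b, hab, rfl⟩ := T.exists_edge e
      rw [hg]
      exact (h t 0 a b).1 (.inr (by rwa [edgeVal_of_ne _ _ _ hab]))
    · obtain ⟨t, a, b, c, hab, hac, hbc, rfl⟩ := T.exists_triangle f
      rw [facets_triangle] at hf ⊢
      simp only [Multiset.insert_eq_cons, Multiset.mem_cons, Multiset.mem_singleton,
        forall_eq_or_imp, forall_eq] at hf
      have := (h t c a b).2.2.2 (by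
        rw [edgeVal_of_ne _ _ _ hab, edgeVal_of_ne _ _ _ hbc, edgeVal_of_ne _ _ _ hac.symm, hf.1,
          hf.2.1, hf.2.2, hκ]
        rfl)
      simpa [hg, add_assoc] using this
  · rintro ⟨g, rfl, hα, hf⟩ t i a b
    simp only [coord_pull, edgeVal_self, add_zero]
    refine ⟨fun h => ?_, (h2 _ _).2 (T.edgeVal_comm g t a b), fun h =>
      (h2 _ _).2 (T.edgeVal_glue g t h.1 h.2), fun h => ?_⟩
    · by_cases hab : a = b
      · rw [hab, edgeVal_self]
      · rw [edgeVal_of_ne _ _ _ hab] at h ⊢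
        exact hα _ (h.resolve_left hab)
    · by_cases hab : a = b
      · rw [hab, edgeVal_self, zero_add, h2, edgeVal_comm]
      by_cases hbi : b = i
      · rw [hbi, edgeVal_self, add_zero, h2, edgeVal_comm]
      by_cases hia : i = a
      · rw [hia, edgeVal_self, add_zero, h2, edgeVal_comm]
      have hval : ∀ z : ZMod 2, z.val = 0 → z = 0 := by decide
      have := hf (by omega) (T.triangle t hab (Ne.symm hia) hbi) (by
        rw [facets_triangle]
        simp only [Multiset.insert_eq_cons, Multiset.mem_cons, Multiset.mem_singleton,
          forall_eq_or_imp, forall_eq]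
        rw [← T.edgeVal_of_ne α t hab, ← T.edgeVal_of_ne α t hbi, ← T.edgeVal_of_ne α t hia]
        exact ⟨hval _ (by omega), hval _ (by omega), hval _ (by omega)⟩)
      rw [facets_triangle] at this
      rw [edgeVal_of_ne _ _ _ hab, edgeVal_of_ne _ _ _ hbi, edgeVal_of_ne _ _ _ hia]
      simpa [add_assoc] using this

end Triangulation

/-! ### Counting the cocycles -/

namespace Triangulation

open WordRAM

variable {n : ℕ} (T : Triangulation n)

/-- The `1`-cocycles with coefficients in `ℤ/2`. -/
def IsCocycle (g : T.Face 1 → ZMod 2) : Prop := ∀ f, ((T.facets f).map g).sum = 0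

theorem card_facets {k : ℕ} (f : T.Face (k + 1)) : (T.facets f).card = k + 2 := by
  induction f using Quot.ind with
  | mk f => exact (Multiset.card_map _ _).trans (by
    change Finset.univ.card = _
    rw [Finset.card_univ, Fintype.card_coe]
    exact f.2.2)

/-- In a one-vertex triangulation every edge is a loop. -/
theorem boundary_zero (hT : T.IsOneVertex) : T.boundary 0 = 0 := by
  have := (Nat.card_eq_one_iff_unique.1 hT).1
  refine Finsupp.lhom_ext' fun e => LinearMap.ext_ring ?_
  obtain ⟨v, w, h⟩ := Multiset.card_eq_two.1 (T.card_facets e)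
  have h2 : (1 : ZMod 2) + 1 = 0 := by decide
  simp [boundary, h, Subsingleton.elim w v, ← Finsupp.single_add, h2]

theorem isCocycle_iff (φ : Module.Dual (ZMod 2) (T.Face 1 →₀ ZMod 2)) :
    T.IsCocycle (fun e => φ (Finsupp.single e 1)) ↔ φ ∈ LinearMap.ker (T.boundary 1).dualMap := by
  rw [LinearMap.mem_ker]
  have h : ∀ f, (T.boundary 1).dualMap φ (Finsupp.single f 1) =
      ((T.facets f).map fun e => φ (Finsupp.single e 1)).sum := by
    intro f
    rw [LinearMap.dualMap_apply]
    simp only [boundary, Finsupp.linearCombination_single, one_smul, map_multiset_sum,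
      Multiset.map_map, Function.comp_def]
  constructor
  · intro hg
    refine Finsupp.lhom_ext' fun f => LinearMap.ext_ring ?_
    exact (h f).trans (hg f)
  · intro hφ f
    rw [← h f, hφ]
    rfl

/-- Since all edges are loops, `H₁` is the cokernel of the boundary of triangles, and the cocycles
are its dual. -/
theorem card_isCocycle (hT : T.IsOneVertex) :
    Nat.card {g // T.IsCocycle g} = 2 ^ T.betti1 := by
  let e : (T.Face 1 → ZMod 2) ≃ₗ[ZMod 2] Module.Dual (ZMod 2) (T.Face 1 →₀ ZMod 2) :=
    Finsupp.llift (ZMod 2) (ZMod 2) (ZMod 2) (T.Face 1)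
  have he : ∀ g, (fun x => e g (Finsupp.single x 1)) = g := by
    intro g
    ext x
    simp [e]
  have h1 : Nat.card {g // T.IsCocycle g} = Nat.card (LinearMap.ker (T.boundary 1).dualMap) := by
    refine Nat.card_congr (e.toEquiv.subtypeEquiv fun g => ?_)
    have := T.isCocycle_iff (e g)
    rw [he g] at this
    exact this
  rw [h1, Module.natCard_eq_pow_finrank (K := ZMod 2), Nat.card_zmod]
  congr 1
  have h2 := LinearMap.finrank_range_add_finrank_ker (T.boundary 1).dualMap
  rw [LinearMap.finrank_range_dualMap_eq_finrank_range, Subspace.dual_finrank_eq] at h2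
  have hker : LinearMap.ker (T.boundary 0) = ⊤ := by
    rw [T.boundary_zero hT]; exact LinearMap.ker_zero
  have h3 := Submodule.finrank_quotient_add_finrank
    ((LinearMap.range (T.boundary 1)).comap (LinearMap.ker (T.boundary 0)).subtype :
      Submodule (ZMod 2) (LinearMap.ker (T.boundary 0)))
  have h4 : LinearMap.range (T.boundary 1) ≤ LinearMap.ker (T.boundary 0) := by
    rw [hker]; exact le_top
  rw [(Submodule.comapSubtypeEquivOfLe h4).finrank_eq] at h3
  have h5 : Module.finrank (ZMod 2) (LinearMap.ker (T.boundary 0)) =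
      Module.finrank (ZMod 2) (T.Face 1 →₀ ZMod 2) := by
    rw [hker, finrank_top]
  rw [h5] at h3
  change T.betti1 + _ = _ at h3
  omega

open Classical in
/-- A sum over the solutions as a sum over functions on the edges. -/
theorem sum_solution (q : ℕ) (α : T.Face 1 → ZMod 2) (κ : ℕ) {M : Type*} [AddCommMonoid M]
    (F : (Fin (16 * n) → ZMod 2) → M) :
    (∑ x, if Solution (16 * n) ((input T q).mem 0) ((input T q).mem 1) (bitsOf (T.pull α)) κ x
      then F x else 0) =
    ∑ g : T.Face 1 → ZMod 2, if (∀ e, (α e).val ≠ κ → g e = 0) ∧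
        (κ = 0 → ∀ f, (∀ e ∈ T.facets f, α e = 0) → ((T.facets f).map g).sum = 0)
      then F (T.pull g) else 0 := by
  rw [← Finset.sum_filter, ← Finset.sum_filter]
  symm
  refine Finset.sum_bij (fun g _ => T.pull g) ?_ (fun _ _ _ _ h => T.pull_injective h) ?_
    (fun _ _ => rfl)
  · intro g hg
    rw [Finset.mem_filter] at hg ⊢
    exact ⟨Finset.mem_univ _, (T.solution_iff q α κ _).2 ⟨g, rfl, hg.2⟩⟩
  · intro x hx
    rw [Finset.mem_filter, solution_iff] at hx
    obtain ⟨-, g, rfl, hg⟩ := hx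
    exact ⟨g, by rw [Finset.mem_filter]; exact ⟨Finset.mem_univ _, hg⟩, rfl⟩

open Classical in
theorem solutionDim_eq_log (q : ℕ) (α : T.Face 1 → ZMod 2) (κ : ℕ) :
    solutionDim (16 * n) ((input T q).mem 0) ((input T q).mem 1) (bitsOf (T.pull α)) κ =
      Nat.log 2 (Finset.univ.filter fun g : T.Face 1 → ZMod 2 => (∀ e, (α e).val ≠ κ → g e = 0) ∧
        (κ = 0 → ∀ f, (∀ e ∈ T.facets f, α e = 0) → ((T.facets f).map g).sum = 0)).card := by
  have h := T.sum_solution q α κ fun _ => 1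
  rw [← Finset.sum_filter, ← Finset.sum_filter, ← Finset.card_eq_sum_ones,
    ← Finset.card_eq_sum_ones] at h
  rw [solutionDim, h]

theorem solutionDim_cocycles (q : ℕ) (hT : T.IsOneVertex) :
    solutionDim (16 * n) ((input T q).mem 0) ((input T q).mem 1) 0 0 = T.betti1 := by
  classical
  have h := T.solutionDim_eq_log q 0 0
  rw [pull_zero, bitsOf_zero] at h
  rw [h]
  have hc : (Finset.univ.filter fun g : T.Face 1 → ZMod 2 =>
      (∀ e, ((0 : T.Face 1 → ZMod 2) e).val ≠ 0 → g e = 0) ∧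
        (0 = 0 → ∀ f, (∀ e ∈ T.facets f, (0 : T.Face 1 → ZMod 2) e = 0) →
          ((T.facets f).map g).sum = 0)).card = 2 ^ T.betti1 := by
    rw [← T.card_isCocycle hT, Nat.card_eq_fintype_card, Fintype.card_subtype]
    congr 1
    ext g
    rw [Finset.mem_filter, Finset.mem_filter]
    simp [IsCocycle]
  rw [hc, Nat.log_pow (by omega)]

open Classical in
/-- For `κ = 1` the solutions are all functions supported on the edges of colour `1`, so that the
exponent counts these edges. -/
theorem solutionDim_edges (q : ℕ) (α : T.Face 1 → ZMod 2) :
    solutionDim (16 * n) ((input T q).mem 0) ((input T q).mem 1) (bitsOf (T.pull α)) 1 =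
      (Finset.univ.filter fun e => α e ≠ 0).card := by
  rw [solutionDim_eq_log]
  have hval : ∀ z : ZMod 2, z.val ≠ 1 ↔ z = 0 := by decide
  have hset : (Finset.univ.filter fun g : T.Face 1 → ZMod 2 => (∀ e, (α e).val ≠ 1 → g e = 0) ∧
        (1 = 0 → ∀ f, (∀ e ∈ T.facets f, α e = 0) → ((T.facets f).map g).sum = 0)) =
      Fintype.piFinset fun e => if α e = 0 then {0} else Finset.univ := by
    ext g
    simp only [Finset.mem_filter, Finset.mem_univ, true_and, hval, one_ne_zero, false_imp_iff,
      and_true, Fintype.mem_piFinset]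
    refine forall_congr' fun e => ?_
    split_ifs with h <;> simp [h]
  rw [hset, Fintype.card_piFinset]
  have : ∀ e, (if α e = 0 then ({0} : Finset (ZMod 2)) else Finset.univ).card =
      if α e ≠ 0 then 2 else 1 := by
    intro e
    by_cases h : α e = 0 <;> simp [h, ZMod.card]
  rw [Finset.prod_congr rfl fun e _ => this e, ← Finset.prod_filter, Finset.prod_const,
    Nat.log_pow (by omega)]

end Triangulation

/-! ### The weights for `r = 4` -/

namespace TuraevViro

open WordRAM

/-- The negative of `[2]`. -/
noncomputable def base (q : ℕ) : ℂ := if q = 1 then -(Real.sqrt 2 : ℂ) else (Real.sqrt 2 : ℂ)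

theorem base_sq (q : ℕ) : base q ^ 2 = 2 := by
  have h2 : (Real.sqrt 2 : ℂ) ^ 2 = 2 := by
    rw [← Complex.ofReal_pow, Real.sq_sqrt (by norm_num)]; norm_num
  unfold base
  split_ifs <;> simp [h2]

theorem base_ne_zero (q : ℕ) : base q ≠ 0 := by
  intro h
  have := base_sq q
  rw [h] at this
  norm_num at this

theorem zeta_eq (q : ℕ) : zeta 4 q = Complex.exp ((Real.pi * q / 4 : ℝ) * Complex.I) := by
  unfold zeta
  congr 1
  push_cast
  ring

theorem zeta_inv (q : ℕ) : (zeta 4 q)⁻¹ = Complex.exp (-(Real.pi * q / 4 : ℝ) * Complex.I) := by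
  rw [zeta_eq, ← Complex.exp_neg]
  congr 1
  ring

theorem zeta_ne_zero (q : ℕ) : zeta 4 q ≠ 0 := Complex.exp_ne_zero _

variable {q : ℕ}

theorem zeta_add_inv (hq : q = 1 ∨ q = 3) : zeta 4 q + (zeta 4 q)⁻¹ = -base q := by
  rw [zeta_inv, zeta_eq, ← Complex.two_cos, ← Complex.ofReal_cos]
  rcases hq with rfl | rfl
  · rw [show Real.pi * (1 : ℕ) / 4 = Real.pi / 4 by push_cast; ring, Real.cos_pi_div_four, base,
      if_pos rfl]
    push_cast
    ring
  · rw [show Real.pi * (3 : ℕ) / 4 = Real.pi - Real.pi / 4 by push_cast; ring, Real.cos_pi_sub,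
      Real.cos_pi_div_four, base, if_neg (by decide)]
    push_cast
    ring

theorem zeta_sub_inv_sq (hq : q = 1 ∨ q = 3) : (zeta 4 q - (zeta 4 q)⁻¹) ^ 2 = -2 := by
  have h1 : (zeta 4 q + (zeta 4 q)⁻¹) ^ 2 = 2 := by rw [zeta_add_inv hq, neg_sq, base_sq]
  have h2 := mul_inv_cancel₀ (zeta_ne_zero q)
  linear_combination h1 - 4 * h2

theorem zeta_sub_inv_ne (hq : q = 1 ∨ q = 3) : zeta 4 q - (zeta 4 q)⁻¹ ≠ 0 := by
  intro h
  have := zeta_sub_inv_sq hq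
  rw [h] at this
  norm_num at this

theorem vertexWeight_four (hq : q = 1 ∨ q = 3) : Triangulation.vertexWeight 4 q = 1 / 4 := by
  have : ‖zeta 4 q - (zeta 4 q)⁻¹‖ ^ 2 = 2 := by
    rw [← norm_pow, zeta_sub_inv_sq hq, norm_neg]
    simp
  unfold Triangulation.vertexWeight
  rw [this]
  norm_num

theorem bracket_one (hq : q = 1 ∨ q = 3) : bracket 4 q 1 = 1 := by
  rw [bracket, if_neg (by decide), pow_one, pow_one, div_self (zeta_sub_inv_ne hq)]

theorem bracket_two (hq : q = 1 ∨ q = 3) : bracket 4 q 2 = -base q := by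
  rw [bracket, if_neg (by decide), div_eq_iff (zeta_sub_inv_ne hq), ← zeta_add_inv hq]
  ring

theorem bracket_three (hq : q = 1 ∨ q = 3) : bracket 4 q 3 = 1 := by
  rw [bracket, if_neg (by decide), div_eq_iff (zeta_sub_inv_ne hq), one_mul]
  have h1 := zeta_sub_inv_sq hq
  have h2 := mul_inv_cancel₀ (zeta_ne_zero q)
  generalize zeta 4 q = z at *
  generalize z⁻¹ = y at *
  linear_combination (z - y) * h1 + 3 * (z - y) * h2

theorem bracket_four (hq : q = 1 ∨ q = 3) : bracket 4 q 4 = 0 := by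
  rw [bracket, if_neg (by decide), div_eq_zero_iff]
  left
  have h1 := zeta_sub_inv_sq hq
  have h2 := mul_inv_cancel₀ (zeta_ne_zero q)
  generalize zeta 4 q = z at *
  generalize z⁻¹ = y at *
  linear_combination (z ^ 2 - y ^ 2) * h1 + 2 * (z ^ 2 - y ^ 2) * h2

theorem bracketFact_of_le (hq : q = 1 ∨ q = 3) {k : ℕ} (hk : k ≤ 3) :
    bracketFact 4 q k = (-base q) ^ (k / 2) := by
  have h0 : bracket 4 q 0 = 1 := if_pos rfl
  interval_cases k <;>
    simp [bracketFact, Finset.prod_range_succ, h0, bracket_one hq, bracket_two hq,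
      bracket_three hq]

theorem bracketFact_of_lt (hq : q = 1 ∨ q = 3) {k : ℕ} (hk : 3 < k) :
    bracketFact 4 q k = 0 :=
  Finset.prod_eq_zero (Finset.mem_range.2 (by omega : 4 < k + 1)) (bracket_four hq)

/-- Whether a colour is `1`. -/
def isOne (c : Fin 3) : ZMod 2 := if c = 1 then 1 else 0

/-- Whether a colour is `2`. -/
def isTwo (c : Fin 3) : ZMod 2 := if c = 2 then 1 else 0

/-- Admissibility of the colours of a triangle. -/
abbrev AdmissibleTriple (a b c : Fin 3) : Prop :=
  ((a : ℕ) + b + c) % 2 = 0 ∧ (a : ℕ) ≤ b + c ∧ (b : ℕ) ≤ a + c ∧ (c : ℕ) ≤ a + b ∧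
    (a : ℕ) + b + c ≤ 4

theorem admissibleTriple_iff (a b c : Fin 3) : AdmissibleTriple a b c ↔
    isOne a + isOne b + isOne c = 0 ∧
      ((isOne a = 0 ∧ isOne b = 0 ∧ isOne c = 0) → isTwo a + isTwo b + isTwo c = 0) := by
  revert a b c; decide

theorem edgeWeight_four (hq : q = 1 ∨ q = 3) (c : Fin 3) :
    Triangulation.edgeWeight 4 q c = if isOne c = 0 then 1 else base q := by
  unfold Triangulation.edgeWeight
  fin_cases c
  · simp [isOne, bracket_one hq]
  · simp [isOne, bracket_two hq]
  · simp [isOne, bracket_three hq]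

theorem triangleWeight_four (hq : q = 1 ∨ q = 3) (a b c : Fin 3) (h : AdmissibleTriple a b c) :
    Triangulation.triangleWeight 4 q {(a : ℕ), (b : ℕ), (c : ℕ)} =
      if isOne a = 0 ∧ isOne b = 0 ∧ isOne c = 0 then 1
      else base q / 2 * sgn (isTwo a + isTwo b + isTwo c) := by
  have key : ∀ a b c : Fin 3, AdmissibleTriple a b c →
      ((a : ℕ) + b + c) / 2 ≤ 2 ∧
      if isOne a = 0 ∧ isOne b = 0 ∧ isOne c = 0 then ((a : ℕ) + b + c) / 2 % 2 = 0 ∧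
        (((a : ℕ) + b + c) / 2 - a) / 2 + (((a : ℕ) + b + c) / 2 - b) / 2 +
          (((a : ℕ) + b + c) / 2 - c) / 2 = (((a : ℕ) + b + c) / 2 + 1) / 2
      else (((a : ℕ) + b + c) / 2 - a) / 2 + (((a : ℕ) + b + c) / 2 - b) / 2 +
          (((a : ℕ) + b + c) / 2 - c) / 2 = 0 ∧ (((a : ℕ) + b + c) / 2 + 1) / 2 = 1 ∧
        isTwo a + isTwo b + isTwo c = ((((a : ℕ) + b + c) / 2 + 1 : ℕ) : ZMod 2) := by decide
  obtain ⟨hs, hk⟩ := key a b c h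
  have hsum : (({(a : ℕ), (b : ℕ), (c : ℕ)} : Multiset ℕ)).sum = (a : ℕ) + b + c := by
    simp [add_assoc]
  unfold Triangulation.triangleWeight
  rw [hsum]
  generalize ((a : ℕ) + b + c) / 2 = s at hs hk ⊢
  simp only [Multiset.insert_eq_cons, Multiset.map_cons, Multiset.map_singleton,
    Multiset.prod_cons, Multiset.prod_singleton]
  rw [bracketFact_of_le hq (by omega), bracketFact_of_le hq (by omega),
    bracketFact_of_le hq (by omega), bracketFact_of_le hq (by omega), ← pow_add, ← pow_add,
    ← add_assoc]
  have hb : -base q ≠ 0 := neg_ne_zero.2 (base_ne_zero q)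
  split_ifs at hk ⊢ with h0
  · rw [hk.2, mul_div_assoc, div_self (pow_ne_zero _ hb), mul_one, neg_one_pow_eq_pow_mod_two, hk.1,
      pow_zero]
  · have hsgn : sgn (((s + 1 : ℕ) : ZMod 2)) = -(-1) ^ s := by
      interval_cases s <;> simp [sgn] <;> decide
    rw [hk.1, hk.2.1, hk.2.2, hsgn, pow_zero, pow_one, mul_one, div_eq_iff hb]
    linear_combination (-(-1) ^ s / 2 : ℂ) * base_sq q

/-- The exponents of `[2]` in the summand `z = Z` of the weight of a tetrahedron, where `m` is the
upper summation limit, `P` says that no colour is `1`, and `σ` is the parity of `m' (m' + 1) / 2`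
for the number `m'` of edges of colour `2`.  The exponents cancel if no colour is `1`, and add up to
`1` otherwise. -/
def TetExponents (a₁ a₂ a₃ a₄ b₁ b₂ b₃ Z m : ℕ) (P : Prop) [Decidable P] (σ : ZMod 2) : Prop :=
  (Z ≤ 2 ∧ Z ≤ m ∧ (Z < 2 → m = Z) ∧ b₁ - Z ≤ 3 ∧ b₂ - Z ≤ 3 ∧ b₃ - Z ≤ 3) ∧
    if P then
      Z % 2 = 0 ∧ (Z - a₁) / 2 + (Z - a₂) / 2 + (Z - a₃) / 2 + (Z - a₄) / 2 +
        ((b₁ - Z) / 2 + (b₂ - Z) / 2 + (b₃ - Z) / 2) = (Z + 1) / 2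
    else (Z - a₁) / 2 + (Z - a₂) / 2 + (Z - a₃) / 2 + (Z - a₄) / 2 +
        ((b₁ - Z) / 2 + (b₂ - Z) / 2 + (b₃ - Z) / 2) = 0 ∧ (Z + 1) / 2 = 1 ∧
      σ = ((Z + 1 : ℕ) : ZMod 2)

instance (a₁ a₂ a₃ a₄ b₁ b₂ b₃ Z m : ℕ) (P : Prop) [Decidable P] (σ : ZMod 2) :
    Decidable (TetExponents a₁ a₂ a₃ a₄ b₁ b₂ b₃ Z m P σ) := by
  unfold TetExponents
  infer_instance

/-- For an admissible colouring of a tetrahedron only `z = Z`, the largest of the numbers `a`,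
contributes to the weight, since `[z + 1]! = 0` for `z ≥ 3`. -/
theorem tetExponents : ∀ c₀ c₁ c₃ : Fin 3, AdmissibleTriple c₀ c₁ c₃ →
    ∀ c₂ c₄ : Fin 3, AdmissibleTriple c₀ c₂ c₄ → ∀ c₅ : Fin 3, AdmissibleTriple c₁ c₂ c₅ →
    AdmissibleTriple c₃ c₄ c₅ →
    TetExponents (((c₀ : ℕ) + c₁ + c₃) / 2) (((c₀ : ℕ) + c₂ + c₄) / 2)
      (((c₁ : ℕ) + c₂ + c₅) / 2) (((c₃ : ℕ) + c₄ + c₅) / 2)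
      (((c₀ : ℕ) + c₁ + c₄ + c₅) / 2) (((c₀ : ℕ) + c₂ + c₃ + c₅) / 2)
      (((c₁ : ℕ) + c₂ + c₃ + c₄) / 2)
      (max (max (((c₀ : ℕ) + c₁ + c₃) / 2) (((c₀ : ℕ) + c₂ + c₄) / 2))
        (max (((c₁ : ℕ) + c₂ + c₅) / 2) (((c₃ : ℕ) + c₄ + c₅) / 2)))
      (min (min (((c₀ : ℕ) + c₁ + c₄ + c₅) / 2) (((c₀ : ℕ) + c₂ + c₃ + c₅) / 2))
        (((c₁ : ℕ) + c₂ + c₃ + c₄) / 2))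
      (isOne c₀ = 0 ∧ isOne c₁ = 0 ∧ isOne c₂ = 0 ∧ isOne c₃ = 0 ∧ isOne c₄ = 0 ∧ isOne c₅ = 0)
      (symm12 (isTwo c₀) (isTwo c₁) (isTwo c₂) (isTwo c₃) (isTwo c₄) (isTwo c₅)) := by
  decide +kernel

/-- The weight of a tetrahedron depends on its edges of colour `2` only through the sign
`(-1) ^ symm12`, which tells whether there are any. -/
theorem tetWeight_four (hq : q = 1 ∨ q = 3) {c₀ c₁ c₂ c₃ c₄ c₅ : Fin 3}
    (h₁ : AdmissibleTriple c₀ c₁ c₃) (h₂ : AdmissibleTriple c₀ c₂ c₄)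
    (h₃ : AdmissibleTriple c₁ c₂ c₅) (h₄ : AdmissibleTriple c₃ c₄ c₅) :
    Triangulation.tetWeight 4 q c₀ c₁ c₂ c₃ c₄ c₅ =
      if isOne c₀ = 0 ∧ isOne c₁ = 0 ∧ isOne c₂ = 0 ∧ isOne c₃ = 0 ∧ isOne c₄ = 0 ∧ isOne c₅ = 0
      then 1 else base q *
        sgn (symm12 (isTwo c₀) (isTwo c₁) (isTwo c₂) (isTwo c₃) (isTwo c₄) (isTwo c₅)) := by
  have key := tetExponents c₀ c₁ c₃ h₁ c₂ c₄ h₂ c₅ h₃ h₄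
  unfold Triangulation.tetWeight
  dsimp only
  generalize ((c₀ : ℕ) + c₁ + c₃) / 2 = a₁ at *
  generalize ((c₀ : ℕ) + c₂ + c₄) / 2 = a₂ at *
  generalize ((c₁ : ℕ) + c₂ + c₅) / 2 = a₃ at *
  generalize ((c₃ : ℕ) + c₄ + c₅) / 2 = a₄ at *
  generalize ((c₀ : ℕ) + c₁ + c₄ + c₅) / 2 = b₁ at *
  generalize ((c₀ : ℕ) + c₂ + c₃ + c₅) / 2 = b₂ at *
  generalize ((c₁ : ℕ) + c₂ + c₃ + c₄) / 2 = b₃ at *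
  generalize max (max a₁ a₂) (max a₃ a₄) = Z at *
  generalize min (min b₁ b₂) b₃ = m at *
  obtain ⟨⟨k1, k2, k3, k4, k5, k6⟩, hk⟩ := key
  rw [Finset.sum_eq_single Z ?_ (fun h => absurd (Finset.mem_Icc.2 ⟨le_rfl, k2⟩) h)]
  swap
  · intro z hz hne
    rw [Finset.mem_Icc] at hz
    rw [bracketFact_of_lt hq (by omega : 3 < z + 1), mul_zero, zero_div]
  rw [bracketFact_of_le hq (by omega : Z + 1 ≤ 3), bracketFact_of_le hq (by omega : Z - a₁ ≤ 3),
    bracketFact_of_le hq (by omega : Z - a₂ ≤ 3), bracketFact_of_le hq (by omega : Z - a₃ ≤ 3),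
    bracketFact_of_le hq (by omega : Z - a₄ ≤ 3), bracketFact_of_le hq k4,
    bracketFact_of_le hq k5, bracketFact_of_le hq k6]
  simp only [← pow_add]
  have hb : -base q ≠ 0 := neg_ne_zero.2 (base_ne_zero q)
  split_ifs at hk ⊢ with h0
  · rw [hk.2, mul_div_assoc, div_self (pow_ne_zero _ hb), mul_one, neg_one_pow_eq_pow_mod_two, hk.1,
      pow_zero]
  · have hsgn : sgn (((Z + 1 : ℕ) : ZMod 2)) = -(-1) ^ Z := by
      interval_cases Z <;> simp [sgn] <;> decide
    rw [hk.1, hk.2.1, hk.2.2, hsgn, pow_zero, pow_one, div_one]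
    ring

end TuraevViro

/-! ### The invariant as a sum over cocycles -/

namespace Triangulation

open WordRAM TuraevViro

theorem sgn_sum {ι : Type*} (s : Finset ι) (f : ι → ZMod 2) :
    sgn (∑ i ∈ s, f i) = ∏ i ∈ s, sgn (f i) := by
  classical
  induction s using Finset.induction_on with
  | empty => simp [sgn]
  | insert i s hi ih => rw [Finset.sum_insert hi, Finset.prod_insert hi, sgn_add, ih]

variable {n : ℕ} (T : Triangulation n) {q : ℕ}

theorem admissible_iff (θ : T.Colouring 4) :
    T.Admissible 4 θ ↔ ∀ f e₁ e₂ e₃, T.facets f = {e₁, e₂, e₃} →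
      AdmissibleTriple (θ e₁) (θ e₂) (θ e₃) := by
  constructor
  · intro h f e₁ e₂ e₃ hf
    obtain ⟨h1, h2, h3⟩ := h f e₁ e₂ e₃ hf
    obtain ⟨-, h4, -⟩ := h f e₂ e₁ e₃ (by rw [hf]; exact Multiset.cons_swap _ _ _)
    obtain ⟨-, h5, -⟩ := h f e₃ e₁ e₂ (hf.trans ((congrArg (e₁ ::ₘ ·)
      (Multiset.cons_swap e₂ e₃ 0)).trans (Multiset.cons_swap e₁ e₃ _)))
    exact ⟨Nat.even_iff.1 h1, h2, h4, h5, h3⟩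
  · intro h f e₁ e₂ e₃ hf
    obtain ⟨h1, h2, -, -, h3⟩ := h f e₁ e₂ e₃ hf
    exact ⟨Nat.even_iff.2 h1, h2, h3⟩

/-- The functions `g` that can be the indicator of the edges of colour `2` if `α` is that of the
edges of colour `1`. -/
def Compatible (α g : T.Face 1 → ZMod 2) : Prop :=
  (∀ e, (α e).val ≠ 0 → g e = 0) ∧
    ∀ f, (∀ e ∈ T.facets f, α e = 0) → ((T.facets f).map g).sum = 0

/-- A colouring is admissible if and only if the edges of colour `1` form a cocycle and the edges of
colour `2` satisfy the cocycle equation on the triangles without edges of colour `1`. -/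
theorem admissible_iff_cocycle (θ : T.Colouring 4) :
    T.Admissible 4 θ ↔ T.IsCocycle (fun e => isOne (θ e)) ∧
      T.Compatible (fun e => isOne (θ e)) (fun e => isTwo (θ e)) := by
  have h12 : ∀ c : Fin 3, (isOne c).val ≠ 0 → isTwo c = 0 := by decide
  rw [admissible_iff]
  simp only [admissibleTriple_iff]
  constructor
  · intro h
    refine ⟨fun f => ?_, fun e => h12 _, fun f hf => ?_⟩ <;>
    obtain ⟨e₁, e₂, e₃, hf'⟩ := Multiset.card_eq_three.1 (T.card_facets f) <;>
    have := h f e₁ e₂ e₃ hf'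
    · rw [hf']
      simpa [add_assoc] using this.1
    · rw [hf'] at hf ⊢
      simp only [Multiset.insert_eq_cons, Multiset.mem_cons, Multiset.mem_singleton,
        forall_eq_or_imp, forall_eq] at hf
      simpa [add_assoc] using this.2 hf
  · rintro ⟨h1, -, h2⟩ f e₁ e₂ e₃ hf
    have h1 := h1 f
    have h2 := h2 f
    rw [hf] at h1 h2
    simp only [Multiset.insert_eq_cons, Multiset.mem_cons, Multiset.mem_singleton,
        forall_eq_or_imp, forall_eq] at h2
    exact ⟨by simpa [add_assoc] using h1, fun h => by simpa [add_assoc] using h2 h⟩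

theorem sum_range_faceIndex {M : Type*} [AddCommMonoid M] (F : ℕ → M) :
    ∑ p ∈ Finset.range (4 * n), F p = ∑ p : Fin n × Fin 4, F (faceIndex p) := by
  symm
  refine Finset.sum_bij (fun p _ => faceIndex p) ?_ (fun _ _ _ _ h => faceIndex_injective h) ?_
    (fun _ _ => rfl)
  · rintro ⟨t, i⟩ -
    rw [Finset.mem_range]
    dsimp only [faceIndex]
    omega
  · intro p hp
    have hp := Finset.mem_range.1 hp
    exact ⟨(⟨p / 4, by omega⟩, ⟨p % 4, by omega⟩), Finset.mem_univ _, by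
      dsimp only [faceIndex]; omega⟩

theorem val_add_three_eq_zero : ∀ a b c : ZMod 2,
    a.val + b.val + c.val = 0 ↔ a = 0 ∧ b = 0 ∧ c = 0 := by decide

section
variable (α g : T.Face 1 → ZMod 2)

theorem face_cells (t : Fin n) (i : Fin 4) :
    (faceIndex (t, i) / 4 * 16 + 4 * ((faceIndex (t, i) + 1) % 4) + (faceIndex (t, i) + 2) % 4 =
      16 * t + 4 * (i + 1 : Fin 4) + (i + 2 : Fin 4) ∧
    faceIndex (t, i) / 4 * 16 + 4 * ((faceIndex (t, i) + 2) % 4) + (faceIndex (t, i) + 3) % 4 =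
      16 * t + 4 * (i + 2 : Fin 4) + (i + 3 : Fin 4)) ∧
    faceIndex (t, i) / 4 * 16 + 4 * ((faceIndex (t, i) + 3) % 4) + (faceIndex (t, i) + 1) % 4 =
      16 * t + 4 * (i + 3 : Fin 4) + (i + 1 : Fin 4) := by
  have h1 : ((i + 1 : Fin 4) : ℕ) = (i + 1) % 4 := rfl
  have h2 : ((i + 2 : Fin 4) : ℕ) = (i + 2) % 4 := rfl
  have h3 : ((i + 3 : Fin 4) : ℕ) = (i + 3) % 4 := rfl
  rw [h1, h2, h3]
  dsimp only [faceIndex]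
  omega

theorem phiOf_faceIndex (t : Fin n) (i : Fin 4) :
    phiOf ((input T q).mem 0) ((input T q).mem 1) (bitsOf (T.pull α)) (faceIndex (t, i)) =
      if ¬(T.edgeVal α t (i + 1) (i + 2) = 0 ∧ T.edgeVal α t (i + 2) (i + 3) = 0 ∧
        T.edgeVal α t (i + 3) (i + 1) = 0) ∧
        faceIndex (t, i) < faceIndex (T.partner (t, i)) then 1 else 0 := by
  obtain ⟨⟨h1, h2⟩, h3⟩ := face_cells t i
  have h4 : faceIndex (t, i) / 4 * 16 + 4 * (faceIndex (t, i) % 4) + faceIndex (t, i) % 4 =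
      16 * (t : ℕ) + 4 * i + i := by
    dsimp only [faceIndex]; omega
  have h5 : faceIndex (t, i) = 4 * (t : ℕ) + i := rfl
  rw [phiOf, h1, h2, h3, h4, bitsOf_pull, bitsOf_pull, bitsOf_pull, input_glue, h5, input_adj]
  simp only [ne_eq, val_add_three_eq_zero]
  rfl

theorem faceSum_faceIndex (t : Fin n) (i : Fin 4) :
    faceSum (T.pull g) (faceIndex (t, i)) = T.edgeVal g t (i + 1) (i + 2) +
      T.edgeVal g t (i + 2) (i + 3) + T.edgeVal g t (i + 3) (i + 1) := by
  obtain ⟨⟨h1, h2⟩, h3⟩ := face_cells t i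
  rw [faceSum, h1, h2, h3, coord_pull, coord_pull, coord_pull]

theorem tauOf_pull (t : Fin n) :
    tauOf (bitsOf (T.pull α)) t = if T.edgeVal α t 0 1 = 0 ∧ T.edgeVal α t 0 2 = 0 ∧
      T.edgeVal α t 0 3 = 0 ∧ T.edgeVal α t 1 2 = 0 ∧ T.edgeVal α t 1 3 = 0 ∧
      T.edgeVal α t 2 3 = 0 then 0 else 1 := by
  have h : ∀ a b c d e f : ZMod 2, a.val + b.val + c.val + d.val + e.val + f.val = 0 ↔
    a = 0 ∧ b = 0 ∧ c = 0 ∧ d = 0 ∧ e = 0 ∧ f = 0 := by decide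
  refine if_congr ?_ rfl rfl
  rw [← h]
  simp only [← bitsOf_pull]
  rfl

theorem quadTet_pull (t : Fin n) :
    quadTet (T.pull g) (16 * t) = symm12 (T.edgeVal g t 0 1) (T.edgeVal g t 0 2)
      (T.edgeVal g t 0 3) (T.edgeVal g t 1 2) (T.edgeVal g t 1 3) (T.edgeVal g t 2 3) := by
  simp only [← coord_pull]
  rfl

end

theorem admissibleTriple_edges {θ : T.Colouring 4} (hθ : T.Admissible 4 θ) (t : Fin n)
    {a b c : Fin 4} (hab : a ≠ b) (hac : a ≠ c) (hbc : b ≠ c) :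
    AdmissibleTriple (θ (T.edge t a b hab)) (θ (T.edge t a c hac)) (θ (T.edge t b c hbc)) := by
  have h := (T.admissible_iff θ).1 hθ _ _ _ _ (T.facets_triangle t hab hac hbc)
  rw [← T.edge_comm t hac] at h
  unfold AdmissibleTriple at h ⊢
  omega

/-- The weight of the colouring with edges of colour `1` given by `α` and edges of colour `2` given
by `g`. -/
noncomputable def pairWeight (q : ℕ) (α g : T.Face 1 → ZMod 2) : ℂ :=
  1 / 4 * base q ^ (solutionDim (16 * n) ((input T q).mem 0) ((input T q).mem 1)
      (bitsOf (T.pull α)) 1 +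
    ∑ p ∈ Finset.range (4 * n), phiOf ((input T q).mem 0) ((input T q).mem 1)
      (bitsOf (T.pull α)) p + ∑ t ∈ Finset.range n, tauOf (bitsOf (T.pull α)) t) /
    2 ^ (∑ p ∈ Finset.range (4 * n), phiOf ((input T q).mem 0) ((input T q).mem 1)
      (bitsOf (T.pull α)) p) *
    sgn (quad n (tauOf (bitsOf (T.pull α))) (phiOf ((input T q).mem 0) ((input T q).mem 1)
      (bitsOf (T.pull α))) (T.pull g))

theorem prod_triangleWeight (hq : q = 1 ∨ q = 3) {θ : T.Colouring 4} (hθ : T.Admissible 4 θ) :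
    ∏ f : T.Face 2, triangleWeight 4 q ((T.facets f).map fun e => (θ e : ℕ)) =
      (base q / 2) ^ (∑ p ∈ Finset.range (4 * n), phiOf ((input T q).mem 0) ((input T q).mem 1)
        (bitsOf (T.pull fun e => isOne (θ e))) p) *
      sgn (∑ p ∈ Finset.range (4 * n), (phiOf ((input T q).mem 0) ((input T q).mem 1)
        (bitsOf (T.pull fun e => isOne (θ e))) p : ZMod 2) *
          faceSum (T.pull fun e => isTwo (θ e)) p) := by
  rw [prod_face, sum_range_faceIndex, sum_range_faceIndex, ← Finset.prod_pow_eq_pow_sum, sgn_sum,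
    ← Finset.prod_mul_distrib]
  refine Finset.prod_congr rfl ?_
  rintro ⟨t, i⟩ -
  have h1 : i + 1 ≠ i + 2 := by revert i; decide
  have h2 : i + 2 ≠ i + 3 := by revert i; decide
  have h3 : i + 3 ≠ i + 1 := by revert i; decide
  rw [phiOf_faceIndex, faceSum_faceIndex, edgeVal_of_ne _ _ _ h1, edgeVal_of_ne _ _ _ h2,
    edgeVal_of_ne _ _ _ h3, edgeVal_of_ne _ _ _ h1, edgeVal_of_ne _ _ _ h2,
    edgeVal_of_ne _ _ _ h3]
  have hfacets := T.facets_triangle t h1 h3.symm h2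
  have hadm := (T.admissible_iff θ).1 hθ _ _ _ _ hfacets
  have hw := triangleWeight_four hq _ _ _ hadm
  rw [face_eq_triangle, hfacets]
  simp only [Multiset.insert_eq_cons, Multiset.map_cons, Multiset.map_singleton] at hw ⊢
  rw [hw]
  by_cases hlt : faceIndex (t, i) < faceIndex (T.partner (t, i))
  · simp only [hlt, if_true, and_true]
    split_ifs with h0
    · simp [sgn]
    · simp
  · simp [hlt, sgn]

theorem prod_tetWeight (hq : q = 1 ∨ q = 3) {θ : T.Colouring 4} (hθ : T.Admissible 4 θ) :
    (∏ t : Fin n, tetWeight 4 q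
      (θ (T.edge t 0 1 (by decide))) (θ (T.edge t 0 2 (by decide))) (θ (T.edge t 0 3 (by decide)))
      (θ (T.edge t 1 2 (by decide))) (θ (T.edge t 1 3 (by decide)))
      (θ (T.edge t 2 3 (by decide)))) =
      base q ^ (∑ t ∈ Finset.range n, tauOf (bitsOf (T.pull fun e => isOne (θ e))) t) *
      sgn (∑ t ∈ Finset.range n, (tauOf (bitsOf (T.pull fun e => isOne (θ e))) t : ZMod 2) *
          quadTet (T.pull fun e => isTwo (θ e)) (16 * t)) := by
  rw [Finset.sum_range, Finset.sum_range, ← Finset.prod_pow_eq_pow_sum, sgn_sum,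
    ← Finset.prod_mul_distrib]
  refine Finset.prod_congr rfl fun t _ => ?_
  rw [tauOf_pull, quadTet_pull]
  simp only [T.edgeVal_of_ne _ t (show (0 : Fin 4) ≠ 1 by decide),
    T.edgeVal_of_ne _ t (show (0 : Fin 4) ≠ 2 by decide),
    T.edgeVal_of_ne _ t (show (0 : Fin 4) ≠ 3 by decide),
    T.edgeVal_of_ne _ t (show (1 : Fin 4) ≠ 2 by decide),
    T.edgeVal_of_ne _ t (show (1 : Fin 4) ≠ 3 by decide),
    T.edgeVal_of_ne _ t (show (2 : Fin 4) ≠ 3 by decide)]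
  have hw := tetWeight_four hq
    (T.admissibleTriple_edges hθ t (a := 0) (b := 1) (c := 2) (by decide) (by decide) (by decide))
    (T.admissibleTriple_edges hθ t (a := 0) (b := 1) (c := 3) (by decide) (by decide) (by decide))
    (T.admissibleTriple_edges hθ t (a := 0) (b := 2) (c := 3) (by decide) (by decide) (by decide))
    (T.admissibleTriple_edges hθ t (a := 1) (b := 2) (c := 3) (by decide) (by decide) (by decide))
  refine hw.trans ?_
  split_ifs with h0
  · simp [sgn]
  · simp

theorem weight_eq (hT : T.IsOneVertex) (hq : q = 1 ∨ q = 3) {θ : T.Colouring 4}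
    (hθ : T.Admissible 4 θ) :
    T.weight 4 q θ = T.pairWeight q (fun e => isOne (θ e)) (fun e => isTwo (θ e)) := by
  classical
  rw [weight, T.prod_triangleWeight hq hθ, T.prod_tetWeight hq hθ, Finset.prod_const,
    Finset.card_univ, ← Nat.card_eq_fintype_card, hT, pow_one, vertexWeight_four hq,
    Finset.prod_congr rfl fun e _ => edgeWeight_four hq (θ e), pairWeight, solutionDim_edges, quad,
    sgn_add]
  rw [Finset.prod_ite, Finset.prod_const_one, one_mul, Finset.prod_const, pow_add, pow_add, div_pow]
  ring

open Classical in
theorem TV_eq (hT : T.IsOneVertex) (hq : q = 1 ∨ q = 3) :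
    T.TV 4 q = ∑ x : Fin (16 * n) → ZMod 2,
      if Solution (16 * n) ((input T q).mem 0) ((input T q).mem 1) 0 0 x then
        cocycleWeight n ((input T q).mem 0) ((input T q).mem 1) (bitsOf x) q else 0 := by
  have h0 : (∑ x : Fin (16 * n) → ZMod 2,
      if Solution (16 * n) ((input T q).mem 0) ((input T q).mem 1) 0 0 x then
        cocycleWeight n ((input T q).mem 0) ((input T q).mem 1) (bitsOf x) q else 0) =
      ∑ α, if T.IsCocycle α then
        cocycleWeight n ((input T q).mem 0) ((input T q).mem 1) (bitsOf (T.pull α)) q else 0 := by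
    have h := T.sum_solution q 0 0
      (fun x => cocycleWeight n ((input T q).mem 0) ((input T q).mem 1) (bitsOf x) q)
    rw [pull_zero, bitsOf_zero] at h
    exact h.trans (Finset.sum_congr rfl fun α _ => if_congr (by simp [IsCocycle]) rfl rfl)
  have h1 : ∀ α : T.Face 1 → ZMod 2,
      cocycleWeight n ((input T q).mem 0) ((input T q).mem 1) (bitsOf (T.pull α)) q =
      ∑ g, if T.Compatible α g then T.pairWeight q α g else 0 := by
    intro α
    rw [cocycleWeight, sum_solution, Finset.mul_sum]
    refine Finset.sum_congr rfl fun g _ => ?_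
    rw [mul_ite, mul_zero]
    exact if_congr (by simp [Compatible]) rfl rfl
  rw [h0]
  simp only [h1]
  rw [TV, Finset.sum_congr rfl fun θ hθ => T.weight_eq hT hq (Finset.mem_filter.1 hθ).2]
  have h3 : ∑ α : T.Face 1 → ZMod 2, (if T.IsCocycle α then
      ∑ g, if T.Compatible α g then T.pairWeight q α g else 0 else 0) =
      ∑ z ∈ (Finset.univ : Finset ((T.Face 1 → ZMod 2) × (T.Face 1 → ZMod 2))).filter
        (fun z => T.IsCocycle z.1 ∧ T.Compatible z.1 z.2), T.pairWeight q z.1 z.2 := by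
    rw [Finset.sum_filter, Fintype.sum_prod_type]
    refine Finset.sum_congr rfl fun α _ => ?_
    by_cases h : T.IsCocycle α <;> simp [h]
  rw [h3]
  refine Finset.sum_bij (fun θ _ => (fun e => isOne (θ e), fun e => isTwo (θ e))) ?_ ?_ ?_
    (fun _ _ => rfl)
  · intro θ hθ
    rw [Finset.mem_filter] at hθ ⊢
    exact ⟨Finset.mem_univ _, (T.admissible_iff_cocycle θ).1 hθ.2⟩
  · intro θ _ θ' _ h
    have hinj : ∀ c c' : Fin 3, isOne c = isOne c' → isTwo c = isTwo c' → c = c' := by decide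
    ext1 e
    obtain ⟨h1, h2⟩ := Prod.mk.inj h
    exact hinj _ _ (congrFun h1 e) (congrFun h2 e)
  · rintro ⟨α, g⟩ hz
    rw [Finset.mem_filter] at hz
    obtain ⟨-, hα, hg⟩ := hz
    let c : ZMod 2 → ZMod 2 → Fin 3 := fun a x => if a ≠ 0 then 1 else if x ≠ 0 then 2 else 0
    have c1 : ∀ a x, isOne (c a x) = a := by decide
    have c2 : ∀ a x, (a.val ≠ 0 → x = 0) → isTwo (c a x) = x := by decide
    have e1 : (fun e => isOne (c (α e) (g e))) = α := funext fun e => c1 _ _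
    have e2 : (fun e => isTwo (c (α e) (g e))) = g := funext fun e => c2 _ _ (hg.1 e)
    refine ⟨fun e => c (α e) (g e), ?_, Prod.ext e1 e2⟩
    rw [Finset.mem_filter]
    refine ⟨Finset.mem_univ _, (T.admissible_iff_cocycle _).2 ?_⟩
    rw [e1, e2]
    exact ⟨hα, hg⟩

end Triangulation

/-! ### The algorithm -/

theorem Triangulation.IsOneVertex.pos {n : ℕ} {T : Triangulation n} (hT : T.IsOneVertex) :
    1 ≤ n := by
  obtain ⟨v⟩ := (Nat.card_eq_one_iff_unique.1 hT).2
  induction v using Quot.ind with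
  | mk f => exact Nat.one_le_iff_ne_zero.2 fun h => (h ▸ f.1).elim0

open WordRAM in
/-- The bound `10 ^ 9` absorbs the constants of `run_main`: with `N = 16 n`, the time is at most
`300 · 400 · 2 ^ β₁ · N³ = 491520000 · 2 ^ β₁ · n³`, and `4 N² = 1024 n²` cells and words of that
size suffice. -/
theorem exists_exec_main {C : ℕ} (hC : 10 ^ 9 ≤ C) {n : ℕ} (T : Triangulation n)
    (hT : T.IsOneVertex) {q : ℕ} (hq : q = 1 ∨ q = 3) :
    ∃ (s : State) (t : ℕ), Exec ((n + 1) ^ C) (C * n ^ 2) main (input T q) s t ∧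
      t ≤ C * 2 ^ T.betti1 * n ^ 3 ∧ s.Outputs (T.TV 4 q) := by
  have hn := hT.pos
  have h2 : 1024 * n ^ 2 ≤ C * n ^ 2 := Nat.mul_le_mul_right _ (by omega)
  have h3 : 1024 * n ^ 2 ≤ (n + 1) ^ C := by
    calc 1024 * n ^ 2 = 2 ^ 10 * n ^ 2 := by norm_num
      _ ≤ (n + 1) ^ 10 * (n + 1) ^ 2 :=
        Nat.mul_le_mul (Nat.pow_le_pow_left (by omega) _) (Nat.pow_le_pow_left (by omega) _)
      _ = (n + 1) ^ 12 := by ring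
      _ ≤ (n + 1) ^ C := Nat.pow_le_pow_right (by omega) (by omega)
  have h4 : 4 * (16 * n * (16 * n)) = 1024 * n ^ 2 := by ring
  have hB : Big ((n + 1) ^ C) (C * n ^ 2) (16 * n) := ⟨by omega, by omega, by omega⟩
  obtain ⟨s, t, hs, ht, hout⟩ := run_main hB rfl (T.tables_input q) (s := input T q) (q := q)
    rfl rfl (fun x hx => by simp [input, show x ≠ 0 by omega, show x ≠ 1 by omega]) rfl rfl
    (fun a ha => by ext j; simp [input, show a ≠ 0 by omega, show a ≠ 1 by omega])
  refine ⟨s, t, hs, ht.trans ?_, ?_⟩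
  · rw [T.solutionDim_cocycles q hT]
    calc 300 * (400 * (2 ^ T.betti1 * (16 * n * (16 * n * (16 * n)))))
        = 491520000 * 2 ^ T.betti1 * n ^ 3 := by ring
      _ ≤ C * 2 ^ T.betti1 * n ^ 3 :=
        Nat.mul_le_mul_right _ (Nat.mul_le_mul_right _ (by omega))
  · rw [T.TV_eq hT hq]
    exact hout

theorem mainTheorem1 :
    ∃ (P : WordRAM.Prog) (C : ℕ),
      ∀ (n : ℕ) (T : Triangulation n), T.IsClosedManifold → T.IsOneVertex →
        ∀ q : ℕ, (q = 1 ∨ q = 3) →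
          ∃ (s : WordRAM.State) (t : ℕ),
            WordRAM.Exec ((n + 1) ^ C) (C * n ^ 2) P (WordRAM.input T q) s t ∧
            t ≤ C * 2 ^ T.betti1 * n ^ 3 ∧
            s.Outputs (T.TV 4 q) :=
  ⟨WordRAM.main, 10 ^ 9, fun _ T _ hT _ hq => exists_exec_main le_rfl T hT hq⟩
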